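/- Let $SU(2)$ be identified with the round three-sphere of radius $2$, with Riemannian volume measure $\mu$ (the bi-invariant measure of total mass $16\pi^2$). For $\ell\in\frac12\mathbb N=\{0,\frac12,1,\dots\}$ and $m,s\in\{-\ell,-\ell+1,\dots,\ell\}$ let $\psi^\ell_m(z_0,z_1)=\binom{2\ell}{\ell+m}^{1/2}z_0^{\ell+m}z_1^{\ell-m}$, let the Wigner functions $D^\ell_{m,s}\colon SU(2)\to\mathbb C$ be defined by the polynomial identity $\sum_{m}\psi^\ell_m(z_0,z_1)\,D^\ell_{m,s}(g)=\psi^\ell_s\big(g^{-1}(z_0,z_1)^T\big)$, and let $\phi^\ell_{m,s}=\frac{\sqrt{2\ell+1}}{4\pi}D^\ell_{m,s}$; these functions form an orthonormal basis of $L^2(SU(2),\mu)$. Let $(\Omega,\mathbb P)$ be a probability space. A complex random variable is called complex Gaussian if it has the law of $\frac{\sigma}{\sqrt2}(\xi_1+i\xi_2)$ for some $\sigma\in\mathbb R$ and independent $\xi_1,\xi_2\sim N(0,1)$; a random vector $V\in\mathbb C^N$ is complex Gaussian if all $\mathbb C$-linear combinations of its components are, and $V\sim N_{\mathbb C}(0,K)$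 means that moreover $\mathbb E\{V\overline V^T\}=K$. A random field $X\colon SU(2)\to\mathbb C$ is a jointly measurable function $X\colon\Omega\times SU(2)\to\mathbb C$; it is complex Gaussian if $(X(g_1),\dots,X(g_N))$ is a complex Gaussian vector for all $g_1,\dots,g_N\in SU(2)$. Its coefficients and its components of degree $2\ell$ are $$a^\ell_{m,s}=\int_{SU(2)}X\,\overline{\phi^\ell_{m,s}}\,d\mu,\qquad X^\ell=\sum_{m,s}a^\ell_{m,s}\phi^\ell_{m,s},$$ and we write $a^\ell_{\bullet,s}=(a^\ell_{m,s})_{m}$ and $a^\ell_{m,\bullet}=(a^\ell_{m,s})_{s}$, which are vectors in $\mathbb C^{2\ell+1}$. We say that $X$ *has a harmonic expansion* if $X\in L^2(SU(2),\mu)$ almost surely and, for every $g\in SU(2)$, $X(g)=\sum_{\ell}X^\ell(g)$ almost surely (the sum being taken in increasing order of $\ell$). The field $X$ is *strongly left-invariant* (respectively *right-invariant*, *bi-invariant*) if $X\circ\varphi$ and $X$ have the same finite-dimensional distributions for every $\varphi$ of the form $z\mapsto g^{-1}z$ (respectively $z\mapsto zg$, $z\mapsto g^{-1}zg'$). It is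 *2-weakly* left-, right- or bi-invariant if $\mathbb E|X(g)|^2<\infty$ for all $g$ and, for all $\varphi$ of the respective form, $X\circ\varphi$ and $X$ have the same joint moments of order at most two (where each variable may be conjugated). **Theorem.** Let $X\colon SU(2)\to\mathbb C$ be a complex Gaussian random field. 1. $X$ is 2-weakly left-invariant (respectively right-invariant, bi-invariant) if and only if it is strongly left-invariant (respectively right-invariant, bi-invariant). 2. $X$ is left-invariant if and only if it has a harmonic expansion, the fields $X^\ell$, $\ell\in\frac12\mathbb N$, are independent, and there are $\sigma(\ell,s)\in\mathbb R$ and $K(\ell;s,s')\in\mathbb C$ such that for all $\ell$ and all $s,s'$ $$a^\ell_{\bullet,s}\sim N_{\mathbb C}\big(0,\sigma(\ell,s)^2\mathbb 1_{2\ell+1}\big),\qquad \mathbb E\big\{a^\ell_{\bullet,s}\,\overline{a^\ell_{\bullet,s'}}^{\,T}\big\}=K(\ell;s,s')\,\mathbb 1_{2\ell+1}.$$ 3. $X$ is right-invariant if and only if it has a harmonic expansion, the fields $X^\ell$, $\ell\in\frac12\mathbb N$, are independent, and there are $\sigma(\ell,m)\in\mathbb R$ and $K(\ell;m,m')\in\mathbb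 C$ such that for all $\ell$ and all $m,m'$ $$a^\ell_{m,\bullet}\sim N_{\mathbb C}\big(0,\sigma(\ell,m)^2\mathbb 1_{2\ell+1}\big),\qquad \mathbb E\big\{a^\ell_{m,\bullet}\,\overline{a^\ell_{m',\bullet}}^{\,T}\big\}=K(\ell;m,m')\,\mathbb 1_{2\ell+1}.$$ 4. $X$ is bi-invariant if and only if it has a harmonic expansion, all the variables $a^\ell_{m,s}$ form an independent family, and there are $\sigma(\ell)\in\mathbb R$ such that $a^\ell_{\bullet,s}\sim N_{\mathbb C}\big(0,\sigma(\ell)^2\mathbb 1_{2\ell+1}\big)$ for all $\ell$ and $s$. -/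

import Mathlib

open MeasureTheory ProbabilityTheory Filter Topology
open scoped ComplexConjugate

/-- The group `SU(2)`. -/
abbrev SU2 : Type := Matrix.specialUnitaryGroup (Fin 2) ℂ

noncomputable section

instance SU2.instMeasurableSpace : MeasurableSpace SU2 := borel SU2

instance SU2.instBorelSpace : BorelSpace SU2 := ⟨rfl⟩

instance SU2.instIsTopologicalGroup : IsTopologicalGroup SU2 where
  continuous_inv :=
    Continuous.subtype_mk (continuous_star.comp continuous_subtype_val) _

theorem SU2.isCompact_carrier :
    IsCompact ((Matrix.specialUnitaryGroup (Fin 2) ℂ : Set (Matrix (Fin 2) (Fin 2) ℂ))) := by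
  have hK : IsCompact (Set.pi Set.univ fun _ : Fin 2 =>
      (Set.pi Set.univ fun _ : Fin 2 => Metric.closedBall (0 : ℂ) 1)) :=
    isCompact_univ_pi fun _ => isCompact_univ_pi fun _ => isCompact_closedBall 0 1
  have hcl : IsClosed
      ((Matrix.specialUnitaryGroup (Fin 2) ℂ : Set (Matrix (Fin 2) (Fin 2) ℂ))) := by
    have heq : ((Matrix.specialUnitaryGroup (Fin 2) ℂ : Set (Matrix (Fin 2) (Fin 2) ℂ)))
        = {A | A * star A = 1} ∩ {A | A.det = 1} := by
      ext A
      simp only [SetLike.mem_coe, Matrix.mem_specialUnitaryGroup_iff,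
        Matrix.mem_unitaryGroup_iff, Set.mem_inter_iff, Set.mem_ofPred_eq]
    rw [heq]
    exact (isClosed_eq (by fun_prop) continuous_const).inter
      (isClosed_eq (by fun_prop) continuous_const)
  refine hK.of_isClosed_subset hcl ?_
  intro A hA i _ j _
  rw [mem_closedBall_zero_iff]
  exact entry_norm_bound_of_unitary (Matrix.mem_specialUnitaryGroup_iff.1 hA).1 i j

instance SU2.instCompactSpace : CompactSpace SU2 :=
  isCompact_iff_compactSpace.1 SU2.isCompact_carrier

/-! ### Harmonic analysis on `SU(2)`

The half-integer degree `ℓ` is encoded by `n = 2ℓ : ℕ`, and an index `m ∈ {-ℓ, …, ℓ}` by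
`ℓ + m : Fin (n + 1)`. -/

/-- The Riemannian volume of `SU(2)`, seen as the round three-sphere of radius `2`: the
bi-invariant measure of total mass `16 π ^ 2`. -/
def volSU2 : Measure SU2 :=
  ENNReal.ofReal (16 * Real.pi ^ 2) •
    Measure.haarMeasure (⊤ : TopologicalSpace.PositiveCompacts SU2)

/-- The Wigner function `D^ℓ_{m,s}`, with `n = 2ℓ`, `i = ℓ + m`, `j = ℓ + s`. For
`ψ^ℓ_m(z₀, z₁) = √(2ℓ choose ℓ+m) z₀^(ℓ+m) z₁^(ℓ-m)` and `g` with first column `(α, β)`, it is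
defined by the polynomial identity
`∑ₘ ψ^ℓ_m(z₀, z₁) D^ℓ_{m,s}(g) = ψ^ℓ_s(g⁻¹ (z₀, z₁)) = ψ^ℓ_s(conj α z₀ + conj β z₁, -β z₀ + α z₁)`;
the code reads off the coefficient of `z₀^(ℓ+m)` after setting `z₁ = 1`. -/
def wignerD (n : ℕ) (i j : Fin (n + 1)) (g : SU2) : ℂ :=
  ((√(n.choose j : ℝ) / √(n.choose i : ℝ) : ℝ) : ℂ) *
    ((Polynomial.C (conj (g.1 0 0)) * Polynomial.X + Polynomial.C (conj (g.1 1 0))) ^ (j : ℕ) *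
      (Polynomial.C (-(g.1 1 0)) * Polynomial.X + Polynomial.C (g.1 0 0)) ^ (n - (j : ℕ))).coeff i

/-- The hyperspherical harmonic `φ^ℓ_{m,s} = √(2ℓ+1) / (4π) · D^ℓ_{m,s}`. -/
def hypersphericalHarmonic (n : ℕ) (i j : Fin (n + 1)) (g : SU2) : ℂ :=
  ((√(n + 1 : ℝ) / (4 * Real.pi) : ℝ) : ℂ) * wignerD n i j g

section Field

variable {Ω : Type*} (X : Ω → SU2 → ℂ)

/-- The random Fourier coefficient `a^ℓ_{m,s} = ∫ X(g) conj (φ^ℓ_{m,s}(g)) dg`. -/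
def fourierCoeffSU2 (n : ℕ) (i j : Fin (n + 1)) (ω : Ω) : ℂ :=
  ∫ g, X ω g * conj (hypersphericalHarmonic n i j g) ∂volSU2

/-- The component `X^ℓ = ∑_{m,s} a^ℓ_{m,s} φ^ℓ_{m,s}` of the random field `X`. -/
def degreeComponent (n : ℕ) (ω : Ω) (g : SU2) : ℂ :=
  ∑ i, ∑ j, fourierCoeffSU2 X n i j ω * hypersphericalHarmonic n i j g

variable [MeasurableSpace Ω] (P : Measure Ω)

/-- `X` is almost surely square integrable, and for every `g ∈ SU(2)` its harmonic expansion
`X(g) = ∑_ℓ X^ℓ(g)` holds almost surely. -/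
def HasHarmonicExpansion : Prop :=
  (∀ᵐ ω ∂P, MemLp (X ω) 2 volSU2) ∧
  ∀ g, ∀ᵐ ω ∂P,
    Tendsto (fun N : ℕ => ∑ n ∈ Finset.range N, degreeComponent X n ω g) atTop (𝓝 (X ω g))

/-! ### Invariance -/

/-- The maps `z ↦ g⁻¹ z`. -/
def leftTranslations : Set (SU2 → SU2) := {φ | ∃ g, φ = fun z => g⁻¹ * z}

/-- The maps `z ↦ z g`. -/
def rightTranslations : Set (SU2 → SU2) := {φ | ∃ g, φ = fun z => z * g}

/-- The maps `z ↦ g⁻¹ z g'`. -/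
def biTranslations : Set (SU2 → SU2) := {φ | ∃ g g', φ = fun z => g⁻¹ * z * g'}

/-- Strong invariance under a set `T` of maps: for `φ ∈ T`, the fields `X ∘ φ` and `X` have the
same law in the space of functions `SU2 → ℂ` with the product σ-algebra, i.e. the same
finite-dimensional distributions. -/
def StronglyInvariant (T : Set (SU2 → SU2)) : Prop :=
  ∀ φ ∈ T, IdentDistrib (fun ω z => X ω (φ z)) (fun ω z => X ω z) P P

/-- 2-weak invariance under a set `T` of maps: the moments of order at most two are finite, and for
`φ ∈ T` the fields `X ∘ φ` and `X` have the same joint moments of order at most two, where each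
variable may be conjugated. -/
def TwoWeaklyInvariant (T : Set (SU2 → SU2)) : Prop :=
  (∀ g, MemLp (fun ω => X ω g) 2 P) ∧
  ∀ φ ∈ T,
    (∀ g, ∫ ω, X ω (φ g) ∂P = ∫ ω, X ω g ∂P) ∧
    ∀ c ∈ ({id, fun z => conj z} : Set (ℂ → ℂ)), ∀ d ∈ ({id, fun z => conj z} : Set (ℂ → ℂ)), ∀ g₁ g₂,
      ∫ ω, c (X ω (φ g₁)) * d (X ω (φ g₂)) ∂P = ∫ ω, c (X ω g₁) * d (X ω g₂) ∂P

end Field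

/-! ### Complex Gaussian variables -/

/-- The centered, circularly symmetric complex Gaussian law: the law of `σ (ξ₁ + i ξ₂) / √2`, for
independent standard real Gaussian variables `ξ₁, ξ₂`. -/
def complexGaussian (σ : ℝ) : Measure ℂ :=
  ((gaussianReal 0 1).prod (gaussianReal 0 1)).map
    fun ξ => ((σ / √2 : ℝ) : ℂ) * ((ξ.1 : ℂ) + (ξ.2 : ℂ) * Complex.I)

section Gaussian

variable {Ω : Type*} [MeasurableSpace Ω] (P : Measure Ω)

/-- A random vector is complex Gaussian if every `ℂ`-linear combination of its components is a
complex Gaussian variable. -/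
def IsComplexGaussianVector {ι : Type*} [Fintype ι] (V : ι → Ω → ℂ) : Prop :=
  ∀ c : ι → ℂ, ∃ σ : ℝ, HasLaw (fun ω => ∑ i, c i * V i ω) (complexGaussian σ) P

/-- The matrix `𝔼[V conj(W)ᵀ]`. -/
def crossCovariance {ι κ : Type*} (V : ι → Ω → ℂ) (W : κ → Ω → ℂ) : Matrix ι κ ℂ :=
  Matrix.of fun i k => ∫ ω, V i ω * conj (W k ω) ∂P

/-- `V ∼ N_ℂ(0, K)`: the random vector `V` is complex Gaussian with `𝔼[V conj(V)ᵀ] = K`. -/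
def HasComplexNormalLaw {ι : Type*} [Fintype ι] (V : ι → Ω → ℂ) (K : Matrix ι ι ℂ) : Prop :=
  IsComplexGaussianVector P V ∧ crossCovariance P V V = K

/-- A random field is complex Gaussian if all its evaluations at finitely many points form a complex
Gaussian vector. -/
def IsComplexGaussianField (X : Ω → SU2 → ℂ) : Prop :=
  ∀ (N : ℕ) (g : Fin N → SU2), IsComplexGaussianVector P fun k ω => X ω (g k)

end Gaussian

end

/-! ### Complex Gaussian laws -/

/-! The Gaussian laws in question are centred and circular, so second moments `𝔼[Y conj Y']` decide
everything. Let `gaussianSpace` be the closed span of the values `X(g)` in `L²(Ω)`. Each of its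
elements `Y` satisfies `𝔼 exp(i Re Y) = exp(-𝔼|Y|²/4)`, and a real functional on `ℂ^N` is the real
part of a complex linear one. Hence the covariance determines the law of the field
(`identDistrib_of_covariance_eq`), which makes 2-weak and strong invariance equivalent, and
orthogonal families in the space are independent (`iIndepFun_of_orthogonal`). Moreover, almost sure
limits inside the space are `L²` limits (`exists_tendsto_of_tendsto_ae`).

The harmonic analysis is elementary. The Wigner matrices form a unitary representation, since they
are the action on binary forms of degree `n`. Averaging over the group gives intertwining matrices,
and testing these on two kinds of elements gives Schur orthogonality. The span of the harmonics is
stable under multiplication by the matrix entries, so Stone–Weierstrass gives completeness and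
Parseval's identity.

Let `X` be left-invariant. Translating the integral that defines `a_{ij}` shows that `𝔼[X(w) conj
a_{ij}]` is a combination over `k` of the `φ_{ik}(w)`, with coefficients `c_{kj}` independent of
`i`. By orthonormality `𝔼[a_{ij} conj a_{i'j'}] = δ_{ii'} c_{jj'}`, and coefficients of different
degrees are orthogonal. For the expansion at a given point no continuity of the covariance is
needed: `X^ℓ(g)` behaves as an orthogonal projection of `X(g)`, and both variances are independent
of `g`. Parseval's identity, integrated over `Ω` and divided by the volume, therefore says that the
variances of the `X^ℓ(g)` add up to that of `X(g)` at every `g`. This is `L²` convergence of a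
series of independent variables, and Lévy's theorem on conditional expectations makes it almost sure
(`ae_tendsto_sum_of_orthogonal`).

Conversely, an expansion with such coefficients expresses the covariance at `(g, h)` as a limit of
sums of `K_{jj'} D_{j'j}(h⁻¹g)`, which is left-invariant. Transposition `g ↦ gᵀ` exchanges left with
right and rows with columns. Bi-invariance is the conjunction of the two, where both Kronecker
deltas appear and the remaining constant depends on the degree only. -/

instance isProbabilityMeasure_complexGaussian (σ : ℝ) :
    IsProbabilityMeasure (complexGaussian σ) :=
  Measure.isProbabilityMeasure_map (by fun_prop)

/-- The real part of `z t` is `(σ/√2)(ξ₁ Re t - ξ₂ Im t)`, a sum of independent real Gaussians of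
total variance `σ²‖t‖²/2`; hence the factor `1/4`. -/
theorem integral_cexp_re_complexGaussian (σ : ℝ) (t : ℂ) :
    ∫ z, Complex.exp ((z * t).re * Complex.I) ∂complexGaussian σ =
      Complex.exp (-(σ ^ 2 * ‖t‖ ^ 2 / 4)) := by
  have hm : Continuous fun z : ℂ => Complex.exp ((z * t).re * Complex.I) := by fun_prop
  rw [complexGaussian, integral_map (by fun_prop) hm.aestronglyMeasurable]
  have h : ∀ ξ : ℝ × ℝ, Complex.exp
      (((((σ / √2 : ℝ) : ℂ) * ((ξ.1 : ℂ) + (ξ.2 : ℂ) * Complex.I)) * t).re * Complex.I) =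
      Complex.exp (((σ / √2 * t.re : ℝ) : ℂ) * ξ.1 * Complex.I) *
        Complex.exp (((-(σ / √2 * t.im) : ℝ) : ℂ) * ξ.2 * Complex.I) := by
    intro ξ
    rw [← Complex.exp_add, ← add_mul]
    congr 2
    norm_cast
    simp
    ring
  simp_rw [h]
  rw [integral_prod_mul (fun x : ℝ => Complex.exp (((σ / √2 * t.re : ℝ) : ℂ) * x * Complex.I))
    (fun x : ℝ => Complex.exp (((-(σ / √2 * t.im) : ℝ) : ℂ) * x * Complex.I)),
    ← charFun_apply_real, ← charFun_apply_real, charFun_gaussianReal, charFun_gaussianReal,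
    ← Complex.exp_add]
  congr 1
  have h3 : (‖t‖ : ℂ) ^ 2 = ((t.re * t.re + t.im * t.im : ℝ) : ℂ) := by
    rw [← Complex.normSq_apply, Complex.normSq_eq_norm_sq]
    push_cast
    rfl
  rw [h3]
  have h2 : (√2 : ℝ) ^ 2 = 2 := Real.sq_sqrt (by norm_num)
  simp only [mul_zero, Complex.ofReal_zero, zero_mul, zero_sub]
  push_cast
  norm_cast
  simp only [div_mul_eq_mul_div, div_pow, h2, neg_sq, mul_pow]
  ring

theorem ext_of_integral_cexp_re {μ ν : Measure ℂ} [IsProbabilityMeasure μ]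
    [IsProbabilityMeasure ν]
    (h : ∀ t : ℂ, ∫ z, Complex.exp ((z * t).re * Complex.I) ∂μ =
      ∫ z, Complex.exp ((z * t).re * Complex.I) ∂ν) : μ = ν := by
  apply Measure.ext_of_charFun
  ext t
  -- The real inner product of `ℂ` is the real part of `z conj t`.
  have := h (conj t)
  simp only [charFun_apply]
  convert! this using 5 <;> simp [Complex.inner] <;> ring

theorem memLp_id_complexGaussian (σ : ℝ) : MemLp (fun z : ℂ => z) 2 (complexGaussian σ) := by
  have h0 : MemLp (fun x : ℝ => (x : ℂ)) 2 (gaussianReal 0 1) :=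
    (memLp_id_gaussianReal (μ := 0) (v := 1) 2).ofReal
  rw [complexGaussian, memLp_map_measure_iff (by fun_prop) (by fun_prop)]
  exact ((h0.comp_measurePreserving measurePreserving_fst).add
    ((h0.comp_measurePreserving measurePreserving_snd).mul_const Complex.I)).const_mul _

theorem integral_complexGaussian (σ : ℝ) : ∫ z, z ∂complexGaussian σ = 0 := by
  have h0 : Integrable (fun x : ℝ => (x : ℂ)) (gaussianReal 0 1) :=
    ((memLp_id_gaussianReal (μ := 0) (v := 1) 1).integrable (by simp)).ofReal
  have hz : ∫ x : ℝ, (x : ℂ) ∂gaussianReal 0 1 = 0 := by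
    rw [integral_complex_ofReal]; simp
  rw [complexGaussian, integral_map (by fun_prop) (by fun_prop), integral_const_mul,
    integral_add (h0.comp_fst _) ((h0.comp_snd _).mul_const _), integral_mul_const,
    integral_fun_fst, integral_fun_snd, hz]
  simp

theorem integral_norm_sq_complexGaussian (σ : ℝ) :
    ∫ z, ‖z‖ ^ 2 ∂complexGaussian σ = σ ^ 2 := by
  have h0 : Integrable (fun x : ℝ => x ^ 2) (gaussianReal 0 1) :=
    (memLp_id_gaussianReal (μ := 0) (v := 1) 2).integrable_sq
  have hz : ∫ x : ℝ, x ^ 2 ∂gaussianReal 0 1 = 1 := by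
    have := variance_eq_sub (memLp_id_gaussianReal (μ := 0) (v := 1) 2)
    rw [variance_id_gaussianReal] at this
    simpa using this.symm
  have h (ξ : ℝ × ℝ) : ‖((σ / √2 : ℝ) : ℂ) * ((ξ.1 : ℂ) + (ξ.2 : ℂ) * Complex.I)‖ ^ 2 =
      σ ^ 2 / 2 * (ξ.1 ^ 2 + ξ.2 ^ 2) := by
    rw [norm_mul, mul_pow, ← Complex.normSq_eq_norm_sq (_ + _), Complex.normSq_add_mul_I,
      Complex.norm_real, Real.norm_eq_abs, sq_abs, div_pow, Real.sq_sqrt (by norm_num)]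
  rw [complexGaussian, integral_map (by fun_prop) (by fun_prop)]
  simp_rw [h]
  rw [integral_const_mul, integral_add (h0.comp_fst _) (h0.comp_snd _),
    integral_fun_fst (fun x : ℝ => x ^ 2), integral_fun_snd (fun x : ℝ => x ^ 2), hz]
  simp
  ring

/-! ### The Gaussian Hilbert space of a field -/

section GaussianSpace

variable {Ω : Type*} [MeasurableSpace Ω] (X : Ω → SU2 → ℂ) (P : Measure Ω)

/-- The closed subspace of `L²(Ω)` generated by the values of a random field. -/
noncomputable def gaussianSpace : Submodule ℂ (Lp ℂ 2 P) :=
  (Submodule.span ℂ {Z : Lp ℂ 2 P | ∃ g, Z =ᵐ[P] fun ω => X ω g}).topologicalClosure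

/-- A random variable almost surely equal to an element of the Gaussian Hilbert space. -/
def InGaussianSpace (Y : Ω → ℂ) : Prop := ∃ Z ∈ gaussianSpace X P, Z =ᵐ[P] Y

variable {X P}

theorem InGaussianSpace.memLp {Y : Ω → ℂ} (h : InGaussianSpace X P Y) : MemLp Y 2 P := by
  obtain ⟨Z, -, hZ⟩ := h
  exact (memLp_congr_ae hZ).1 (Lp.memLp Z)

theorem InGaussianSpace.congr {Y Y' : Ω → ℂ} (h : InGaussianSpace X P Y) (hY : Y =ᵐ[P] Y') :
    InGaussianSpace X P Y' := by
  obtain ⟨Z, hZ, hZY⟩ := h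
  exact ⟨Z, hZ, hZY.trans hY⟩

theorem InGaussianSpace.add {Y Y' : Ω → ℂ} (h : InGaussianSpace X P Y)
    (h' : InGaussianSpace X P Y') : InGaussianSpace X P fun ω => Y ω + Y' ω := by
  obtain ⟨Z, hZ, hY⟩ := h
  obtain ⟨Z', hZ', hY'⟩ := h'
  refine ⟨Z + Z', Submodule.add_mem _ hZ hZ', ?_⟩
  filter_upwards [hY, hY', Lp.coeFn_add Z Z'] with ω h1 h2 h3
  rw [h3, Pi.add_apply, h1, h2]

theorem InGaussianSpace.const_mul {Y : Ω → ℂ} (h : InGaussianSpace X P Y) (c : ℂ) :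
    InGaussianSpace X P fun ω => c * Y ω := by
  obtain ⟨Z, hZ, hY⟩ := h
  refine ⟨c • Z, Submodule.smul_mem _ c hZ, ?_⟩
  filter_upwards [hY, Lp.coeFn_smul c Z] with ω h1 h3
  simp [h1, h3]

theorem InGaussianSpace.mul_const {Y : Ω → ℂ} (h : InGaussianSpace X P Y) (c : ℂ) :
    InGaussianSpace X P fun ω => Y ω * c := by
  simpa only [mul_comm] using h.const_mul c

theorem InGaussianSpace.sub {Y Y' : Ω → ℂ} (h : InGaussianSpace X P Y)
    (h' : InGaussianSpace X P Y') : InGaussianSpace X P fun ω => Y ω - Y' ω := by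
  simpa [sub_eq_add_neg] using h.add (h'.const_mul (-1))

theorem InGaussianSpace.sum {ι : Type*} (s : Finset ι) {Y : ι → Ω → ℂ}
    (h : ∀ i ∈ s, InGaussianSpace X P (Y i)) : InGaussianSpace X P fun ω => ∑ i ∈ s, Y i ω := by
  classical
  induction s using Finset.induction_on with
  | empty =>
    refine ⟨0, Submodule.zero_mem _, ?_⟩
    filter_upwards [Lp.coeFn_zero ℂ 2 P] with ω h
    rw [h]
    simp
  | insert i s hi ih =>
    simp_rw [Finset.sum_insert hi]
    exact (h i (by simp)).add (ih fun j hj => h j (by simp [hj]))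

theorem isComplexGaussianField_memLp (hG : IsComplexGaussianField P X) (g : SU2) :
    MemLp (fun ω => X ω g) 2 P := by
  obtain ⟨σ, hσ⟩ := hG 1 (fun _ => g) (fun _ => 1)
  simp only [Finset.univ_unique, one_mul, Finset.sum_const, Finset.card_singleton, one_smul] at hσ
  have := memLp_id_complexGaussian σ
  rw [← hσ.map_eq] at this
  exact (memLp_map_measure_iff (by fun_prop) hσ.aemeasurable).1 this

theorem inGaussianSpace_apply (hG : IsComplexGaussianField P X) (g : SU2) :
    InGaussianSpace X P fun ω => X ω g :=
  ⟨(isComplexGaussianField_memLp hG g).toLp _,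
    Submodule.le_topologicalClosure _ (Submodule.subset_span ⟨g, MemLp.coeFn_toLp _⟩),
    MemLp.coeFn_toLp _⟩

theorem Lp_norm_sq_eq_integral (Z : Lp ℂ 2 P) : ‖Z‖ ^ 2 = ∫ ω, ‖Z ω‖ ^ 2 ∂P := by
  have h := L2.inner_def (𝕜 := ℂ) Z Z
  rw [inner_self_eq_norm_sq_to_K] at h
  have h2 : ∀ ω, inner ℂ (Z ω) (Z ω) = ((‖Z ω‖ ^ 2 : ℝ) : ℂ) := by
    intro ω
    rw [inner_self_eq_norm_sq_to_K]
    push_cast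
    rfl
  simp_rw [h2] at h
  rw [integral_complex_ofReal] at h
  refine Complex.ofReal_injective (Eq.trans ?_ h)
  push_cast
  rfl

/-- The value at `1` of the characteristic function of the real part of an element of the
Gaussian Hilbert space. -/
theorem integral_cexp_re_of_mem_gaussianSpace [IsProbabilityMeasure P]
    (hG : IsComplexGaussianField P X) {Z : Lp ℂ 2 P} (hZ : Z ∈ gaussianSpace X P) :
    ∫ ω, Complex.exp ((Z ω).re * Complex.I) ∂P = Complex.exp (-(‖Z‖ ^ 2 / 4)) := by
  -- A finite combination of values has law `complexGaussian σ`, and its squared norm is `σ²`.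
  have hspan : ∀ W ∈ Submodule.span ℂ {Z : Lp ℂ 2 P | ∃ g, Z =ᵐ[P] fun ω => X ω g},
      ∫ ω, Complex.exp ((W ω).re * Complex.I) ∂P = Complex.exp (-(‖W‖ ^ 2 / 4)) := by
    intro W hW
    obtain ⟨n, c, w, rfl⟩ := Submodule.mem_span_set'.1 hW
    choose g hg using fun i => (w i).2
    obtain ⟨σ, hσ⟩ := hG n g c
    have hae : (⇑(∑ i, c i • (w i : Lp ℂ 2 P)) : Ω → ℂ) =ᵐ[P] fun ω => ∑ i, c i * X ω (g i) := by
      have h1 : ∀ᵐ ω ∂P, ∀ i, (c i • (w i : Lp ℂ 2 P) : Lp ℂ 2 P) ω = c i * X ω (g i) := by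
        rw [ae_all_iff]
        intro i
        filter_upwards [Lp.coeFn_smul (c i) (w i : Lp ℂ 2 P), hg i] with ω h1 h2
        simp [h1, h2]
      filter_upwards [h1, Lp.coeFn_finsetSum Finset.univ fun i => c i • (w i : Lp ℂ 2 P)]
        with ω h1 h2
      rw [h2]
      simp [h1]
    set W := ∑ i, c i • (w i : Lp ℂ 2 P)
    have hn : ‖W‖ ^ 2 = σ ^ 2 := by
      rw [Lp_norm_sq_eq_integral, ← integral_norm_sq_complexGaussian σ,
        ← hσ.integral_comp (f := fun z => ‖z‖ ^ 2) (by fun_prop)]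
      refine integral_congr_ae ?_
      filter_upwards [hae] with ω h
      simp [h]
    have h1 := integral_cexp_re_complexGaussian σ 1
    rw [← hσ.integral_comp (f := fun z => Complex.exp ((z * 1).re * Complex.I)) (by fun_prop)] at h1
    have h2 : (‖W‖ : ℂ) ^ 2 = (σ : ℂ) ^ 2 := by exact_mod_cast hn
    rw [h2]
    simp only [mul_one, norm_one, Complex.ofReal_one, one_pow] at h1
    rw [← h1]
    refine integral_congr_ae ?_
    filter_upwards [hae] with ω h
    simp [h]
  -- Passage to the closure: a subsequence converges almost surely, and the integrands have modulus
  -- one.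
  obtain ⟨w, hw, hlim⟩ := mem_closure_iff_seq_limit.1 hZ
  obtain ⟨ns, hns, hae⟩ := (tendstoInMeasure_of_tendsto_Lp hlim).exists_seq_tendsto_ae
  have h1 : Tendsto (fun k => ∫ ω, Complex.exp ((w (ns k) ω).re * Complex.I) ∂P) atTop
      (𝓝 (∫ ω, Complex.exp ((Z ω).re * Complex.I) ∂P)) := by
    refine tendsto_integral_of_dominated_convergence (fun _ => 1) ?_ (integrable_const _) ?_ ?_
    · intro n
      have h0 := (Lp.aestronglyMeasurable (w (ns n)))
      have hc : Continuous fun z : ℂ => Complex.exp (z.re * Complex.I) := by fun_prop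
      exact hc.comp_aestronglyMeasurable h0
    · intro n
      filter_upwards with ω
      rw [Complex.norm_exp_ofReal_mul_I]
    · filter_upwards [hae] with ω h
      have hc : Continuous fun z : ℂ => Complex.exp (z.re * Complex.I) := by fun_prop
      exact (hc.tendsto _).comp h
  have h2 : Tendsto (fun k => Complex.exp (-((‖w (ns k)‖ : ℂ) ^ 2 / 4))) atTop
      (𝓝 (Complex.exp (-((‖Z‖ : ℂ) ^ 2 / 4)))) := by
    have hc : Continuous fun z : Lp ℂ 2 P => Complex.exp (-((‖z‖ : ℂ) ^ 2 / 4)) := by fun_prop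
    exact (hc.tendsto _).comp (hlim.comp hns.tendsto_atTop)
  refine tendsto_nhds_unique h1 (h2.congr fun k => ?_)
  exact (hspan _ (hw _)).symm

theorem InGaussianSpace.integral_cexp_re [IsProbabilityMeasure P]
    (hG : IsComplexGaussianField P X) {Y : Ω → ℂ} (hY : InGaussianSpace X P Y) :
    ∫ ω, Complex.exp ((Y ω).re * Complex.I) ∂P =
      Complex.exp (-(((∫ ω, ‖Y ω‖ ^ 2 ∂P : ℝ) : ℂ) / 4)) := by
  obtain ⟨Z, hZ, hae⟩ := hY
  have h := integral_cexp_re_of_mem_gaussianSpace hG hZ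
  have h2 : (‖Z‖ : ℂ) ^ 2 = ((∫ ω, ‖Y ω‖ ^ 2 ∂P : ℝ) : ℂ) := by
    have h3 := integral_congr_ae (hae.fun_comp fun z => ‖z‖ ^ 2)
    simp only [Function.comp_apply] at h3
    rw [← h3]
    exact_mod_cast Lp_norm_sq_eq_integral Z
  rw [h2] at h
  rw [← h]
  exact integral_congr_ae (hae.symm.fun_comp fun z => Complex.exp (z.re * Complex.I))

/-- The Gaussian space is stable under multiplication by `t`, so the formula for `𝔼 exp(i Re Y)`
yields the whole characteristic function. -/
theorem InGaussianSpace.hasLaw [IsProbabilityMeasure P]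
    (hG : IsComplexGaussianField P X) {Y : Ω → ℂ} (hY : InGaussianSpace X P Y) :
    HasLaw Y (complexGaussian (√(∫ ω, ‖Y ω‖ ^ 2 ∂P))) P := by
  have hm := hY.memLp.aestronglyMeasurable.aemeasurable
  refine ⟨hm, ?_⟩
  have := Measure.isProbabilityMeasure_map hm
  refine ext_of_integral_cexp_re fun t => ?_
  have hc : Continuous fun z : ℂ => Complex.exp ((z * t).re * Complex.I) := by fun_prop
  rw [integral_cexp_re_complexGaussian, integral_map hm hc.aestronglyMeasurable,
    (hY.mul_const t).integral_cexp_re hG]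
  simp_rw [norm_mul, mul_pow]
  rw [integral_mul_const]
  have h0 : (0 : ℝ) ≤ ∫ ω, ‖Y ω‖ ^ 2 ∂P := integral_nonneg fun _ => by positivity
  norm_cast
  rw [Real.sq_sqrt h0]

theorem InGaussianSpace.integral_eq_zero [IsProbabilityMeasure P]
    (hG : IsComplexGaussianField P X) {Y : Ω → ℂ} (hY : InGaussianSpace X P Y) :
    ∫ ω, Y ω ∂P = 0 := by
  rw [(hY.hasLaw hG).integral_eq, integral_complexGaussian]

theorem isComplexGaussianVector_of_inGaussianSpace [IsProbabilityMeasure P]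
    (hG : IsComplexGaussianField P X) {ι : Type*} [Fintype ι] {V : ι → Ω → ℂ}
    (hV : ∀ i, InGaussianSpace X P (V i)) : IsComplexGaussianVector P V := fun c =>
  ⟨_, (InGaussianSpace.sum Finset.univ fun i _ => (hV i).const_mul (c i)).hasLaw hG⟩

/-- An almost sure limit of elements of the Gaussian Hilbert space is a limit in `L²`. -/
theorem exists_tendsto_of_tendsto_ae [IsProbabilityMeasure P]
    (hG : IsComplexGaussianField P X) {Z : ℕ → Lp ℂ 2 P} (hZ : ∀ n, Z n ∈ gaussianSpace X P)
    {W : Ω → ℂ} (hW : ∀ᵐ ω ∂P, Tendsto (fun n => Z n ω) atTop (𝓝 (W ω))) :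
    ∃ Z' ∈ gaussianSpace X P, Z' =ᵐ[P] W ∧ Tendsto Z atTop (𝓝 Z') := by
  -- Almost sure convergence sends `𝔼 exp(i Re(Z_p - Z_q))` to `1`. This expectation is `exp(-‖Z_p -
  -- Z_q‖²/4)`, so the sequence is Cauchy in `L²`.
  have hexp : Tendsto (fun p : ℕ × ℕ => Complex.exp (-((‖Z p.1 - Z p.2‖ : ℂ) ^ 2 / 4)))
      atTop (𝓝 1) := by
    have h1 : Tendsto (fun p : ℕ × ℕ =>
        ∫ ω, Complex.exp (((Z p.1 - Z p.2 : Lp ℂ 2 P) ω).re * Complex.I) ∂P) atTop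
        (𝓝 (∫ _, (1 : ℂ) ∂P)) := by
      have hc : Continuous fun z : ℂ => Complex.exp (z.re * Complex.I) := by fun_prop
      refine tendsto_integral_filter_of_dominated_convergence (fun _ => 1) ?_ ?_
        (integrable_const _) ?_
      · exact .of_forall fun n =>
          hc.comp_aestronglyMeasurable (Lp.aestronglyMeasurable (Z n.1 - Z n.2))
      · refine .of_forall fun n => ?_
        filter_upwards with ω
        rw [Complex.norm_exp_ofReal_mul_I]
      · have hsub : ∀ᵐ ω ∂P, ∀ p : ℕ × ℕ, (Z p.1 - Z p.2 : Lp ℂ 2 P) ω = Z p.1 ω - Z p.2 ω :=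
          ae_all_iff.2 fun p => Lp.coeFn_sub _ _
        filter_upwards [hW, hsub] with ω h hs
        simp_rw [hs]
        have h0 : Tendsto (fun p : ℕ × ℕ => Z p.1 ω - Z p.2 ω) atTop (𝓝 0) := by
          rw [← prod_atTop_atTop_eq]
          simpa using (h.comp tendsto_fst).sub (h.comp tendsto_snd)
        have h3 := (hc.tendsto 0).comp h0
        rwa [Complex.zero_re, Complex.ofReal_zero, zero_mul, Complex.exp_zero] at h3
    simp only [integral_const, probReal_univ, one_smul] at h1
    exact h1.congr fun p =>
      integral_cexp_re_of_mem_gaussianSpace hG (Submodule.sub_mem _ (hZ _) (hZ _))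
  have hdist : Tendsto (fun p : ℕ × ℕ => dist (Z p.1) (Z p.2)) atTop (𝓝 0) := by
    have h1 : Tendsto (fun p : ℕ × ℕ => Real.exp (-(‖Z p.1 - Z p.2‖ ^ 2 / 4))) atTop (𝓝 1) := by
      have := (Complex.continuous_re.tendsto _).comp hexp
      refine this.congr fun p => ?_
      simp only [Function.comp_apply]
      norm_cast
    have h2 := ((Real.continuousAt_log one_ne_zero).tendsto.comp h1).neg.const_mul 4
    have h3 := (Real.continuous_sqrt.tendsto _).comp h2
    simp only [Real.log_one, neg_zero, mul_zero, Real.sqrt_zero] at h3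
    refine h3.congr fun p => ?_
    simp only [Function.comp_apply, Real.log_exp]
    rw [dist_eq_norm, ← Real.sqrt_sq (norm_nonneg (Z p.1 - Z p.2))]
    congr 1
    rw [Real.sqrt_sq (norm_nonneg _)]
    ring
  have hC : CauchySeq Z := by
    rw [cauchySeq_iff_tendsto_dist_atTop_0]
    exact hdist
  obtain ⟨Z', hZ'⟩ := cauchySeq_tendsto_of_complete hC
  refine ⟨Z', ?_, ?_, hZ'⟩
  · exact (Submodule.isClosed_topologicalClosure _).mem_of_tendsto hZ' (.of_forall hZ)
  -- The `L²` limit and the almost sure limit are both limits in measure.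
  · exact tendstoInMeasure_ae_unique (tendstoInMeasure_of_tendsto_Lp hZ')
      (tendstoInMeasure_of_tendsto_ae (fun n => Lp.aestronglyMeasurable _) hW)

theorem InGaussianSpace.of_tendsto_ae [IsProbabilityMeasure P]
    (hG : IsComplexGaussianField P X) {Y : ℕ → Ω → ℂ} (hY : ∀ n, InGaussianSpace X P (Y n))
    {W : Ω → ℂ} (hW : ∀ᵐ ω ∂P, Tendsto (fun n => Y n ω) atTop (𝓝 (W ω))) :
    InGaussianSpace X P W := by
  choose Z hZ hae using hY
  obtain ⟨Z', h1, h2, -⟩ := exists_tendsto_of_tendsto_ae hG hZ (W := W) (by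
    filter_upwards [hW, ae_all_iff.2 hae] with ω h h'
    simpa [h'] using h)
  exact ⟨Z', h1, h2⟩

theorem inner_eq_integral_mul_conj {Z Z' : Lp ℂ 2 P} {Y Y' : Ω → ℂ} (h : Z =ᵐ[P] Y)
    (h' : Z' =ᵐ[P] Y') : inner ℂ Z' Z = ∫ ω, Y ω * conj (Y' ω) ∂P := by
  rw [L2.inner_def]
  refine integral_congr_ae ?_
  filter_upwards [h, h'] with ω h1 h2
  rw [h1, h2]
  rfl

/-- Second moments pass to almost sure limits in the Gaussian Hilbert space. -/
theorem tendsto_integral_mul_conj_of_tendsto_ae [IsProbabilityMeasure P]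
    (hG : IsComplexGaussianField P X) {Y Y' : ℕ → Ω → ℂ} (hY : ∀ n, InGaussianSpace X P (Y n))
    (hY' : ∀ n, InGaussianSpace X P (Y' n)) {W W' : Ω → ℂ}
    (hW : ∀ᵐ ω ∂P, Tendsto (fun n => Y n ω) atTop (𝓝 (W ω)))
    (hW' : ∀ᵐ ω ∂P, Tendsto (fun n => Y' n ω) atTop (𝓝 (W' ω))) :
    Tendsto (fun n => ∫ ω, Y n ω * conj (Y' n ω) ∂P) atTop
      (𝓝 (∫ ω, W ω * conj (W' ω) ∂P)) := by
  choose Z hZ hae using hY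
  choose Z' hZ' hae' using hY'
  obtain ⟨U, h1, h2, h3⟩ := exists_tendsto_of_tendsto_ae hG hZ (W := W) (by
    filter_upwards [hW, ae_all_iff.2 hae] with ω h h'
    simpa [h'] using h)
  obtain ⟨U', h1', h2', h3'⟩ := exists_tendsto_of_tendsto_ae hG hZ' (W := W') (by
    filter_upwards [hW', ae_all_iff.2 hae'] with ω h h'
    simpa [h'] using h)
  rw [← inner_eq_integral_mul_conj h2 h2']
  exact (h3'.inner h3).congr fun n => inner_eq_integral_mul_conj (hae n) (hae' n)

end GaussianSpace

/-! ### Independence and uniqueness of laws -/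

/-- Through this, characteristic functions of complex vectors involve only `ℂ`-linear combinations
of the components, which stay in the Gaussian space. -/
theorem exists_re_sum_eq {ι : Type*} [Fintype ι] [DecidableEq ι] (L : (ι → ℂ) →L[ℝ] ℝ) :
    ∃ c : ι → ℂ, ∀ z, L z = (∑ k, c k * z k).re := by
  refine ⟨fun k => ⟨L (Pi.single k 1), -L (Pi.single k Complex.I)⟩, fun z => ?_⟩
  have hz : z = ∑ k, ((z k).re • (Pi.single k 1 : ι → ℂ) +
      (z k).im • (Pi.single k Complex.I : ι → ℂ)) := by
    ext j
    simp only [Finset.sum_apply, Pi.add_apply, Pi.smul_apply, Pi.single_apply]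
    rw [Finset.sum_eq_single j]
    · simp
    · intro b _ hb
      simp [hb.symm]
    · simp
  conv_lhs => rw [hz]
  rw [map_sum, Complex.re_sum]
  refine Finset.sum_congr rfl fun k _ => ?_
  simp only [map_add, map_smul, smul_eq_mul, Complex.mul_re]
  ring

section GaussianSpace

variable {Ω : Type*} [MeasurableSpace Ω] {X : Ω → SU2 → ℂ} {P : Measure Ω}

theorem integral_norm_sq_sum_of_orthogonal {ι : Type*} [Fintype ι] {Y : ι → Ω → ℂ}
    (hY : ∀ i, MemLp (Y i) 2 P)
    (ho : ∀ i j, i ≠ j → ∫ ω, Y i ω * conj (Y j ω) ∂P = 0) :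
    ∫ ω, ‖∑ i, Y i ω‖ ^ 2 ∂P = ∑ i, ∫ ω, ‖Y i ω‖ ^ 2 ∂P := by
  classical
  have hint : ∀ i j, Integrable (fun ω => Y i ω * conj (Y j ω)) P := fun i j =>
    (hY i).integrable_mul (hY j).star
  have h (z : ℂ) : ((‖z‖ ^ 2 : ℝ) : ℂ) = z * conj z := by
    rw [Complex.mul_conj, Complex.normSq_eq_norm_sq]
  apply Complex.ofReal_injective
  rw [Complex.ofReal_sum]
  simp_rw [← integral_complex_ofReal, h, map_sum, Finset.sum_mul_sum]
  rw [integral_finsetSum _ fun i _ => integrable_finsetSum _ fun j _ => hint i j]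
  refine Finset.sum_congr rfl fun i _ => ?_
  rw [integral_finsetSum _ fun j _ => hint i j, Finset.sum_eq_single i]
  · intro j _ hj
    exact ho i j hj.symm
  · simp

/-- A real functional of the joint vector is `Re ∑ Y i`, with one combination `Y i` for each block.
The `Y i` are orthogonal, so `𝔼|∑ Y i|² = ∑ 𝔼|Y i|²` and the joint characteristic function factors.
Moments without conjugation need no separate hypothesis, because the Gaussian space is complex
linear. -/
theorem iIndepFun_of_orthogonal [IsProbabilityMeasure P] (hG : IsComplexGaussianField P X)
    {ι : Type*} {κ : ι → Type*} [∀ i, Fintype (κ i)] {V : (i : ι) → κ i → Ω → ℂ}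
    (hV : ∀ i k, InGaussianSpace X P (V i k))
    (ho : ∀ i j, i ≠ j → ∀ k l, ∫ ω, V i k ω * conj (V j l ω) ∂P = 0) :
    iIndepFun (fun i ω k => V i k ω) P := by
  classical
  rw [iIndepFun_iff_finset]
  intro s
  have hm : ∀ i, AEMeasurable (fun ω k => V i k ω) P := fun i =>
    aemeasurable_pi_lambda _ fun k => (hV i k).memLp.aestronglyMeasurable.aemeasurable
  refine (iIndepFun_iff_charFunDual_pi (E := fun i : s => κ i → ℂ)
    (X := fun (i : s) ω k => V i k ω) fun i => hm i).2 fun L => ?_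
  choose c hc using fun i : s =>
    exists_re_sum_eq (L ∘SL ContinuousLinearMap.single ℝ (fun i : s => κ i → ℂ) i)
  have hL : ∀ z : (i : s) → κ i → ℂ, L z = (∑ i, ∑ k, c i k * z i k).re := by
    intro z
    conv_lhs => rw [← Finset.univ_sum_single z, map_sum]
    rw [Complex.re_sum]
    exact Finset.sum_congr rfl fun i _ => hc i (z i)
  set Y : s → Ω → ℂ := fun i ω => ∑ k, c i k * V i k ω with hYdef
  have hY : ∀ i, InGaussianSpace X P (Y i) := fun i =>
    InGaussianSpace.sum _ fun k _ => (hV i k).const_mul (c i k)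
  have hYo : ∀ i j, i ≠ j → ∫ ω, Y i ω * conj (Y j ω) ∂P = 0 := by
    intro i j hij
    have hint : ∀ k l, Integrable (fun ω => c i k * V i k ω * conj (c j l * V j l ω)) P :=
      fun k l => ((hV i k).const_mul (c i k)).memLp.integrable_mul
        ((hV j l).const_mul (c j l)).memLp.star
    simp_rw [hYdef, map_sum, Finset.sum_mul_sum]
    rw [integral_finsetSum _ fun k _ => integrable_finsetSum _ fun l _ => hint k l]
    refine Finset.sum_eq_zero fun k _ => ?_
    rw [integral_finsetSum _ fun l _ => hint k l]
    refine Finset.sum_eq_zero fun l _ => ?_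
    have : ∀ ω, c i k * V i k ω * conj (c j l * V j l ω) =
        c i k * conj (c j l) * (V i k ω * conj (V j l ω)) := by
      intro ω
      rw [map_mul]
      ring
    simp_rw [this]
    rw [integral_const_mul, ho i j (fun h => hij (Subtype.ext h)), mul_zero]
  have h1 : charFunDual (P.map fun ω (i : s) k => V i k ω) L =
      ∫ ω, Complex.exp ((∑ i, Y i ω).re * Complex.I) ∂P := by
    rw [charFunDual_apply, integral_map (aemeasurable_pi_lambda _ fun i : s => hm i)
      (by fun_prop)]
    simp_rw [hL, hYdef]
  have h2 : ∀ i : s, charFunDual (P.map fun ω k => V i k ω)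
      (L ∘SL ContinuousLinearMap.single ℝ (fun i : s => κ i → ℂ) i) =
      ∫ ω, Complex.exp ((Y i ω).re * Complex.I) ∂P := by
    intro i
    rw [charFunDual_apply, integral_map (hm i) (by fun_prop)]
    simp_rw [hc, hYdef]
  rw [h1, (InGaussianSpace.sum Finset.univ fun i _ => hY i).integral_cexp_re hG]
  simp_rw [h2, fun i => (hY i).integral_cexp_re hG]
  rw [← Complex.exp_sum, integral_norm_sq_sum_of_orthogonal (fun i => (hY i).memLp) hYo]
  congr 1
  push_cast
  rw [Finset.sum_div, Finset.sum_neg_distrib]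

/-! ### Laws determined by covariances; weak and strong invariance -/

theorem measurable_field (hX : Measurable (Function.uncurry X)) (g : SU2) :
    Measurable fun ω => X ω g := hX.comp (measurable_id.prodMk measurable_const)

theorem integral_norm_sq_sum_eq_of_cov {ι : Type*} [Fintype ι] {Y Y' : ι → Ω → ℂ}
    (hY : ∀ i, MemLp (Y i) 2 P) (hY' : ∀ i, MemLp (Y' i) 2 P)
    (h : ∀ i j, ∫ ω, Y i ω * conj (Y j ω) ∂P = ∫ ω, Y' i ω * conj (Y' j ω) ∂P) (c : ι → ℂ) :
    ∫ ω, ‖∑ i, c i * Y i ω‖ ^ 2 ∂P = ∫ ω, ‖∑ i, c i * Y' i ω‖ ^ 2 ∂P := by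
  have key : ∀ {Y : ι → Ω → ℂ}, (∀ i, MemLp (Y i) 2 P) →
      ((∫ ω, ‖∑ i, c i * Y i ω‖ ^ 2 ∂P : ℝ) : ℂ) =
        ∑ i, ∑ j, c i * conj (c j) * ∫ ω, Y i ω * conj (Y j ω) ∂P := by
    intro Y hY
    have hint : ∀ i j, Integrable (fun ω => c i * conj (c j) * (Y i ω * conj (Y j ω))) P :=
      fun i j => ((hY i).integrable_mul (hY j).star).const_mul _
    have hz (ω : Ω) : ((‖∑ i, c i * Y i ω‖ ^ 2 : ℝ) : ℂ) =
        ∑ i, ∑ j, c i * conj (c j) * (Y i ω * conj (Y j ω)) := by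
      rw [← Complex.normSq_eq_norm_sq, ← Complex.mul_conj, map_sum, Finset.sum_mul_sum]
      refine Finset.sum_congr rfl fun i _ => Finset.sum_congr rfl fun j _ => ?_
      rw [map_mul]
      ring
    rw [← integral_complex_ofReal]
    simp_rw [hz]
    rw [integral_finsetSum _ fun i _ => integrable_finsetSum _ fun j _ => hint i j]
    refine Finset.sum_congr rfl fun i _ => ?_
    rw [integral_finsetSum _ fun j _ => hint i j]
    simp_rw [integral_const_mul]
  apply Complex.ofReal_injective
  rw [key hY, key hY']
  simp_rw [h]

/-- The law of a complex Gaussian field is determined by its covariance. -/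
theorem identDistrib_of_covariance_eq [IsProbabilityMeasure P]
    (hX : Measurable (Function.uncurry X)) (hG : IsComplexGaussianField P X) {φ : SU2 → SU2}
    (h : ∀ g₁ g₂, ∫ ω, X ω (φ g₁) * conj (X ω (φ g₂)) ∂P = ∫ ω, X ω g₁ * conj (X ω g₂) ∂P) :
    IdentDistrib (fun ω z => X ω (φ z)) (fun ω z => X ω z) P P := by
  classical
  have hm : ∀ g, Measurable fun ω => X ω g := measurable_field hX
  have hA : AEMeasurable (fun ω z => X ω (φ z)) P :=
    (measurable_pi_lambda _ fun z => hm (φ z)).aemeasurable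
  have hB : AEMeasurable (fun ω z => X ω z) P :=
    (measurable_pi_lambda _ fun z => hm z).aemeasurable
  refine (identDistrib_iff_forall_finset_identDistrib (X := fun z ω => X ω (φ z))
    (Y := fun z ω => X ω z) hA hB).2 fun I => ?_
  have hA' : AEMeasurable (fun ω (i : I) => X ω (φ i)) P :=
    (measurable_pi_lambda _ fun z : I => hm (φ z)).aemeasurable
  have hB' : AEMeasurable (fun ω (i : I) => X ω i) P :=
    (measurable_pi_lambda _ fun z : I => hm z).aemeasurable
  refine ⟨hA', hB', ?_⟩
  change P.map (fun ω (i : I) => X ω (φ i)) = P.map (fun ω (i : I) => X ω i)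
  have := Measure.isProbabilityMeasure_map hA'
  have := Measure.isProbabilityMeasure_map hB'
  refine Measure.ext_of_charFunDual (funext fun L => ?_)
  obtain ⟨c, hc⟩ := exists_re_sum_eq L
  rw [charFunDual_apply, charFunDual_apply, integral_map hA' (by fun_prop),
    integral_map hB' (by fun_prop)]
  simp_rw [hc]
  rw [(InGaussianSpace.sum Finset.univ fun (i : I) _ =>
      (inGaussianSpace_apply hG (φ i)).const_mul (c i)).integral_cexp_re hG,
    (InGaussianSpace.sum Finset.univ fun (i : I) _ =>
      (inGaussianSpace_apply hG i.1).const_mul (c i)).integral_cexp_re hG,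
    integral_norm_sq_sum_eq_of_cov (Y := fun (i : I) ω => X ω (φ i))
      (Y' := fun (i : I) ω => X ω i) (fun i => isComplexGaussianField_memLp hG _)
      (fun i => isComplexGaussianField_memLp hG _) fun i j => h i j]

theorem StronglyInvariant.integral_comp₂ {T : Set (SU2 → SU2)} (h : StronglyInvariant X P T)
    {φ : SU2 → SU2} (hφ : φ ∈ T) {f : ℂ × ℂ → ℂ} (hf : Measurable f) (g₁ g₂ : SU2) :
    ∫ ω, f (X ω (φ g₁), X ω (φ g₂)) ∂P = ∫ ω, f (X ω g₁, X ω g₂) ∂P :=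
  ((h φ hφ).comp (u := fun x : SU2 → ℂ => f (x g₁, x g₂)) (by fun_prop)).integral_eq

/-- Strong invariance needs only the moments `𝔼[X(g₁) conj X(g₂)]`. Conversely, Gaussian values have
finite second moments, and moments of two values are functions of the law. -/
theorem twoWeaklyInvariant_iff_stronglyInvariant [IsProbabilityMeasure P]
    (hX : Measurable (Function.uncurry X)) (hG : IsComplexGaussianField P X)
    (T : Set (SU2 → SU2)) : TwoWeaklyInvariant X P T ↔ StronglyInvariant X P T := by
  constructor
  · intro h φ hφ
    refine identDistrib_of_covariance_eq hX hG fun g₁ g₂ => ?_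
    exact (h.2 φ hφ).2 id (by simp) (fun z => conj z) (by simp) g₁ g₂
  · intro h
    refine ⟨isComplexGaussianField_memLp hG, fun φ hφ => ⟨fun g => ?_, fun c hc d hd g₁ g₂ => ?_⟩⟩
    · exact h.integral_comp₂ hφ (f := Prod.fst) (by fun_prop) g g
    · have hc' : ∀ c ∈ ({id, fun z => conj z} : Set (ℂ → ℂ)), Measurable c := by
        rintro c (rfl | rfl)
        · exact measurable_id
        · exact Complex.continuous_conj.measurable
      exact h.integral_comp₂ hφ (f := fun p => c p.1 * d p.2)
        (((hc' c hc).comp measurable_fst).mul ((hc' d hd).comp measurable_snd)) g₁ g₂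

/-! ### Almost sure convergence of orthogonal series in the Gaussian Hilbert space -/

/-- Conditioning requires independence from the whole family at once. The index `none` adds `W` to
the family `V`, so that everything is jointly independent and the indices split into two disjoint
sets. -/
theorem indep_iSup_of_orthogonal [IsProbabilityMeasure P] (hG : IsComplexGaussianField P X)
    {κ : Type*} {W : Ω → ℂ} {V : κ → Ω → ℂ} (hW : InGaussianSpace X P W)
    (hWm : Measurable W) (hV : ∀ k, InGaussianSpace X P (V k)) (hVm : ∀ k, Measurable (V k))
    (hWV : ∀ k, ∫ ω, W ω * conj (V k ω) ∂P = 0)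
    (hVV : ∀ k l, k ≠ l → ∫ ω, V k ω * conj (V l ω) ∂P = 0) :
    Indep (MeasurableSpace.comap W inferInstance)
      (⨆ k, MeasurableSpace.comap (V k) inferInstance) P := by
  have hswap : ∀ k, ∫ ω, V k ω * conj (W ω) ∂P = 0 := by
    intro k
    have h := congrArg conj (hWV k)
    rw [← integral_conj, map_zero] at h
    simpa [mul_comm] using h
  set U : Option κ → Ω → ℂ := fun o => o.elim W V with hU
  have h := iIndepFun_of_orthogonal hG (ι := Option κ) (κ := fun _ => Unit)
    (V := fun o _ => U o) (by rintro (_ | k) _ <;> simp [hU, hW, hV]) (by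
      rintro (_ | k) (_ | l) hkl - -
      · exact absurd rfl hkl
      · exact hWV l
      · exact hswap k
      · exact hVV k l fun h => hkl (by rw [h]))
  have h' : iIndepFun U P :=
    h.comp (fun _ (x : Unit → ℂ) => x ()) fun _ => measurable_pi_apply _
  have hle : ∀ o, MeasurableSpace.comap (U o) inferInstance ≤ ‹MeasurableSpace Ω› := by
    rintro (_ | k)
    · exact hWm.comap_le
    · exact (hVm k).comap_le
  have := indep_iSup_of_disjoint hle h'.iIndep
    (S := {none}) (T := Set.range some) (by simp)
  rw [iSup_range, iSup_singleton] at this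
  exact this

/-- The remainder after a partial sum is orthogonal to the terms used, hence independent of them.
The partial sums are thus conditional expectations of `Z`, and Lévy's upward theorem gives almost
sure convergence. -/
theorem ae_tendsto_sum_of_orthogonal [IsProbabilityMeasure P] (hG : IsComplexGaussianField P X)
    {Y : ℕ → Ω → ℂ} {Z : Ω → ℂ} (hY : ∀ n, InGaussianSpace X P (Y n))
    (hYm : ∀ n, Measurable (Y n)) (hZ : InGaussianSpace X P Z) (hZm : Measurable Z)
    (hYY : ∀ m n, m ≠ n → ∫ ω, Y m ω * conj (Y n ω) ∂P = 0)
    (hZY : ∀ n, ∫ ω, Z ω * conj (Y n ω) ∂P = ∫ ω, Y n ω * conj (Y n ω) ∂P)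
    (hlim : Tendsto (fun N => ∫ ω, ‖(∑ n ∈ Finset.range N, Y n ω) - Z ω‖ ^ 2 ∂P) atTop (𝓝 0)) :
    ∀ᵐ ω ∂P, Tendsto (fun N => ∑ n ∈ Finset.range N, Y n ω) atTop (𝓝 (Z ω)) := by
  set S : ℕ → Ω → ℂ := fun N ω => ∑ n ∈ Finset.range N, Y n ω with hS
  have hSm : ∀ N, Measurable (S N) := fun N => Finset.measurable_sum _ fun n _ => hYm n
  have hSG : ∀ N, InGaussianSpace X P (S N) := fun N => InGaussianSpace.sum _ fun n _ => hY n
  -- `F N` is generated by `Y 0, …, Y N`; this is `N + 1` variables, so it goes with `S (N + 1)`.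
  set F := Filtration.natural Y fun n => (hYm n).stronglyMeasurable with hF
  have horth : ∀ N, ∀ k : Fin (N + 1),
      ∫ ω, (Z ω - S (N + 1) ω) * conj (Y k ω) ∂P = 0 := by
    intro N k
    have hi : ∀ {U V : Ω → ℂ}, InGaussianSpace X P U → InGaussianSpace X P V →
        Integrable (fun ω => U ω * conj (V ω)) P := fun hU hV =>
      hU.memLp.integrable_mul hV.memLp.star
    simp_rw [sub_mul]
    rw [integral_sub (hi hZ (hY k)) (hi (hSG _) (hY k)), hZY]
    simp_rw [hS, Finset.sum_mul]
    rw [integral_finsetSum _ fun n _ => hi (hY n) (hY k), Finset.sum_eq_single k.1, sub_self]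
    · intro n _ hn
      exact hYY n k hn
    · intro h
      simp only [Finset.mem_range, not_lt] at h
      exact absurd k.2 (by omega)
  have hind : ∀ N, Indep (MeasurableSpace.comap (fun ω => Z ω - S (N + 1) ω) inferInstance)
      (F N) P := by
    intro N
    have h := indep_iSup_of_orthogonal hG (κ := Fin (N + 1)) (hZ.sub (hSG (N + 1)))
      (hZm.sub (hSm _)) (fun k => hY k) (fun k => hYm k) (horth N)
      fun k l hkl => hYY k l fun h => hkl (Fin.ext h)
    refine indep_of_indep_of_le_right h ?_
    exact iSup₂_le fun j hj => le_iSup_of_le (⟨j, Nat.lt_succ_of_le hj⟩ : Fin (N + 1)) le_rfl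
  have hmeas : TendstoInMeasure P S atTop Z := by
    refine tendstoInMeasure_of_tendsto_eLpNorm (p := 2) (by simp)
      (fun N => (hSm N).aestronglyMeasurable) hZm.aestronglyMeasurable ?_
    have h1 : ∀ N, eLpNorm (S N - Z) 2 P =
        ENNReal.ofReal ((∫ ω, ‖S N ω - Z ω‖ ^ 2 ∂P) ^ ((2 : ℝ)⁻¹)) := by
      intro N
      have := ((hSG N).sub hZ).memLp.eLpNorm_eq_integral_rpow_norm (by simp) (by simp)
      simp only [ENNReal.toReal_ofNat, Real.rpow_ofNat] at this
      exact this
    simp_rw [h1]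
    have h2 := (hlim.rpow_const (p := (2 : ℝ)⁻¹) (Or.inr (by norm_num)))
    have h3 := ENNReal.tendsto_ofReal h2
    rwa [Real.zero_rpow (by norm_num), ENNReal.ofReal_zero] at h3
  have key : ∀ l : ℂ →L[ℝ] ℝ, ∀ᵐ ω ∂P, Tendsto (fun N => l (S N ω)) atTop (𝓝 (l (Z ω))) := by
    intro l
    have hint : ∀ {U : Ω → ℂ}, InGaussianSpace X P U → Integrable U P := fun hU =>
      hU.memLp.integrable (by norm_num)
    have hce : ∀ N, P[fun ω => l (Z ω) | F N] =ᵐ[P] fun ω => l (S (N + 1) ω) := by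
      intro N
      have h1 : P[fun ω => l (Z ω - S (N + 1) ω) | F N] =ᵐ[P] fun _ => 0 := by
        have h := condExp_indep_eq (μ := P) (f := fun ω => l (Z ω - S (N + 1) ω))
          (hZm.sub (hSm (N + 1))).comap_le (F.le N)
          (l.continuous.comp_stronglyMeasurable
            (comap_measurable (fun ω => Z ω - S (N + 1) ω)).stronglyMeasurable) (hind N)
        refine h.trans (.of_forall fun ω => ?_)
        have h0 := l.integral_comp_comm (hint (hZ.sub (hSG (N + 1))))
        rw [h0, (hZ.sub (hSG (N + 1))).integral_eq_zero hG, map_zero]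
      have h2 : P[fun ω => l (S (N + 1) ω) | F N] = fun ω => l (S (N + 1) ω) := by
        refine condExp_of_stronglyMeasurable (F.le N) ?_ (l.integrable_comp (hint (hSG _)))
        refine l.continuous.comp_stronglyMeasurable ?_
        refine Finset.stronglyMeasurable_fun_sum _ fun n hn => ?_
        exact ((Filtration.stronglyAdapted_natural
          fun n => (hYm n).stronglyMeasurable) n).mono (F.mono (by
            simpa [Nat.lt_succ_iff] using hn))
      have h3 : (fun ω => l (Z ω)) =
          (fun ω => l (Z ω - S (N + 1) ω)) + fun ω => l (S (N + 1) ω) := by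
        ext ω
        simp
      rw [h3]
      refine (condExp_add (l.integrable_comp (hint (hZ.sub (hSG _))))
        (l.integrable_comp (hint (hSG _))) _).trans ?_
      filter_upwards [h1] with ω h
      rw [Pi.add_apply, h, h2, zero_add]
    have hlimce := tendsto_ae_condExp (μ := P) (ℱ := F) fun ω => l (Z ω)
    have h4 : ∀ᵐ ω ∂P, Tendsto (fun N => l (S (N + 1) ω)) atTop
        (𝓝 ((P[fun ω => l (Z ω) | ⨆ n, F n]) ω)) := by
      filter_upwards [hlimce, ae_all_iff.2 hce] with ω h h'
      simpa [h'] using h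
    -- Convergence in measure identifies the limit given by Lévy's theorem with `l (Z ω)`.
    obtain ⟨ns, hns, hsub⟩ := hmeas.exists_seq_tendsto_ae
    filter_upwards [h4, hsub] with ω h h'
    rw [tendsto_add_atTop_iff_nat (f := fun N => l (S N ω)) 1] at h
    rwa [tendsto_nhds_unique ((l.continuous.tendsto _).comp h') (h.comp hns.tendsto_atTop)]
  filter_upwards [key Complex.reCLM, key Complex.imCLM] with ω hre him
  have := (Complex.continuous_ofReal.tendsto _ |>.comp hre).add
    ((Complex.continuous_ofReal.tendsto _ |>.comp him).mul_const Complex.I)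
  simpa [Function.comp_def, Complex.re_add_im] using this

end GaussianSpace

/-! ### Algebra of the Wigner functions -/

namespace SU2

/-- Both matrices are inverse to `g`. Comparing entries shows that the first column determines the
matrix. -/
theorem star_eq_adjugate (g : SU2) : star g.1 = g.1.adjugate := by
  obtain ⟨hu, hd⟩ := Matrix.mem_specialUnitaryGroup_iff.1 g.2
  have h1 : star g.1 * g.1 = 1 := (Matrix.mem_unitaryGroup_iff').1 hu
  have h2 : g.1 * g.1.adjugate = 1 := by rw [Matrix.mul_adjugate, hd, one_smul]
  exact left_inv_eq_right_inv h1 h2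

theorem apply_one_one (g : SU2) : g.1 1 1 = conj (g.1 0 0) := by
  have h := congrFun (congrFun (star_eq_adjugate g) 0) 0
  rw [Matrix.adjugate_fin_two] at h
  simpa [Matrix.star_apply] using h.symm

theorem apply_zero_one (g : SU2) : g.1 0 1 = -conj (g.1 1 0) := by
  have h := congrFun (congrFun (star_eq_adjugate g) 0) 1
  rw [Matrix.adjugate_fin_two] at h
  simp only [Matrix.star_apply, Matrix.of_apply, Matrix.cons_val_zero, Matrix.cons_val_one] at h
  rw [← neg_eq_iff_eq_neg]
  simpa using h.symm

theorem mul_conj_add_mul_conj (g : SU2) :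
    g.1 0 0 * conj (g.1 0 0) + g.1 1 0 * conj (g.1 1 0) = 1 := by
  have hd := (Matrix.mem_specialUnitaryGroup_iff.1 g.2).2
  rw [Matrix.det_fin_two, apply_one_one, apply_zero_one] at hd
  linear_combination hd

theorem mul_apply_zero_zero (g h : SU2) :
    (g * h).1 0 0 = g.1 0 0 * h.1 0 0 - conj (g.1 1 0) * h.1 1 0 := by
  simp [Matrix.mul_apply, Fin.sum_univ_two, apply_zero_one]
  ring

theorem mul_apply_one_zero (g h : SU2) :
    (g * h).1 1 0 = g.1 1 0 * h.1 0 0 + conj (g.1 0 0) * h.1 1 0 := by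
  simp [Matrix.mul_apply, Fin.sum_univ_two, apply_one_one]

theorem inv_apply_zero_zero (g : SU2) : (g⁻¹).1 0 0 = conj (g.1 0 0) := rfl

theorem inv_apply_one_zero (g : SU2) : (g⁻¹).1 1 0 = -(g.1 1 0) := by
  have : (g⁻¹).1 1 0 = conj (g.1 0 1) := rfl
  rw [this, apply_zero_one]
  simp

/-- The element of `SU(2)` with first column `(a, b)`. -/
def ofColumn (a b : ℂ) (h : a * conj a + b * conj b = 1) : SU2 :=
  ⟨!![a, -conj b; b, conj a], by
    rw [Matrix.mem_specialUnitaryGroup_iff, Matrix.mem_unitaryGroup_iff]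
    constructor
    · ext i j
      fin_cases i <;> fin_cases j <;>
        simp [Matrix.mul_apply, Fin.sum_univ_two, Matrix.star_apply] <;>
        first
          | linear_combination h
          | ring
    · rw [Matrix.det_fin_two_of]
      linear_combination h⟩

/-- Transposition of the matrices in `SU(2)`. -/
def transpose (g : SU2) : SU2 :=
  ⟨g.1.transpose, by
    obtain ⟨hu, hd⟩ := Matrix.mem_specialUnitaryGroup_iff.1 g.2
    rw [Matrix.mem_specialUnitaryGroup_iff, Matrix.mem_unitaryGroup_iff, Matrix.det_transpose]
    refine ⟨?_, hd⟩
    have h1 : star g.1 * g.1 = 1 := (Matrix.mem_unitaryGroup_iff').1 hu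
    have h2 := congrArg Matrix.transpose h1
    rwa [Matrix.transpose_mul, Matrix.transpose_one] at h2⟩

theorem transpose_transpose (g : SU2) : transpose (transpose g) = g := rfl

theorem transpose_mul (g h : SU2) : transpose (g * h) = transpose h * transpose g :=
  Subtype.ext (Matrix.transpose_mul _ _)

theorem transpose_apply_zero_zero (g : SU2) : (transpose g).1 0 0 = g.1 0 0 := rfl

theorem transpose_apply_one_zero (g : SU2) : (transpose g).1 1 0 = -conj (g.1 1 0) :=
  apply_zero_one g

theorem continuous_transpose : Continuous transpose :=
  Continuous.subtype_mk (continuous_subtype_val.matrix_transpose) _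

end SU2

open Polynomial in
/-- The polynomial `(conj a X + conj b)^j (-b X + a)^k`. -/
noncomputable def wignerPoly (j k : ℕ) (a b : ℂ) : ℂ[X] :=
  (C (conj a) * X + C (conj b)) ^ j * (C (-b) * X + C a) ^ k

theorem wignerD_eq (n : ℕ) (i j : Fin (n + 1)) (g : SU2) :
    wignerD n i j g = ((√(n.choose j : ℝ) / √(n.choose i : ℝ) : ℝ) : ℂ) *
      (wignerPoly j (n - j) (g.1 0 0) (g.1 1 0)).coeff i := rfl

/-! ### The action of the group on binary forms -/

section WignerPoly

open Polynomial

theorem natDegree_wignerPoly_le (j k : ℕ) (a b : ℂ) : (wignerPoly j k a b).natDegree ≤ j + k := by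
  have h (c d : ℂ) : (C c * X + C d).natDegree ≤ 1 := natDegree_linear_le
  refine natDegree_mul_le.trans (add_le_add ?_ ?_)
  · simpa using natDegree_pow_le_of_le j (h (conj a) (conj b))
  · simpa using natDegree_pow_le_of_le k (h (-b) a)

theorem wignerPoly_coeff_eq_zero {j k i : ℕ} (h : j + k < i) (a b : ℂ) :
    (wignerPoly j k a b).coeff i = 0 :=
  coeff_eq_zero_of_natDegree_lt ((natDegree_wignerPoly_le j k a b).trans_lt h)

/-- Homogenization of a polynomial, evaluated in a `ℂ`-algebra. -/
theorem sum_coeff_homogenize_linear_mul {R : Type*} [CommRing R] [Algebra ℂ R] (U V : R) (n : ℕ)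
    (p : ℂ[X]) (hp : p.natDegree ≤ n) (a b : ℂ) :
    ∑ i ∈ Finset.range (n + 2), ((C a * X + C b) * p).coeff i • (U ^ i * V ^ (n + 1 - i)) =
      (a • U + b • V) * ∑ i ∈ Finset.range (n + 1), p.coeff i • (U ^ i * V ^ (n - i)) := by
  have h1 : ∑ i ∈ Finset.range (n + 2), (C a * X * p).coeff i • (U ^ i * V ^ (n + 1 - i)) =
      a • U * ∑ i ∈ Finset.range (n + 1), p.coeff i • (U ^ i * V ^ (n - i)) := by
    rw [Finset.sum_range_succ', Finset.mul_sum]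
    have : (C a * X * p).coeff 0 = 0 := by simp [mul_assoc]
    rw [this, zero_smul, add_zero]
    refine Finset.sum_congr rfl fun i hi => ?_
    rw [mul_assoc, coeff_C_mul, coeff_X_mul, Nat.add_sub_add_right, pow_succ]
    simp only [Algebra.smul_def, map_mul]
    ring
  have h2 : ∑ i ∈ Finset.range (n + 2), (C b * p).coeff i • (U ^ i * V ^ (n + 1 - i)) =
      b • V * ∑ i ∈ Finset.range (n + 1), p.coeff i • (U ^ i * V ^ (n - i)) := by
    rw [Finset.sum_range_succ, Finset.mul_sum, coeff_C_mul,
      coeff_eq_zero_of_natDegree_lt (Nat.lt_succ_of_le hp), mul_zero, zero_smul, add_zero]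
    refine Finset.sum_congr rfl fun i hi => ?_
    rw [coeff_C_mul, Nat.sub_add_comm (Nat.lt_succ_iff.1 (Finset.mem_range.1 hi)), pow_succ]
    simp only [Algebra.smul_def, map_mul]
    ring
  simp_rw [add_mul, coeff_add, add_smul]
  rw [Finset.sum_add_distrib, h1, h2]

/-- This recovers the homogeneous form from its value at `z₁ = 1`. Taking `U` and `V` in an
arbitrary algebra allows linear forms to be substituted for the variables, which is how group
elements are composed. -/
theorem sum_wignerPoly_coeff {R : Type*} [CommRing R] [Algebra ℂ R] (U V : R) (j k : ℕ)
    (a b : ℂ) :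
    ∑ i ∈ Finset.range (j + k + 1), (wignerPoly j k a b).coeff i • (U ^ i * V ^ (j + k - i)) =
      (conj a • U + conj b • V) ^ j * ((-b) • U + a • V) ^ k := by
  induction j with
  | zero =>
    induction k with
    | zero => simp [wignerPoly]
    | succ k ih =>
      have h : wignerPoly 0 (k + 1) a b = (C (-b) * X + C a) * wignerPoly 0 k a b := by
        simp only [wignerPoly]
        ring
      have h2 := sum_coeff_homogenize_linear_mul U V (0 + k) _ (natDegree_wignerPoly_le 0 k a b)
        (-b) a
      rw [← h, ih] at h2
      rw [← add_assoc, h2]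
      ring
  | succ j ih =>
    have h : wignerPoly (j + 1) k a b = (C (conj a) * X + C (conj b)) * wignerPoly j k a b := by
      simp only [wignerPoly]
      ring
    have h2 := sum_coeff_homogenize_linear_mul U V (j + k) _ (natDegree_wignerPoly_le j k a b)
      (conj a) (conj b)
    rw [← h, ih] at h2
    rw [add_right_comm j 1 k, h2]
    ring

theorem sum_wignerPoly_coeff_fin {R : Type*} [CommRing R] [Algebra ℂ R] (U V : R) {n : ℕ}
    (j : Fin (n + 1)) (a b : ℂ) :
    ∑ i : Fin (n + 1), (wignerPoly j (n - j) a b).coeff i • (U ^ (i : ℕ) * V ^ (n - i)) =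
      (conj a • U + conj b • V) ^ (j : ℕ) * ((-b) • U + a • V) ^ (n - j) := by
  have h := sum_wignerPoly_coeff U V j (n - j) a b
  have hn : (j : ℕ) + (n - j) = n := Nat.add_sub_cancel' (Nat.lt_succ_iff.1 j.2)
  rw [hn] at h
  rw [← h, ← Fin.sum_univ_eq_sum_range
    (fun i => (wignerPoly j (n - j) a b).coeff i • (U ^ i * V ^ (n - i)))]

/-- Substituting the linear forms of `g⁻¹` into the form attached to `h` gives the form attached to
`g * h`. -/
theorem wignerPoly_coeff_mul {n : ℕ} (k j : Fin (n + 1)) (g h : SU2) :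
    (wignerPoly j (n - j) ((g * h).1 0 0) ((g * h).1 1 0)).coeff k =
      ∑ i : Fin (n + 1), (wignerPoly i (n - i) (g.1 0 0) (g.1 1 0)).coeff k *
        (wignerPoly j (n - j) (h.1 0 0) (h.1 1 0)).coeff i := by
  have hs := sum_wignerPoly_coeff_fin
    (C (conj (g.1 0 0)) * X + C (conj (g.1 1 0))) (C (-(g.1 1 0)) * X + C (g.1 0 0)) j
    (h.1 0 0) (h.1 1 0)
  have h1 : wignerPoly j (n - j) ((g * h).1 0 0) ((g * h).1 1 0) =
      ∑ i : Fin (n + 1), (wignerPoly j (n - j) (h.1 0 0) (h.1 1 0)).coeff i •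
        wignerPoly i (n - i) (g.1 0 0) (g.1 1 0) := by
    simp only [wignerPoly] at hs ⊢
    rw [hs, SU2.mul_apply_zero_zero, SU2.mul_apply_one_zero]
    congr 2
    · simp only [smul_eq_C_mul, map_sub, map_mul, map_add, map_neg, Complex.conj_conj]
      ring
    · simp only [smul_eq_C_mul, map_sub, map_mul, map_add, map_neg]
      ring
  rw [h1, finsetSum_coeff]
  refine Finset.sum_congr rfl fun i _ => ?_
  rw [coeff_smul, smul_eq_mul, mul_comm]

theorem eq_of_sum_mul_pow_eq {n : ℕ} {a b : Fin (n + 1) → ℂ}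
    (h : ∀ x : ℂ, ∑ i, a i * x ^ (i : ℕ) = ∑ i, b i * x ^ (i : ℕ)) : a = b := by
  have key : ∀ c : Fin (n + 1) → ℂ, ∀ k : Fin (n + 1),
      (∑ i, C (c i) * X ^ (i : ℕ) : ℂ[X]).coeff k = c k := by
    intro c k
    simp [finsetSum_coeff, coeff_C_mul, coeff_X_pow, Fin.val_inj]
  have hp : (∑ i, C (a i) * X ^ (i : ℕ) : ℂ[X]) = ∑ i, C (b i) * X ^ (i : ℕ) :=
    Polynomial.funext fun x => by simpa [eval_finsetSum] using h x
  ext k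
  rw [← key a k, hp, key]

theorem sum_wignerPoly_coeff_mul_pow {n : ℕ} (j : Fin (n + 1)) (a b x : ℂ) :
    ∑ i : Fin (n + 1), (wignerPoly j (n - j) a b).coeff i * x ^ (i : ℕ) =
      (conj a * x + conj b) ^ (j : ℕ) * (-b * x + a) ^ (n - j) := by
  simpa using sum_wignerPoly_coeff_fin x 1 j a b

theorem conj_wignerPoly_coeff (j k i : ℕ) (a b : ℂ) :
    conj ((wignerPoly j k a b).coeff i) = (wignerPoly j k (conj a) (conj b)).coeff i := by
  rw [← coeff_map]
  simp [wignerPoly]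

/-- The generating function identity behind the unitarity of the Wigner matrices. -/
theorem choose_mul_conj_wignerPoly_coeff {n : ℕ} (i j : Fin (n + 1)) (a b : ℂ) :
    (n.choose j : ℂ) * conj ((wignerPoly j (n - j) a b).coeff i) =
      n.choose i * (wignerPoly i (n - i) (conj a) (-b)).coeff j := by
  -- Both sides expand the power `(a x y + b y - conj b x + conj a) ^ n`, grouped by `y` on the left
  -- and by `x` on the right.
  have hgen : ∀ x y : ℂ,
      ∑ i : Fin (n + 1), (∑ j : Fin (n + 1), (n.choose j : ℂ) *
        conj ((wignerPoly j (n - j) a b).coeff i) * y ^ (j : ℕ)) * x ^ (i : ℕ) =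
      ∑ i : Fin (n + 1), (∑ j : Fin (n + 1), (n.choose i : ℂ) *
        (wignerPoly i (n - i) (conj a) (-b)).coeff j * y ^ (j : ℕ)) * x ^ (i : ℕ) := by
    intro x y
    have hL : ∑ i : Fin (n + 1), (∑ j : Fin (n + 1), (n.choose j : ℂ) *
        conj ((wignerPoly j (n - j) a b).coeff i) * y ^ (j : ℕ)) * x ^ (i : ℕ) =
        (y * (a * x + b) + (-conj b * x + conj a)) ^ n := by
      simp_rw [Finset.sum_mul]
      rw [Finset.sum_comm, add_pow, ← Fin.sum_univ_eq_sum_range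
        (fun j => (y * (a * x + b)) ^ j * (-conj b * x + conj a) ^ (n - j) * (n.choose j : ℂ))]
      refine Finset.sum_congr rfl fun j _ => ?_
      have h := sum_wignerPoly_coeff_mul_pow j (conj a) (conj b) x
      simp only [Complex.conj_conj] at h
      rw [mul_pow, mul_assoc (y ^ (j : ℕ)), ← h, Finset.mul_sum, Finset.sum_mul]
      refine Finset.sum_congr rfl fun i _ => ?_
      rw [conj_wignerPoly_coeff]
      ring
    have hR : ∑ i : Fin (n + 1), (∑ j : Fin (n + 1), (n.choose i : ℂ) *
        (wignerPoly i (n - i) (conj a) (-b)).coeff j * y ^ (j : ℕ)) * x ^ (i : ℕ) =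
        (x * (a * y - conj b) + (b * y + conj a)) ^ n := by
      rw [add_pow, ← Fin.sum_univ_eq_sum_range
        (fun i => (x * (a * y - conj b)) ^ i * (b * y + conj a) ^ (n - i) * (n.choose i : ℂ))]
      refine Finset.sum_congr rfl fun i _ => ?_
      have h := sum_wignerPoly_coeff_mul_pow i (conj a) (-b) y
      simp only [Complex.conj_conj, map_neg, neg_neg] at h
      rw [mul_pow, mul_assoc (x ^ (i : ℕ)), sub_eq_add_neg (a * y), ← h, Finset.mul_sum,
        Finset.sum_mul, Finset.sum_mul]
      refine Finset.sum_congr rfl fun j _ => ?_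
      ring
    rw [hL, hR]
    ring
  have h1 : ∀ y : ℂ, _ = _ := fun y => congrFun (eq_of_sum_mul_pow_eq fun x => hgen x y) i
  exact congrFun (eq_of_sum_mul_pow_eq h1) j

end WignerPoly

/-! ### The Wigner matrices as a continuous unitary representation -/

theorem wignerD_mul {n : ℕ} (i j : Fin (n + 1)) (g h : SU2) :
    wignerD n i j (g * h) = ∑ k, wignerD n i k g * wignerD n k j h := by
  simp_rw [wignerD_eq]
  rw [wignerPoly_coeff_mul, Finset.mul_sum]
  refine Finset.sum_congr rfl fun k _ => ?_
  have hk : (√(n.choose k : ℝ) : ℂ) ≠ 0 := by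
    have := Nat.choose_pos (Nat.lt_succ_iff.1 k.2)
    exact_mod_cast (Real.sqrt_pos.2 (by exact_mod_cast this)).ne'
  push_cast
  field_simp

/-- The square roots of binomial coefficients in `wignerD` symmetrize the weighted identity
`choose_mul_conj_wignerPoly_coeff`, which thereby becomes unitarity. -/
theorem wignerD_inv {n : ℕ} (i j : Fin (n + 1)) (g : SU2) :
    wignerD n i j g⁻¹ = conj (wignerD n j i g) := by
  have h := choose_mul_conj_wignerPoly_coeff j i (g.1 0 0) (g.1 1 0)
  have hne : ∀ k : Fin (n + 1), (√(n.choose k : ℝ) : ℂ) ≠ 0 := by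
    intro k
    have := Nat.choose_pos (Nat.lt_succ_iff.1 k.2)
    exact_mod_cast (Real.sqrt_pos.2 (by exact_mod_cast this)).ne'
  have hsq : ∀ k : Fin (n + 1), (n.choose k : ℂ) = (√(n.choose k : ℝ) : ℂ) ^ 2 := by
    intro k
    have : (√(n.choose k : ℝ)) ^ 2 = n.choose k := Real.sq_sqrt (by positivity)
    exact_mod_cast this.symm
  rw [wignerD_eq, wignerD_eq, SU2.inv_apply_zero_zero, SU2.inv_apply_one_zero, map_mul,
    Complex.conj_ofReal]
  rw [hsq, hsq] at h
  have h1 := hne i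
  have h2 := hne j
  push_cast
  field_simp
  linear_combination -h

/-- For a unitary matrix, `gᵀ` is the entrywise conjugate of `g⁻¹`, and conjugating the entries
conjugates the coefficients of the Wigner polynomials. -/
theorem wignerD_transpose {n : ℕ} (i j : Fin (n + 1)) (g : SU2) :
    wignerD n i j (SU2.transpose g) = wignerD n j i g := by
  have h := wignerD_inv i j g
  rw [← Complex.conj_conj (wignerD n j i g), ← h, wignerD_eq, wignerD_eq, map_mul,
    Complex.conj_ofReal, conj_wignerPoly_coeff, SU2.inv_apply_zero_zero, SU2.inv_apply_one_zero,
    SU2.transpose_apply_zero_zero, SU2.transpose_apply_one_zero, Complex.conj_conj, map_neg]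

theorem continuous_wignerPoly_coeff (j k i : ℕ) :
    Continuous fun g : SU2 => (wignerPoly j k (g.1 0 0) (g.1 1 0)).coeff i := by
  have hmul : ∀ p q : SU2 → Polynomial ℂ, (∀ i, Continuous fun g => (p g).coeff i) →
      (∀ i, Continuous fun g => (q g).coeff i) →
      ∀ i, Continuous fun g => (p g * q g).coeff i := by
    intro p q hp hq i
    simp_rw [Polynomial.coeff_mul]
    exact continuous_finsetSum _ fun x _ => (hp _).mul (hq _)
  have hpow : ∀ p : SU2 → Polynomial ℂ, (∀ i, Continuous fun g => (p g).coeff i) →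
      ∀ k i, Continuous fun g => (p g ^ k).coeff i := by
    intro p hp k
    induction k with
    | zero =>
      intro i
      simp only [pow_zero]
      exact continuous_const
    | succ k ih =>
      simp_rw [pow_succ]
      exact hmul _ _ ih hp
  have hlin : ∀ a b : SU2 → ℂ, Continuous a → Continuous b → ∀ i, Continuous fun g =>
      (Polynomial.C (a g) * Polynomial.X + Polynomial.C (b g)).coeff i := by
    intro a b ha hb i
    simp only [Polynomial.coeff_add, Polynomial.coeff_C_mul, Polynomial.coeff_C]
    refine (ha.mul continuous_const).add ?_
    split_ifs
    exacts [hb, continuous_const]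
  have he : ∀ k l, Continuous fun g : SU2 => g.1 k l := fun k l =>
    continuous_subtype_val.matrix_elem k l
  exact hmul _ _
    (hpow _ (hlin _ _ (Complex.continuous_conj.comp (he 0 0))
      (Complex.continuous_conj.comp (he 1 0))) j)
    (hpow _ (hlin _ _ (he 1 0).neg (he 0 0)) k) i

theorem continuous_wignerD (n : ℕ) (i j : Fin (n + 1)) : Continuous (wignerD n i j) :=
  continuous_const.mul (continuous_wignerPoly_coeff _ _ _)

theorem continuous_hypersphericalHarmonic (n : ℕ) (i j : Fin (n + 1)) :
    Continuous (hypersphericalHarmonic n i j) :=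
  continuous_const.mul (continuous_wignerD n i j)

theorem wignerD_one {n : ℕ} (i j : Fin (n + 1)) :
    wignerD n i j 1 = if i = j then 1 else 0 := by
  have h : (wignerPoly j (n - j) ((1 : SU2).1 0 0) ((1 : SU2).1 1 0)).coeff i =
      if i = j then 1 else 0 := by
    simp [wignerPoly, Polynomial.coeff_X_pow, Fin.val_inj]
  rw [wignerD_eq, h]
  split_ifs with hij
  · subst hij
    have := Nat.choose_pos (Nat.lt_succ_iff.1 i.2)
    rw [div_self (Real.sqrt_pos.2 (by exact_mod_cast this)).ne']
    simp
  · simp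

theorem sum_wignerD_mul_conj {n : ℕ} (j k : Fin (n + 1)) (g h : SU2) :
    ∑ i, wignerD n i j g * conj (wignerD n i k h) = wignerD n k j (h⁻¹ * g) := by
  rw [wignerD_mul]
  refine Finset.sum_congr rfl fun i _ => ?_
  rw [wignerD_inv, mul_comm]

/-! ### The invariant measure -/

instance SU2.instSecondCountableTopology : SecondCountableTopology SU2 :=
  inferInstanceAs (SecondCountableTopology
    {A : Fin 2 → Fin 2 → ℂ // A ∈ Matrix.specialUnitaryGroup (Fin 2) ℂ})

instance SU2.instT2Space : T2Space SU2 :=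
  inferInstanceAs (T2Space {A : Fin 2 → Fin 2 → ℂ // A ∈ Matrix.specialUnitaryGroup (Fin 2) ℂ})

instance isMulLeftInvariant_volSU2 : volSU2.IsMulLeftInvariant := by
  unfold volSU2; infer_instance

instance isFiniteMeasure_volSU2 : IsFiniteMeasure volSU2 :=
  Measure.smul_finite _ ENNReal.ofReal_ne_top

instance regular_volSU2 : volSU2.Regular :=
  Measure.Regular.smul ENNReal.ofReal_ne_top

theorem volSU2_real_univ : volSU2.real Set.univ = 16 * Real.pi ^ 2 := by
  have h : Measure.haarMeasure (⊤ : TopologicalSpace.PositiveCompacts SU2) Set.univ = 1 :=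
    Measure.haarMeasure_self
  rw [volSU2, measureReal_ennreal_smul_apply, measureReal_def, h,
    ENNReal.toReal_ofReal (by positivity)]
  simp

/-- The double integral of `f (xᵀ y)` is computed in both orders. Left invariance in `y` gives the
volume times `∫ f`; writing `xᵀ y = (yᵀ x)ᵀ`, left invariance in `x` gives the volume times the
integral of `f` after transposition. -/
theorem measurePreserving_transpose : MeasurePreserving SU2.transpose volSU2 volSU2 := by
  have ht : Measurable SU2.transpose := SU2.continuous_transpose.measurable
  refine ⟨ht, Measure.ext_of_lintegral _ fun f hf => ?_⟩
  rw [lintegral_map hf ht]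
  have hV : volSU2 Set.univ ≠ 0 := by
    intro h
    have := volSU2_real_univ
    rw [measureReal_def, h, ENNReal.toReal_zero] at this
    have h2 : (0 : ℝ) < 16 * Real.pi ^ 2 := by positivity
    exact h2.ne this
  have hsw : ∫⁻ x, ∫⁻ y, f (SU2.transpose x * y) ∂volSU2 ∂volSU2 =
      ∫⁻ y, ∫⁻ x, f (SU2.transpose x * y) ∂volSU2 ∂volSU2 :=
    lintegral_lintegral_swap (by fun_prop)
  have h1 : ∀ x, ∫⁻ y, f (SU2.transpose x * y) ∂volSU2 = ∫⁻ y, f y ∂volSU2 := fun x =>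
    lintegral_mul_left_eq_self f (SU2.transpose x)
  have h2 : ∀ y, ∫⁻ x, f (SU2.transpose x * y) ∂volSU2 =
      ∫⁻ x, f (SU2.transpose x) ∂volSU2 := fun y => by
    rw [← lintegral_mul_left_eq_self (fun x => f (SU2.transpose x)) (SU2.transpose y)]
    simp_rw [SU2.transpose_mul, SU2.transpose_transpose]
  simp_rw [h1, h2, lintegral_const] at hsw
  exact ((ENNReal.mul_left_inj hV (measure_ne_top _ _)).1 hsw).symm

theorem integrable_of_continuous {f : SU2 → ℂ} (hf : Continuous f) : Integrable f volSU2 :=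
  hf.integrable_of_hasCompactSupport (HasCompactSupport.of_compactSpace f)

/-! ### Orthogonality of the Wigner functions -/

/-- The diagonal element of `SU(2)` with first entry `exp (iθ)`. -/
noncomputable def SU2.diagonal (θ : ℝ) : SU2 :=
  SU2.ofColumn (Complex.exp (θ * Complex.I)) 0 (by
    rw [← Complex.exp_conj, ← Complex.exp_add]
    simp)

theorem wignerD_diagonal {n : ℕ} (i j : Fin (n + 1)) (θ : ℝ) :
    wignerD n i j (SU2.diagonal θ) =
      if i = j then Complex.exp (θ * ((n : ℤ) - 2 * (i : ℤ) : ℤ) * Complex.I) else 0 := by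
  have h0 : (SU2.diagonal θ).1 0 0 = Complex.exp (θ * Complex.I) := rfl
  have h1 : (SU2.diagonal θ).1 1 0 = 0 := rfl
  have h : wignerPoly j (n - j) (Complex.exp (θ * Complex.I)) 0 =
      Polynomial.C (Complex.exp (θ * ((n : ℤ) - 2 * (j : ℤ) : ℤ) * Complex.I)) *
        Polynomial.X ^ (j : ℕ) := by
    have he : Complex.exp (-(θ * Complex.I)) ^ (j : ℕ) * Complex.exp (θ * Complex.I) ^ (n - j) =
        Complex.exp (θ * ((n : ℤ) - 2 * (j : ℤ) : ℤ) * Complex.I) := by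
      rw [← Complex.exp_nat_mul, ← Complex.exp_nat_mul, ← Complex.exp_add,
        Nat.cast_sub (Nat.lt_succ_iff.1 j.2)]
      push_cast
      congr 1
      ring
    rw [wignerPoly, ← Complex.exp_conj]
    simp only [map_mul, Complex.conj_ofReal, Complex.conj_I, map_zero, neg_zero, zero_mul,
      zero_add, add_zero, mul_neg, mul_pow]
    rw [← he, map_mul, map_pow, map_pow]
    ring
  rw [wignerD_eq, h0, h1, h, Polynomial.coeff_C_mul, Polynomial.coeff_X_pow]
  simp only [Fin.val_inj]
  split_ifs with hij
  · subst hij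
    have := Nat.choose_pos (Nat.lt_succ_iff.1 i.2)
    rw [div_self (Real.sqrt_pos.2 (by exact_mod_cast this)).ne']
    simp
  · simp

/-- An element with nonzero first column makes the last column of each Wigner matrix a row of
binomial terms, none of them zero. It isolates single entries in the intertwining relation below;
the triple 3, 4, 5 keeps the entries rational. -/
theorem exists_wignerD_last_ne_zero : ∃ h : SU2, ∀ (n : ℕ) (i : Fin (n + 1)),
    wignerD n i (Fin.last n) h ≠ 0 := by
  have h35 : conj (3 / 5 : ℂ) = 3 / 5 := by rw [map_div₀, map_ofNat, map_ofNat]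
  have h45 : conj (4 / 5 : ℂ) = 4 / 5 := by rw [map_div₀, map_ofNat, map_ofNat]
  refine ⟨SU2.ofColumn (3 / 5) (4 / 5) (by rw [h35, h45]; norm_num), fun n i => ?_⟩
  have hp : wignerPoly n 0 (3 / 5) (4 / 5) =
      (Polynomial.C (3 / 5) * (Polynomial.X + Polynomial.C (4 / 3))) ^ n := by
    rw [wignerPoly, h35, h45, pow_zero, mul_one, mul_add, ← Polynomial.C_mul]
    norm_num
  have hc : (wignerPoly n 0 (3 / 5) (4 / 5)).coeff i =
      (3 / 5 : ℂ) ^ n * ((4 / 3) ^ (n - i) * (n.choose i : ℂ)) := by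
    rw [hp, mul_pow, ← Polynomial.C_pow, Polynomial.coeff_C_mul, Polynomial.coeff_X_add_C_pow]
  have hpos := Nat.choose_pos (Nat.lt_succ_iff.1 i.2)
  have hs := (Real.sqrt_pos.2 (by exact_mod_cast hpos : (0 : ℝ) < n.choose i)).ne'
  rw [wignerD_eq]
  simp only [Fin.val_last, Nat.sub_self]
  change _ * (wignerPoly n 0 (3 / 5) (4 / 5)).coeff i ≠ 0
  rw [hc]
  have h3 : (n.choose i : ℂ) ≠ 0 := by exact_mod_cast hpos.ne'
  refine mul_ne_zero (Complex.ofReal_ne_zero.2 (div_ne_zero ?_ hs)) ?_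
  · simp
  · exact mul_ne_zero (pow_ne_zero _ (by norm_num)) (mul_ne_zero (pow_ne_zero _ (by norm_num)) h3)

theorem integrable_wignerD_mul_conj {n n' : ℕ} (i k : Fin (n + 1)) (j l : Fin (n' + 1)) :
    Integrable (fun g => wignerD n i k g * conj (wignerD n' j l g)) volSU2 :=
  integrable_of_continuous ((continuous_wignerD n i k).mul
    (Complex.continuous_conj.comp (continuous_wignerD n' j l)))

/-- The averaged matrix of products intertwines the representations of degrees `n` and `n'`: both
sides are `∫ D_{ik}(hg) conj D_{jl}(g) dg`, by invariance of the measure. -/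
theorem sum_wignerD_mul_integral {n n' : ℕ} (k : Fin (n + 1)) (l : Fin (n' + 1)) (h : SU2)
    (i : Fin (n + 1)) (j : Fin (n' + 1)) :
    ∑ p, wignerD n i p h * ∫ g, wignerD n p k g * conj (wignerD n' j l g) ∂volSU2 =
      ∑ q, (∫ g, wignerD n i k g * conj (wignerD n' q l g) ∂volSU2) * wignerD n' q j h := by
  have h1 : ∑ p, wignerD n i p h * ∫ g, wignerD n p k g * conj (wignerD n' j l g) ∂volSU2 =
      ∫ g, wignerD n i k (h * g) * conj (wignerD n' j l g) ∂volSU2 := by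
    simp_rw [← integral_const_mul]
    rw [← integral_finsetSum _ fun p _ => (integrable_wignerD_mul_conj p k j l).const_mul _]
    simp_rw [wignerD_mul, Finset.sum_mul, mul_assoc]
  have h2 : ∑ q, (∫ g, wignerD n i k g * conj (wignerD n' q l g) ∂volSU2) * wignerD n' q j h =
      ∫ g, wignerD n i k g * conj (wignerD n' j l (h⁻¹ * g)) ∂volSU2 := by
    simp_rw [← integral_mul_const]
    rw [← integral_finsetSum _ fun q _ => (integrable_wignerD_mul_conj i k q l).mul_const _]
    simp_rw [wignerD_mul, wignerD_inv, map_sum, map_mul, Complex.conj_conj, Finset.mul_sum]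
    congr 1
    ext g
    exact Finset.sum_congr rfl fun q _ => by ring
  rw [h1, h2, ← integral_mul_left_eq_self
    (fun g => wignerD n i k g * conj (wignerD n' j l (h⁻¹ * g))) h]
  simp only [inv_mul_cancel_left]

/-- For a diagonal `h` the intertwining relation multiplies the integral by a phase on each side. If
the weights differed by `d ≠ 0`, the angle `π / d` would make the two phases opposite. -/
theorem weight_eq_of_integral_ne_zero {n n' : ℕ} {i k : Fin (n + 1)} {j l : Fin (n' + 1)}
    (h : ∫ g, wignerD n i k g * conj (wignerD n' j l g) ∂volSU2 ≠ 0) :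
    (n : ℤ) - 2 * (i : ℤ) = (n' : ℤ) - 2 * (j : ℤ) := by
  by_contra hne
  set d : ℤ := ((n : ℤ) - 2 * (i : ℤ)) - ((n' : ℤ) - 2 * (j : ℤ)) with hd
  have hd0 : (d : ℝ) ≠ 0 := by
    exact Int.cast_ne_zero.2 (sub_ne_zero.2 hne)
  have hs := sum_wignerD_mul_integral k l (SU2.diagonal (Real.pi / d)) i j
  simp only [wignerD_diagonal, ite_mul, mul_ite, zero_mul, mul_zero, Finset.sum_ite_eq,
    Finset.sum_ite_eq', Finset.mem_univ, if_true] at hs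
  rw [mul_comm] at hs
  have he := mul_left_cancel₀ h hs
  have h3 : Complex.exp ((Real.pi / d : ℝ) * ((n : ℤ) - 2 * (i : ℤ) : ℤ) * Complex.I) =
      Complex.exp ((Real.pi / d : ℝ) * ((n' : ℤ) - 2 * (j : ℤ) : ℤ) * Complex.I) *
        Complex.exp (Real.pi * Complex.I) := by
    rw [← Complex.exp_add]
    congr 1
    have h4 : ((n : ℤ) - 2 * (i : ℤ) : ℤ) = ((n' : ℤ) - 2 * (j : ℤ)) + d := by rw [hd]; ring
    have h5 : (d : ℂ) ≠ 0 := by exact_mod_cast hd0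
    rw [h4]
    push_cast
    field_simp
    try ring
  rw [he, Complex.exp_pi_mul_I] at h3
  have h6 := Complex.exp_ne_zero
    ((Real.pi / d : ℝ) * ((n' : ℤ) - 2 * (j : ℤ) : ℤ) * Complex.I)
  apply h6
  linear_combination h3 / 2

/-- The last index of degree `n'` has weight `-n'`, which lies below every weight of degree `n`. In
that column the left side of the intertwining relation vanishes, while on the right only the index
`j` of the same weight as `i` survives, with a nonzero factor. -/
theorem integral_wignerD_mul_conj_of_lt {n n' : ℕ} (hn : n < n') (i k : Fin (n + 1))
    (j l : Fin (n' + 1)) : ∫ g, wignerD n i k g * conj (wignerD n' j l g) ∂volSU2 = 0 := by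
  by_contra hne
  obtain ⟨h, hh⟩ := exists_wignerD_last_ne_zero
  have hs := sum_wignerD_mul_integral k l h i (Fin.last n')
  rw [Finset.sum_eq_zero, Finset.sum_eq_single j] at hs
  · exact mul_ne_zero hne (hh n' j) hs.symm
  · intro q _ hq
    by_contra hq'
    have h1 := weight_eq_of_integral_ne_zero (left_ne_zero_of_mul hq')
    have h2 := weight_eq_of_integral_ne_zero hne
    exact hq (Fin.ext (by omega))
  · simp
  · intro p _
    by_contra hp
    have h1 := weight_eq_of_integral_ne_zero (right_ne_zero_of_mul hp)
    have h2 := p.2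
    simp only [Fin.val_last] at h1
    omega

theorem integral_wignerD_mul_conj_of_ne {n n' : ℕ} (hn : n ≠ n') (i k : Fin (n + 1))
    (j l : Fin (n' + 1)) : ∫ g, wignerD n i k g * conj (wignerD n' j l g) ∂volSU2 = 0 := by
  rcases lt_or_gt_of_ne hn with h | h
  · exact integral_wignerD_mul_conj_of_lt h i k j l
  · have := congrArg conj (integral_wignerD_mul_conj_of_lt h j l i k)
    rw [← integral_conj, map_zero] at this
    simpa [mul_comm] using this

/-- Within one degree the weights are distinct, so the averaged matrix is diagonal; the last column
of the intertwining relation makes it scalar. Its trace is, by unitarity, the volume or zero. -/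
theorem integral_wignerD_mul_conj {n : ℕ} (i k j l : Fin (n + 1)) :
    ∫ g, wignerD n i k g * conj (wignerD n j l g) ∂volSU2 =
      if i = j ∧ k = l then ((16 * Real.pi ^ 2 / (n + 1) : ℝ) : ℂ) else 0 := by
  have hdiag : ∀ {i j : Fin (n + 1)}, i ≠ j →
      ∫ g, wignerD n i k g * conj (wignerD n j l g) ∂volSU2 = 0 := by
    intro i j hij
    by_contra hne
    have h1 := weight_eq_of_integral_ne_zero hne
    exact hij (Fin.ext (by omega))
  by_cases hij : i = j
  · subst hij
    obtain ⟨h, hh⟩ := exists_wignerD_last_ne_zero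
    have hconst : ∀ i : Fin (n + 1), ∫ g, wignerD n i k g * conj (wignerD n i l g) ∂volSU2 =
        ∫ g, wignerD n (Fin.last n) k g * conj (wignerD n (Fin.last n) l g) ∂volSU2 := by
      intro i
      have hs := sum_wignerD_mul_integral k l h i (Fin.last n)
      rw [Finset.sum_eq_single (Fin.last n), Finset.sum_eq_single i, mul_comm] at hs
      · exact (mul_right_cancel₀ (hh n i) hs).symm
      · intro q _ hq
        rw [hdiag hq.symm, zero_mul]
      · simp
      · intro q _ hq
        rw [hdiag hq, mul_zero]
      · simp
    have htr : ∑ i, ∫ g, wignerD n i k g * conj (wignerD n i l g) ∂volSU2 =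
        if k = l then ((16 * Real.pi ^ 2 : ℝ) : ℂ) else 0 := by
      rw [← integral_finsetSum _ fun i _ => integrable_wignerD_mul_conj i k i l]
      simp_rw [sum_wignerD_mul_conj, inv_mul_cancel, wignerD_one]
      rw [integral_const, volSU2_real_univ]
      simp only [eq_comm (a := l)]
      split_ifs <;> simp
    rw [Finset.sum_congr rfl fun p _ => (hconst p).trans (hconst i).symm, Finset.sum_const,
      Finset.card_univ, Fintype.card_fin, nsmul_eq_mul] at htr
    have hn : ((n + 1 : ℕ) : ℂ) ≠ 0 := by exact_mod_cast n.succ_ne_zero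
    simp only [true_and]
    rw [eq_comm, ← mul_right_inj' hn, htr]
    push_cast at hn ⊢
    split_ifs
    · field_simp
    · simp
  · rw [hdiag hij, if_neg fun h => hij h.1]

theorem integral_harmonic_mul_conj_of_ne {n n' : ℕ} (hn : n ≠ n') (i k : Fin (n + 1))
    (j l : Fin (n' + 1)) :
    ∫ g, hypersphericalHarmonic n i k g * conj (hypersphericalHarmonic n' j l g) ∂volSU2 = 0 := by
  simp_rw [hypersphericalHarmonic, map_mul]
  rw [integral_congr_ae (.of_forall fun g => mul_mul_mul_comm _ _ _ _), integral_const_mul, integral_wignerD_mul_conj_of_ne hn, mul_zero]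

theorem integral_harmonic_mul_conj {n : ℕ} (i k j l : Fin (n + 1)) :
    ∫ g, hypersphericalHarmonic n i k g * conj (hypersphericalHarmonic n j l g) ∂volSU2 =
      if i = j ∧ k = l then 1 else 0 := by
  simp_rw [hypersphericalHarmonic, map_mul]
  rw [integral_congr_ae (.of_forall fun g => mul_mul_mul_comm _ _ _ _), integral_const_mul, integral_wignerD_mul_conj, Complex.conj_ofReal]
  split_ifs
  · rw [← Complex.ofReal_mul, ← Complex.ofReal_mul, ← Complex.ofReal_one]
    congr 1
    have h1 : √(n + 1 : ℝ) * √(n + 1 : ℝ) = n + 1 := Real.mul_self_sqrt (by positivity)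
    have h2 := Real.pi_pos.ne'
    have h3 : (n + 1 : ℝ) ≠ 0 := by positivity
    rw [div_mul_div_comm, h1]
    field_simp
    norm_num
  · simp

/-! ### Completeness of the hyperspherical harmonics -/

section WignerPolyRelations

open Polynomial

theorem coeff_X_mul_derivative (p : ℂ[X]) (i : ℕ) :
    (X * derivative p).coeff i = i * p.coeff i := by
  cases i with
  | zero => simp
  | succ i =>
    rw [coeff_X_mul, coeff_derivative]
    push_cast
    ring

theorem derivative_wignerPoly (j k : ℕ) (a b : ℂ) :
    derivative (wignerPoly j k a b) =
      C (j * conj a) * wignerPoly (j - 1) k a b - C (k * b) * wignerPoly j (k - 1) a b := by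
  simp only [wignerPoly, derivative_mul, derivative_pow, derivative_add, derivative_C,
    derivative_X, map_mul, map_neg, map_natCast]
  ring

theorem wignerPoly_mul_left (j k : ℕ) (a b : ℂ) :
    wignerPoly (j + 1) k a b = C (conj a) * (X * wignerPoly j k a b) +
      C (conj b) * wignerPoly j k a b := by
  rw [wignerPoly, wignerPoly]
  ring

theorem wignerPoly_mul_right (j k : ℕ) (a b : ℂ) :
    wignerPoly j (k + 1) a b = C a * wignerPoly j k a b - C b * (X * wignerPoly j k a b) := by
  rw [wignerPoly, wignerPoly, map_neg]
  ring

theorem natCast_mul_wignerPoly_left (j k : ℕ) (a b : ℂ) :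
    (j : ℂ[X]) * wignerPoly j k a b =
      C (j * conj a) * (X * wignerPoly (j - 1) k a b) +
        C (j * conj b) * wignerPoly (j - 1) k a b := by
  cases j with
  | zero => simp
  | succ j =>
    rw [wignerPoly_mul_left, Nat.add_sub_cancel]
    simp only [map_mul, map_natCast]
    ring

theorem natCast_mul_wignerPoly_right (j k : ℕ) (a b : ℂ) :
    (k : ℂ[X]) * wignerPoly j k a b =
      C (k * a) * wignerPoly j (k - 1) a b - C (k * b) * (X * wignerPoly j (k - 1) a b) := by
  cases k with
  | zero => simp
  | succ k =>
    rw [wignerPoly_mul_right, Nat.add_sub_cancel]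
    simp only [map_mul, map_natCast]
    ring

/-- At `z₁ = 1` the derivative is `∂₀` of the form, and `(j + k) p - X p'` is `∂₁` by Euler's
identity. The operator `a ∂₀ + b ∂₁` kills the factor `-b z₀ + a z₁` and sends the other linear
factor to `1`. For `j = 0` the truncated `j - 1` is harmless, its coefficient being zero. -/
theorem wignerPoly_lowering_left {a b : ℂ} (hab : a * conj a + b * conj b = 1) (j k : ℕ) :
    C a * derivative (wignerPoly j k a b) + C b * (((j + k : ℕ) : ℂ[X]) * wignerPoly j k a b -
      X * derivative (wignerPoly j k a b)) = (j : ℂ[X]) * wignerPoly (j - 1) k a b := by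
  have h : C a * C (conj a) + C b * C (conj b) = 1 := by
    rw [← C_mul, ← C_mul, ← C_add, hab, C_1]
  have h1 := natCast_mul_wignerPoly_left j k a b
  have h2 := natCast_mul_wignerPoly_right j k a b
  rw [derivative_wignerPoly]
  simp only [map_mul, map_natCast, Nat.cast_add] at h1 h2 ⊢
  linear_combination C b * h1 + C b * h2 + (j : ℂ[X]) * wignerPoly (j - 1) k a b * h

theorem wignerPoly_lowering_right {a b : ℂ} (hab : a * conj a + b * conj b = 1) (j k : ℕ) :
    C (conj a) * (((j + k : ℕ) : ℂ[X]) * wignerPoly j k a b -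
      X * derivative (wignerPoly j k a b)) - C (conj b) * derivative (wignerPoly j k a b) =
      (k : ℂ[X]) * wignerPoly j (k - 1) a b := by
  have h : C a * C (conj a) + C b * C (conj b) = 1 := by
    rw [← C_mul, ← C_mul, ← C_add, hab, C_1]
  have h1 := natCast_mul_wignerPoly_left j k a b
  have h2 := natCast_mul_wignerPoly_right j k a b
  rw [derivative_wignerPoly]
  simp only [map_mul, map_natCast, Nat.cast_add] at h1 h2 ⊢
  linear_combination C (conj a) * h1 + C (conj a) * h2 +
    (k : ℂ[X]) * wignerPoly j (k - 1) a b * h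

/-- Multiplication of a coefficient by the matrix entries of `SU(2)`. -/
theorem mul_wignerPoly_coeff {a b : ℂ} (hab : a * conj a + b * conj b = 1) (j k i : ℕ) :
    (j + k + 1 : ℂ) * (a * (wignerPoly j k a b).coeff (i + 1)) =
        j * (wignerPoly (j - 1) k a b).coeff i +
          (j + k - i) * (wignerPoly j (k + 1) a b).coeff (i + 1) ∧
      (j + k + 1 : ℂ) * (b * (wignerPoly j k a b).coeff i) =
        j * (wignerPoly (j - 1) k a b).coeff i -
          (i + 1) * (wignerPoly j (k + 1) a b).coeff (i + 1) ∧
      (j + k + 1 : ℂ) * (conj a * (wignerPoly j k a b).coeff i) =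
        k * (wignerPoly j (k - 1) a b).coeff i +
          (i + 1) * (wignerPoly (j + 1) k a b).coeff (i + 1) ∧
      (j + k + 1 : ℂ) * (conj b * (wignerPoly j k a b).coeff (i + 1)) =
        (j + k - i) * (wignerPoly (j + 1) k a b).coeff (i + 1) -
          k * (wignerPoly j (k - 1) a b).coeff i := by
  have h1 := congrArg (fun p => coeff p i) (wignerPoly_lowering_left hab j k)
  have h2 := congrArg (fun p => coeff p i) (wignerPoly_lowering_right hab j k)
  have h3 := congrArg (fun p => coeff p (i + 1)) (wignerPoly_mul_left j k a b)
  have h4 := congrArg (fun p => coeff p (i + 1)) (wignerPoly_mul_right j k a b)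
  simp only [coeff_add, coeff_sub, coeff_C_mul, coeff_natCast_mul, coeff_X_mul_derivative,
    coeff_X_mul, coeff_derivative] at h1 h2 h3 h4
  push_cast at h1 h2
  -- The lowering relations produce degree `j + k - 1` and multiplication by a linear factor
  -- produces `j + k + 1`; eliminating one of the two products leaves each formula.
  refine ⟨?_, ?_, ?_, ?_⟩
  · linear_combination h1 - (j + k - i : ℂ) * h4
  · linear_combination h1 + (i + 1 : ℂ) * h4
  · linear_combination h2 - (i + 1 : ℂ) * h3
  · linear_combination -h2 - (j + k - i : ℂ) * h3

theorem mul_wignerPoly_coeff_zero (a b : ℂ) (j k : ℕ) :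
    a * (wignerPoly j k a b).coeff 0 = (wignerPoly j (k + 1) a b).coeff 0 ∧
      conj b * (wignerPoly j k a b).coeff 0 = (wignerPoly (j + 1) k a b).coeff 0 := by
  rw [wignerPoly_mul_left, wignerPoly_mul_right]
  simp

end WignerPolyRelations

/-- The hyperspherical harmonics as continuous maps. -/
noncomputable def harmonicMap (p : Σ n : ℕ, Fin (n + 1) × Fin (n + 1)) : C(SU2, ℂ) :=
  ⟨hypersphericalHarmonic p.1 p.2.1 p.2.2, continuous_hypersphericalHarmonic _ _ _⟩

/-- The coefficients of the Wigner polynomials as continuous maps. -/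
noncomputable def wignerCoeffMap (j k i : ℕ) : C(SU2, ℂ) :=
  ⟨fun g => (wignerPoly j k (g.1 0 0) (g.1 1 0)).coeff i, continuous_wignerPoly_coeff j k i⟩

/-- The entries of the first column as continuous maps. -/
noncomputable def columnMap (k : Fin 2) : C(SU2, ℂ) :=
  ⟨fun g => g.1 k 0, continuous_subtype_val.matrix_elem k 0⟩

theorem columnMap_apply (k : Fin 2) (g : SU2) : columnMap k g = g.1 k 0 := rfl

theorem wignerCoeffMap_apply (j k i : ℕ) (g : SU2) :
    wignerCoeffMap j k i g = (wignerPoly j k (g.1 0 0) (g.1 1 0)).coeff i := rfl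

theorem wignerCoeffMap_mem_span (j k i : ℕ) :
    wignerCoeffMap j k i ∈ Submodule.span ℂ (Set.range harmonicMap) := by
  rcases Nat.lt_or_ge (j + k) i with h | h
  · have : wignerCoeffMap j k i = 0 := by
      ext g
      exact wignerPoly_coeff_eq_zero h _ _
    rw [this]
    exact Submodule.zero_mem _
  · set i' : Fin (j + k + 1) := ⟨i, Nat.lt_succ_of_le h⟩ with hi'
    set j' : Fin (j + k + 1) := ⟨j, by omega⟩ with hj'
    set c : ℂ := ((√((j + k : ℕ) + 1 : ℝ) / (4 * Real.pi) : ℝ) : ℂ) *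
      ((√((j + k).choose j' : ℝ) / √((j + k).choose i' : ℝ) : ℝ) : ℂ) with hc
    have hs : ∀ l : Fin (j + k + 1), √((j + k).choose l : ℝ) ≠ 0 := by
      intro l
      have := Nat.choose_pos (Nat.lt_succ_iff.1 l.2)
      exact (Real.sqrt_pos.2 (by exact_mod_cast this)).ne'
    have hc0 : c ≠ 0 := by
      refine mul_ne_zero (Complex.ofReal_ne_zero.2 ?_) (Complex.ofReal_ne_zero.2 ?_)
      · exact div_ne_zero (Real.sqrt_pos.2 (by positivity)).ne' (by positivity)
      · exact div_ne_zero (hs _) (hs _)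
    have : wignerCoeffMap j k i = c⁻¹ • harmonicMap ⟨j + k, i', j'⟩ := by
      ext g
      have h1 : harmonicMap ⟨j + k, i', j'⟩ g = c * wignerCoeffMap j k i g := by
        change hypersphericalHarmonic (j + k) i' j' g =
          c * (wignerPoly j k (g.1 0 0) (g.1 1 0)).coeff i
        rw [hypersphericalHarmonic, wignerD_eq, hc, mul_assoc]
        simp [hi', hj']
      rw [ContinuousMap.smul_apply, h1, smul_eq_mul, inv_mul_cancel_left₀ hc0]
    rw [this]
    exact Submodule.smul_mem _ _ (Submodule.subset_span ⟨_, rfl⟩)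

/-- This is the Clebsch–Gordan rule for spin `1/2`: multiplying by an entry moves degree `n` into
degrees `n - 1` and `n + 1`. -/
theorem columnMap_mul_wignerCoeffMap_mem (j k i : ℕ) (l : Fin 2) :
    columnMap l * wignerCoeffMap j k i ∈ Submodule.span ℂ (Set.range harmonicMap) ∧
      star (columnMap l) * wignerCoeffMap j k i ∈
        Submodule.span ℂ (Set.range harmonicMap) := by
  have hn : (j + k + 1 : ℂ) ≠ 0 := by
    exact_mod_cast (j + k).succ_ne_zero
  have hmem := wignerCoeffMap_mem_span
  have key : ∀ {f u v : C(SU2, ℂ)} {c d : ℂ}, u ∈ Submodule.span ℂ (Set.range harmonicMap) →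
      v ∈ Submodule.span ℂ (Set.range harmonicMap) →
      (∀ g, (j + k + 1 : ℂ) * f g = c * u g + d * v g) →
      f ∈ Submodule.span ℂ (Set.range harmonicMap) := by
    intro f u v c d hu hv h
    have : f = (j + k + 1 : ℂ)⁻¹ • (c • u + d • v) := by
      ext g
      simp only [ContinuousMap.smul_apply, ContinuousMap.add_apply, smul_eq_mul]
      rw [← h, inv_mul_cancel_left₀ hn]
    rw [this]
    exact Submodule.smul_mem _ _ (Submodule.add_mem _ (Submodule.smul_mem _ _ hu)
      (Submodule.smul_mem _ _ hv))
  have hrel := fun (g : SU2) i => mul_wignerPoly_coeff (SU2.mul_conj_add_mul_conj g) j k i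
  have hrel0 := fun (g : SU2) => mul_wignerPoly_coeff_zero (g.1 0 0) (g.1 1 0) j k
  have hl : l = 0 ∨ l = 1 := by fin_cases l <;> simp
  rcases hl with rfl | rfl
  · constructor
    · cases i with
      | zero =>
        have : columnMap 0 * wignerCoeffMap j k 0 = wignerCoeffMap j (k + 1) 0 := by
          ext g
          rw [ContinuousMap.mul_apply, columnMap_apply, wignerCoeffMap_apply,
            wignerCoeffMap_apply, (hrel0 g).1]
        rw [this]
        exact hmem _ _ _
      | succ i =>
        refine key (hmem (j - 1) k i) (hmem j (k + 1) (i + 1)) (c := j) (d := j + k - i)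
          fun g => ?_
        rw [ContinuousMap.mul_apply, columnMap_apply]
        simp only [wignerCoeffMap_apply]
        exact (hrel g i).1
    · refine key (hmem j (k - 1) i) (hmem (j + 1) k (i + 1)) (c := k) (d := i + 1) fun g => ?_
      rw [ContinuousMap.mul_apply, ContinuousMap.star_apply, columnMap_apply]
      simp only [wignerCoeffMap_apply]
      exact (hrel g i).2.2.1
  · constructor
    · refine key (c := j) (d := -(i + 1)) (hmem (j - 1) k i) (hmem j (k + 1) (i + 1)) fun g => ?_
      rw [ContinuousMap.mul_apply, columnMap_apply, neg_mul, ← sub_eq_add_neg]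
      simp only [wignerCoeffMap_apply]
      exact (hrel g i).2.1
    · cases i with
      | zero =>
        have : star (columnMap 1) * wignerCoeffMap j k 0 = wignerCoeffMap (j + 1) k 0 := by
          ext g
          rw [ContinuousMap.mul_apply, ContinuousMap.star_apply, columnMap_apply,
            wignerCoeffMap_apply, wignerCoeffMap_apply, ← (hrel0 g).2]
          rfl
        rw [this]
        exact hmem _ _ _
      | succ i =>
        refine key (c := j + k - i) (d := -k) (hmem (j + 1) k (i + 1)) (hmem j (k - 1) i)
          fun g => ?_
        rw [ContinuousMap.mul_apply, ContinuousMap.star_apply, columnMap_apply, neg_mul,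
          ← sub_eq_add_neg]
        simp only [wignerCoeffMap_apply]
        exact (hrel g i).2.2.2

theorem harmonicMap_eq_smul (p : Σ n : ℕ, Fin (n + 1) × Fin (n + 1)) :
    ∃ c : ℂ, harmonicMap p = c • wignerCoeffMap p.2.2 (p.1 - p.2.2) p.2.1 := by
  refine ⟨((√(p.1 + 1 : ℝ) / (4 * Real.pi) : ℝ) : ℂ) *
    ((√(p.1.choose p.2.2 : ℝ) / √(p.1.choose p.2.1 : ℝ) : ℝ) : ℂ), ?_⟩
  ext g
  exact (mul_assoc _ _ _).symm

/-- Stability under the generators extends to the star algebra they generate. Applied to `w = 1`, it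
places that algebra inside the span, without a product formula for two general harmonics. -/
theorem mul_mem_span_harmonicMap {f : C(SU2, ℂ)}
    (hf : f ∈ StarAlgebra.adjoin ℂ (Set.range columnMap)) {w : C(SU2, ℂ)}
    (hw : w ∈ Submodule.span ℂ (Set.range harmonicMap)) :
    f * w ∈ Submodule.span ℂ (Set.range harmonicMap) := by
  rw [← StarSubalgebra.mem_toSubalgebra, StarAlgebra.adjoin_toSubalgebra] at hf
  induction hf using Algebra.adjoin_induction generalizing w with
  | mem f hf =>
    have hgen : ∀ j k i, f * wignerCoeffMap j k i ∈ Submodule.span ℂ (Set.range harmonicMap) := by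
      intro j k i
      rcases hf with ⟨l, rfl⟩ | hf
      · exact (columnMap_mul_wignerCoeffMap_mem j k i l).1
      · obtain ⟨l, hl⟩ := Set.mem_star.1 hf
        rw [← star_star f, ← hl]
        exact (columnMap_mul_wignerCoeffMap_mem j k i l).2
    induction hw using Submodule.span_induction with
    | mem w hw =>
      obtain ⟨p, rfl⟩ := hw
      obtain ⟨c, hc⟩ := harmonicMap_eq_smul p
      rw [hc, mul_smul_comm]
      exact Submodule.smul_mem _ _ (hgen _ _ _)
    | zero => simp
    | add x y _ _ hx hy =>
      rw [mul_add]
      exact Submodule.add_mem _ hx hy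
    | smul c x _ hx =>
      rw [mul_smul_comm]
      exact Submodule.smul_mem _ _ hx
  | algebraMap c =>
    rw [← Algebra.smul_def]
    exact Submodule.smul_mem _ _ hw
  | add x y _ _ hx hy =>
    rw [add_mul]
    exact Submodule.add_mem _ (hx hw) (hy hw)
  | mul x y _ _ hx hy =>
    rw [mul_assoc]
    exact hx (hy hw)

theorem span_harmonicMap_dense :
    (Submodule.span ℂ (Set.range harmonicMap)).topologicalClosure = ⊤ := by
  have hsep : (StarAlgebra.adjoin ℂ (Set.range columnMap)).SeparatesPoints := by
    intro x y hxy
    by_contra hne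
    push Not at hne
    have h : ∀ l, x.1 l 0 = y.1 l 0 := fun l =>
      hne (columnMap l) ⟨columnMap l, StarAlgebra.subset_adjoin ℂ _ ⟨l, rfl⟩, rfl⟩
    refine hxy (Subtype.ext (Matrix.ext fun i j => ?_))
    fin_cases j
    · exact h i
    · fin_cases i
      · exact (SU2.apply_zero_one x).trans ((congrArg (fun z => -conj z) (h 1)).trans
          (SU2.apply_zero_one y).symm)
      · exact (SU2.apply_one_one x).trans ((congrArg (fun z => conj z) (h 0)).trans
          (SU2.apply_one_one y).symm)
  have hd := ContinuousMap.starSubalgebra_topologicalClosure_eq_top_of_separatesPoints _ hsep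
  have hone : (1 : C(SU2, ℂ)) ∈ Submodule.span ℂ (Set.range harmonicMap) := by
    have : (1 : C(SU2, ℂ)) = wignerCoeffMap 0 0 0 := by
      ext g
      simp [wignerCoeffMap, wignerPoly]
    rw [this]
    exact wignerCoeffMap_mem_span 0 0 0
  rw [eq_top_iff]
  intro f _
  have hf : f ∈ (StarAlgebra.adjoin ℂ (Set.range columnMap)).topologicalClosure := by
    rw [hd]
    trivial
  refine closure_mono ?_ hf
  intro w hw
  simpa using mul_mem_span_harmonicMap hw hone

/-- The hyperspherical harmonics as elements of `L²`. -/
noncomputable def harmonicLp (p : Σ n : ℕ, Fin (n + 1) × Fin (n + 1)) : Lp ℂ 2 volSU2 :=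
  ContinuousMap.toLp (E := ℂ) 2 volSU2 ℂ (harmonicMap p)

theorem orthonormal_harmonicLp : Orthonormal ℂ harmonicLp := by
  classical
  rw [orthonormal_iff_ite]
  rintro ⟨n, i, k⟩ ⟨n', j, l⟩
  rw [harmonicLp, harmonicLp, ContinuousMap.inner_toLp]
  change ∫ g, hypersphericalHarmonic n' j l g * conj (hypersphericalHarmonic n i k g) ∂volSU2 = _
  by_cases hn : n' = n
  · subst hn
    rw [integral_harmonic_mul_conj]
    congr 1
    simp [eq_comm]
  · rw [integral_harmonic_mul_conj_of_ne hn, if_neg]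
    intro h
    exact hn (congrArg Sigma.fst h).symm

theorem span_harmonicLp_dense :
    (Submodule.span ℂ (Set.range harmonicLp)).topologicalClosure = ⊤ := by
  have h := (ContinuousMap.toLp_denseRange ℂ volSU2 ℂ
    (by simp : (2 : ENNReal) ≠ ⊤)).topologicalClosure_map_submodule span_harmonicMap_dense
  rw [Submodule.map_span, ← Set.range_comp] at h
  exact h

/-- Parseval's identity for the hyperspherical harmonics. -/
theorem hasSum_norm_sq_fourierCoeff {f : SU2 → ℂ} (hf : MemLp f 2 volSU2) :
    HasSum (fun p : Σ n : ℕ, Fin (n + 1) × Fin (n + 1) =>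
      ‖∫ g, f g * conj (hypersphericalHarmonic p.1 p.2.1 p.2.2 g) ∂volSU2‖ ^ 2)
      (∫ g, ‖f g‖ ^ 2 ∂volSU2) := by
  set B := HilbertBasis.mk orthonormal_harmonicLp span_harmonicLp_dense.ge with hB
  have hBp : ∀ p, B p = harmonicLp p := fun p => by rw [hB, HilbertBasis.coe_mk]
  have h := B.hasSum_inner_mul_inner (hf.toLp f) (hf.toLp f)
  have hin : ∀ p, inner ℂ (B p) (hf.toLp f) =
      ∫ g, f g * conj (hypersphericalHarmonic p.1 p.2.1 p.2.2 g) ∂volSU2 := by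
    intro p
    rw [hBp, harmonicLp, inner_eq_integral_mul_conj (MemLp.coeFn_toLp hf)
      (ContinuousMap.coeFn_toLp (𝕜 := ℂ) volSU2 (harmonicMap p))]
    rfl
  have hs : ∀ p, inner ℂ (hf.toLp f) (B p) * inner ℂ (B p) (hf.toLp f) =
      ((‖∫ g, f g * conj (hypersphericalHarmonic p.1 p.2.1 p.2.2 g) ∂volSU2‖ ^ 2 : ℝ) : ℂ) := by
    intro p
    rw [← inner_conj_symm, hin, mul_comm, Complex.mul_conj, Complex.normSq_eq_norm_sq]
  simp_rw [hs] at h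
  have ht : inner ℂ (hf.toLp f) (hf.toLp f) = ((∫ g, ‖f g‖ ^ 2 ∂volSU2 : ℝ) : ℂ) := by
    rw [inner_eq_integral_mul_conj (MemLp.coeFn_toLp hf) (MemLp.coeFn_toLp hf),
      ← integral_complex_ofReal]
    congr 1
    ext g
    rw [Complex.mul_conj, Complex.normSq_eq_norm_sq]
  rw [ht] at h
  exact_mod_cast h

/-! ### Integrals of a Gaussian field -/

/-- Expand the nonnegative integral of `(V ‖f‖ - m)²`, with `V` the total mass and `m` the integral
of `‖f‖`. -/
theorem norm_integral_sq_le {α : Type*} [MeasurableSpace α] {μ : Measure α} [IsFiniteMeasure μ]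
    {f : α → ℂ} (hf : MemLp f 2 μ) :
    ‖∫ x, f x ∂μ‖ ^ 2 ≤ μ.real Set.univ * ∫ x, ‖f x‖ ^ 2 ∂μ := by
  have hi : Integrable f μ := hf.integrable (by norm_num)
  have hsq : Integrable (fun x => ‖f x‖ ^ 2) μ := hf.integrable_norm_pow (by norm_num)
  set V := μ.real Set.univ with hV
  set m := ∫ x, ‖f x‖ ∂μ with hm
  have hle : ‖∫ x, f x ∂μ‖ ≤ m := norm_integral_le_integral_norm f
  have h0 : 0 ≤ ∫ x, (V * ‖f x‖ - m) ^ 2 ∂μ := integral_nonneg fun _ => sq_nonneg _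
  have hexp : ∫ x, (V * ‖f x‖ - m) ^ 2 ∂μ = V * (V * ∫ x, ‖f x‖ ^ 2 ∂μ - m ^ 2) := by
    have h1 : ∀ x, (V * ‖f x‖ - m) ^ 2 = V ^ 2 * ‖f x‖ ^ 2 - (2 * V * m * ‖f x‖ - m ^ 2) :=
      fun x => by ring
    simp_rw [h1]
    have h2 : Integrable (fun x => 2 * V * m * ‖f x‖ - m ^ 2) μ :=
      (hi.norm.const_mul _).sub (integrable_const _)
    rw [integral_sub (hsq.const_mul _) h2, integral_sub (hi.norm.const_mul _) (integrable_const _), integral_const_mul,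
      integral_const_mul, integral_const, smul_eq_mul, ← hV, ← hm]
    ring
  rw [hexp] at h0
  have hmV : m ^ 2 ≤ V * ∫ x, ‖f x‖ ^ 2 ∂μ := by
    rcases (measureReal_nonneg : 0 ≤ V).eq_or_lt with h | h
    · have : μ = 0 := by
        rw [← Measure.measure_univ_eq_zero]
        exact ((measureReal_eq_zero_iff (measure_ne_top _ _)).1 (hV ▸ h.symm))
      simp [hm, this]
    · linarith [nonneg_of_mul_nonneg_right h0 h]
  exact (pow_le_pow_left₀ (norm_nonneg _) hle 2).trans hmV

section Field

variable {Ω : Type*} [MeasurableSpace Ω] {X : Ω → SU2 → ℂ} {P : Measure Ω}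

theorem InGaussianSpace.integrable_mul_conj {Y Y' : Ω → ℂ} (h : InGaussianSpace X P Y)
    (h' : InGaussianSpace X P Y') : Integrable (fun ω => Y ω * conj (Y' ω)) P :=
  h.memLp.integrable_mul h'.memLp.star

variable [IsProbabilityMeasure P]

theorem measurable_integral_norm_sq (hX : Measurable (Function.uncurry X)) :
    Measurable fun g => ∫ ω, ‖X ω g‖ ^ 2 ∂P := by
  have h : StronglyMeasurable (Function.uncurry fun (g : SU2) (ω : Ω) => ‖X ω g‖ ^ 2) :=
    ((hX.comp measurable_swap).norm.pow_const 2).stronglyMeasurable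
  exact h.integral_prod_right.measurable

theorem memLp_two_prod_of_bounded (hX : Measurable (Function.uncurry X))
    (hG : IsComplexGaussianField P X) {ψ : SU2 → ℂ} (hψ : Measurable ψ) {C : ℝ}
    (hC : ∀ g, (∫ ω, ‖X ω g‖ ^ 2 ∂P) * ‖ψ g‖ ^ 2 ≤ C) :
    MemLp (fun p : Ω × SU2 => X p.1 p.2 * ψ p.2) 2 (P.prod volSU2) := by
  have hm : Measurable fun p : Ω × SU2 => X p.1 p.2 * ψ p.2 :=
    hX.mul (hψ.comp measurable_snd)
  rw [memLp_two_iff_integrable_sq_norm hm.aestronglyMeasurable,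
    integrable_prod_iff' (hm.norm.pow_const 2).aestronglyMeasurable]
  have hint : ∀ g, Integrable (fun ω => ‖X ω g‖ ^ 2) P := fun g =>
    (isComplexGaussianField_memLp hG g).integrable_norm_pow (by norm_num)
  constructor
  · refine .of_forall fun g => ?_
    simp_rw [norm_mul, mul_pow]
    exact (hint g).mul_const _
  · simp_rw [norm_pow, norm_norm, norm_mul, mul_pow, integral_mul_const]
    refine Integrable.of_bound (C := C)
      ((measurable_integral_norm_sq hX).mul (hψ.norm.pow_const 2)).aestronglyMeasurable
      (.of_forall fun g => ?_)
    rw [Real.norm_of_nonneg (mul_nonneg (integral_nonneg fun _ => by positivity) (by positivity))]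
    exact hC g

theorem measurable_integral_field_mul (hX : Measurable (Function.uncurry X)) {ψ : SU2 → ℂ}
    (hψ : Measurable ψ) : Measurable fun ω => ∫ g, X ω g * ψ g ∂volSU2 := by
  have h : StronglyMeasurable (Function.uncurry fun (ω : Ω) (g : SU2) => X ω g * ψ g) :=
    (hX.mul (hψ.comp measurable_snd)).stronglyMeasurable
  exact h.integral_prod_right.measurable

theorem memLp_integral_of_bounded (hX : Measurable (Function.uncurry X))
    (hG : IsComplexGaussianField P X) {ψ : SU2 → ℂ} (hψ : Measurable ψ) {C : ℝ}
    (hC : ∀ g, (∫ ω, ‖X ω g‖ ^ 2 ∂P) * ‖ψ g‖ ^ 2 ≤ C) :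
    MemLp (fun ω => ∫ g, X ω g * ψ g ∂volSU2) 2 P := by
  have hL := memLp_two_prod_of_bounded hX hG hψ hC
  have hm := measurable_integral_field_mul hX hψ
  rw [memLp_two_iff_integrable_sq_norm hm.aestronglyMeasurable]
  have hsq : Integrable (fun p : Ω × SU2 => ‖X p.1 p.2 * ψ p.2‖ ^ 2) (P.prod volSU2) :=
    hL.integrable_norm_pow (by norm_num)
  refine (hsq.integral_prod_left.const_mul (volSU2.real Set.univ)).mono'
    (hm.norm.pow_const 2).aestronglyMeasurable ?_
  filter_upwards [hsq.prod_right_ae] with ω hω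
  rw [norm_pow, norm_norm]
  refine norm_integral_sq_le ?_
  rwa [memLp_two_iff_integrable_sq_norm]
  exact ((hX.comp measurable_prodMk_left).mul hψ).aestronglyMeasurable

/-- Exchange of the expectation and the integral over `SU(2)`. -/
theorem integral_integral_field_mul_conj (hX : Measurable (Function.uncurry X))
    (hG : IsComplexGaussianField P X) {ψ : SU2 → ℂ} (hψ : Measurable ψ) {C : ℝ}
    (hC : ∀ g, (∫ ω, ‖X ω g‖ ^ 2 ∂P) * ‖ψ g‖ ^ 2 ≤ C) {Z : Ω → ℂ} (hZ : MemLp Z 2 P) :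
    ∫ ω, (∫ g, X ω g * ψ g ∂volSU2) * conj (Z ω) ∂P =
      ∫ g, (∫ ω, X ω g * conj (Z ω) ∂P) * ψ g ∂volSU2 := by
  have hL := memLp_two_prod_of_bounded hX hG hψ hC
  have hZ' : MemLp (fun p : Ω × SU2 => conj (Z p.1)) 2 (P.prod volSU2) :=
    hZ.star.comp_fst volSU2
  have hint : Integrable (Function.uncurry fun (ω : Ω) (g : SU2) =>
      X ω g * ψ g * conj (Z ω)) (P.prod volSU2) := hL.integrable_mul hZ'
  simp_rw [← integral_mul_const]
  rw [integral_integral_swap hint]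
  simp_rw [mul_right_comm]

/-- Double orthogonal complement: by Fubini, anything orthogonal to all `X(g)` is orthogonal to the
integral. No Riemann sums, hence no continuity of the field, are needed. -/
theorem inGaussianSpace_integral_of_bounded (hX : Measurable (Function.uncurry X))
    (hG : IsComplexGaussianField P X) {ψ : SU2 → ℂ} (hψ : Measurable ψ) {C : ℝ}
    (hC : ∀ g, (∫ ω, ‖X ω g‖ ^ 2 ∂P) * ‖ψ g‖ ^ 2 ≤ C) :
    InGaussianSpace X P fun ω => ∫ g, X ω g * ψ g ∂volSU2 := by
  have hY := memLp_integral_of_bounded hX hG hψ hC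
  refine ⟨hY.toLp _, ?_, MemLp.coeFn_toLp hY⟩
  rw [gaussianSpace, ← Submodule.orthogonal_orthogonal_eq_closure, Submodule.mem_orthogonal]
  intro u hu
  rw [inner_eq_integral_mul_conj (MemLp.coeFn_toLp hY) (EventuallyEq.refl _ _),
    integral_integral_field_mul_conj hX hG hψ hC (Lp.memLp u)]
  refine integral_eq_zero_of_ae (.of_forall fun g => ?_)
  have hg := isComplexGaussianField_memLp hG g
  have h := (Submodule.mem_orthogonal' _ _).1 hu (hg.toLp _)
    (Submodule.subset_span ⟨g, MemLp.coeFn_toLp hg⟩)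
  rw [inner_eq_integral_mul_conj (MemLp.coeFn_toLp hg) (EventuallyEq.refl _ _)] at h
  simp [h]

/-- Almost sure square integrability does not bound the variance `v g` over the group. The integrand
is cut off to `v g ≤ k`, and the Gaussian space is stable under the almost sure limit `k → ∞`. -/
theorem inGaussianSpace_integral (hX : Measurable (Function.uncurry X))
    (hG : IsComplexGaussianField P X) (hL : ∀ᵐ ω ∂P, MemLp (X ω) 2 volSU2) {φ : SU2 → ℂ}
    (hφ : Continuous φ) : InGaussianSpace X P fun ω => ∫ g, X ω g * φ g ∂volSU2 := by
  have hv := measurable_integral_norm_sq (P := P) hX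
  set v : SU2 → ℝ := fun g => ∫ ω, ‖X ω g‖ ^ 2 ∂P with hvdef
  obtain ⟨M, hM⟩ : ∃ M, ∀ g, ‖φ g‖ ≤ M := by
    obtain ⟨M, hM⟩ := isCompact_univ.exists_bound_of_continuousOn hφ.continuousOn
    exact ⟨M, fun g => hM g trivial⟩
  have hs : ∀ k : ℕ, MeasurableSet {g | v g ≤ k} := fun k => hv measurableSet_Iic
  refine InGaussianSpace.of_tendsto_ae hG
    (Y := fun k ω => ∫ g, X ω g * {g | v g ≤ k}.indicator φ g ∂volSU2) (fun k => ?_) ?_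
  · refine inGaussianSpace_integral_of_bounded hX hG (hφ.measurable.indicator (hs k))
      (C := k * M ^ 2) fun g => ?_
    have hv0 : 0 ≤ v g := integral_nonneg fun _ => by positivity
    by_cases hg : v g ≤ k
    · rw [Set.indicator_of_mem (by exact hg)]
      exact mul_le_mul hg (pow_le_pow_left₀ (norm_nonneg _) (hM g) 2) (by positivity)
        (by positivity)
    · rw [Set.indicator_of_notMem (by exact hg)]
      simp only [norm_zero, ne_eq, OfNat.ofNat_ne_zero, not_false_eq_true, zero_pow, mul_zero]
      positivity
  · filter_upwards [hL] with ω hω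
    have hXi : Integrable (X ω) volSU2 := hω.integrable (by norm_num)
    refine tendsto_integral_of_dominated_convergence (fun g => ‖X ω g‖ * M) (fun k => ?_)
      (hXi.norm.mul_const _) (fun k => .of_forall fun g => ?_) (.of_forall fun g => ?_)
    · exact ((hX.comp measurable_prodMk_left).mul
        (hφ.measurable.indicator (hs k))).aestronglyMeasurable
    · rw [norm_mul]
      exact mul_le_mul_of_nonneg_left ((norm_indicator_le_norm_self _ _).trans (hM g))
        (norm_nonneg _)
    · refine tendsto_const_nhds.congr' ?_
      filter_upwards [eventually_ge_atTop ⌈v g⌉₊] with k hk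
      rw [Set.indicator_of_mem]
      exact Nat.ceil_le.1 hk

theorem measurable_fourierCoeffSU2 (hX : Measurable (Function.uncurry X)) (n : ℕ)
    (i j : Fin (n + 1)) : Measurable (fourierCoeffSU2 X n i j) :=
  measurable_integral_field_mul hX
    (Complex.continuous_conj.comp (continuous_hypersphericalHarmonic n i j)).measurable

theorem inGaussianSpace_fourierCoeffSU2 (hX : Measurable (Function.uncurry X))
    (hG : IsComplexGaussianField P X) (hL : ∀ᵐ ω ∂P, MemLp (X ω) 2 volSU2) (n : ℕ)
    (i j : Fin (n + 1)) : InGaussianSpace X P (fourierCoeffSU2 X n i j) :=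
  inGaussianSpace_integral hX hG hL
    (Complex.continuous_conj.comp (continuous_hypersphericalHarmonic n i j))

theorem measurable_degreeComponent (hX : Measurable (Function.uncurry X)) (n : ℕ) (g : SU2) :
    Measurable fun ω => degreeComponent X n ω g :=
  Finset.measurable_sum _ fun i _ => Finset.measurable_sum _ fun j _ =>
    (measurable_fourierCoeffSU2 hX n i j).mul_const _

theorem inGaussianSpace_degreeComponent (hX : Measurable (Function.uncurry X))
    (hG : IsComplexGaussianField P X) (hL : ∀ᵐ ω ∂P, MemLp (X ω) 2 volSU2) (n : ℕ) (g : SU2) :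
    InGaussianSpace X P fun ω => degreeComponent X n ω g :=
  InGaussianSpace.sum _ fun i _ => InGaussianSpace.sum _ fun j _ =>
    (inGaussianSpace_fourierCoeffSU2 hX hG hL n i j).mul_const _

theorem harmonic_mul_conj_sum {n : ℕ} (j k : Fin (n + 1)) (g h : SU2) :
    ∑ i, hypersphericalHarmonic n i j g * conj (hypersphericalHarmonic n i k h) =
      (((n + 1) / (16 * Real.pi ^ 2) : ℝ) : ℂ) * wignerD n k j (h⁻¹ * g) := by
  simp_rw [hypersphericalHarmonic, map_mul, Complex.conj_ofReal]
  rw [← sum_wignerD_mul_conj, Finset.mul_sum]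
  refine Finset.sum_congr rfl fun i _ => ?_
  have h1 : √(n + 1 : ℝ) * √(n + 1 : ℝ) = n + 1 := Real.mul_self_sqrt (by positivity)
  have h2 : ((n + 1) / (16 * Real.pi ^ 2) : ℝ) =
      √(n + 1 : ℝ) / (4 * Real.pi) * (√(n + 1 : ℝ) / (4 * Real.pi)) := by
    rw [div_mul_div_comm, h1]
    congr 1
    ring
  rw [h2, Complex.ofReal_mul]
  ring

theorem integral_degreeComponent_mul_conj_eq_sum (hX : Measurable (Function.uncurry X))
    (hG : IsComplexGaussianField P X) (hL : ∀ᵐ ω ∂P, MemLp (X ω) 2 volSU2) (n n' : ℕ)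
    (g h : SU2) :
    ∫ ω, degreeComponent X n ω g * conj (degreeComponent X n' ω h) ∂P =
      ∑ i, ∑ j, ∑ i', ∑ j', hypersphericalHarmonic n i j g *
        conj (hypersphericalHarmonic n' i' j' h) *
        ∫ ω, fourierCoeffSU2 X n i j ω * conj (fourierCoeffSU2 X n' i' j' ω) ∂P := by
  have hi : ∀ i j i' j', Integrable (fun ω => hypersphericalHarmonic n i j g *
      conj (hypersphericalHarmonic n' i' j' h) *
      (fourierCoeffSU2 X n i j ω * conj (fourierCoeffSU2 X n' i' j' ω))) P := fun i j i' j' =>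
    ((inGaussianSpace_fourierCoeffSU2 hX hG hL n i j).integrable_mul_conj
      (inGaussianSpace_fourierCoeffSU2 hX hG hL n' i' j')).const_mul _
  have he : ∀ ω, degreeComponent X n ω g * conj (degreeComponent X n' ω h) =
      ∑ i, ∑ j, ∑ i', ∑ j', hypersphericalHarmonic n i j g *
        conj (hypersphericalHarmonic n' i' j' h) *
        (fourierCoeffSU2 X n i j ω * conj (fourierCoeffSU2 X n' i' j' ω)) := by
    intro ω
    simp only [degreeComponent, map_sum, map_mul, Finset.sum_mul]
    refine Finset.sum_congr rfl fun i _ => Finset.sum_congr rfl fun j _ => ?_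
    simp only [Finset.mul_sum]
    refine Finset.sum_congr rfl fun i' _ => Finset.sum_congr rfl fun j' _ => ?_
    ring
  simp_rw [he]
  rw [integral_finsetSum _ fun i _ => integrable_finsetSum _ fun j _ =>
    integrable_finsetSum _ fun i' _ => integrable_finsetSum _ fun j' _ => hi i j i' j']
  refine Finset.sum_congr rfl fun i _ => ?_
  rw [integral_finsetSum _ fun j _ =>
    integrable_finsetSum _ fun i' _ => integrable_finsetSum _ fun j' _ => hi i j i' j']
  refine Finset.sum_congr rfl fun j _ => ?_
  rw [integral_finsetSum _ fun i' _ => integrable_finsetSum _ fun j' _ => hi i j i' j']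
  refine Finset.sum_congr rfl fun i' _ => ?_
  rw [integral_finsetSum _ fun j' _ => hi i j i' j']
  simp_rw [integral_const_mul]

/-- The covariance of a component whose columns of coefficients have scalar covariances. -/
theorem integral_degreeComponent_mul_conj_of_scalar (hX : Measurable (Function.uncurry X))
    (hG : IsComplexGaussianField P X) (hL : ∀ᵐ ω ∂P, MemLp (X ω) 2 volSU2) {n : ℕ}
    {K : Fin (n + 1) → Fin (n + 1) → ℂ}
    (hK : ∀ i j i' j', ∫ ω, fourierCoeffSU2 X n i j ω * conj (fourierCoeffSU2 X n i' j' ω) ∂P =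
      if i = i' then K j j' else 0) (g h : SU2) :
    ∫ ω, degreeComponent X n ω g * conj (degreeComponent X n ω h) ∂P =
      (((n + 1) / (16 * Real.pi ^ 2) : ℝ) : ℂ) *
        ∑ j, ∑ j', K j j' * wignerD n j' j (h⁻¹ * g) := by
  rw [integral_degreeComponent_mul_conj_eq_sum hX hG hL]
  simp_rw [hK]
  have h1 : ∀ i j : Fin (n + 1), ∑ i' : Fin (n + 1), ∑ j' : Fin (n + 1),
      hypersphericalHarmonic n i j g * conj (hypersphericalHarmonic n i' j' h) *
        (if i = i' then K j j' else 0) =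
      ∑ j', hypersphericalHarmonic n i j g * conj (hypersphericalHarmonic n i j' h) * K j j' := by
    intro i j
    rw [Finset.sum_eq_single i]
    · simp
    · intro b _ hb
      simp [hb.symm]
    · simp
  simp_rw [h1]
  rw [Finset.sum_comm, Finset.mul_sum]
  refine Finset.sum_congr rfl fun j _ => ?_
  rw [Finset.sum_comm, Finset.mul_sum]
  refine Finset.sum_congr rfl fun j' _ => ?_
  rw [← Finset.sum_mul, harmonic_mul_conj_sum]
  ring

end Field

/-! ### Left-invariant fields: spectral representation -/

section LeftInvariant

variable {Ω : Type*} [MeasurableSpace Ω] {X : Ω → SU2 → ℂ} {P : Measure Ω}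

/-- The covariance of the field is invariant under left translations. -/
def LeftInvariantCovariance (X : Ω → SU2 → ℂ) (P : Measure Ω) : Prop :=
  ∀ h g₁ g₂, ∫ ω, X ω (h * g₁) * conj (X ω (h * g₂)) ∂P = ∫ ω, X ω g₁ * conj (X ω g₂) ∂P

/-- The matrix coefficient of the covariance function against the Wigner functions. -/
noncomputable def covarianceCoeff (X : Ω → SU2 → ℂ) (P : Measure Ω) (n : ℕ)
    (k j : Fin (n + 1)) : ℂ :=
  ∫ u, (∫ ω, X ω 1 * conj (X ω u) ∂P) * wignerD n k j u ∂volSU2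

theorem ofReal_integral_norm_sq (Y : Ω → ℂ) :
    ((∫ ω, ‖Y ω‖ ^ 2 ∂P : ℝ) : ℂ) = ∫ ω, Y ω * conj (Y ω) ∂P := by
  rw [← integral_complex_ofReal]
  congr 1
  ext ω
  rw [Complex.mul_conj, Complex.normSq_eq_norm_sq]

theorem LeftInvariantCovariance.integral_norm_sq (h : LeftInvariantCovariance X P) (g : SU2) :
    ∫ ω, ‖X ω g‖ ^ 2 ∂P = ∫ ω, ‖X ω 1‖ ^ 2 ∂P := by
  apply Complex.ofReal_injective
  rw [ofReal_integral_norm_sq, ofReal_integral_norm_sq, ← h g 1 1, mul_one]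

theorem integral_mul_conj_swap (Y Z : Ω → ℂ) :
    ∫ ω, Y ω * conj (Z ω) ∂P = conj (∫ ω, Z ω * conj (Y ω) ∂P) := by
  rw [← integral_conj]
  congr 1
  ext ω
  rw [map_mul, Complex.conj_conj, mul_comm]

theorem LeftInvariantCovariance.bounded (h : LeftInvariantCovariance X P) {ψ : SU2 → ℂ}
    (hψ : Continuous ψ) : ∃ C, ∀ g, (∫ ω, ‖X ω g‖ ^ 2 ∂P) * ‖ψ g‖ ^ 2 ≤ C := by
  obtain ⟨M, hM⟩ := isCompact_univ.exists_bound_of_continuousOn hψ.continuousOn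
  refine ⟨(∫ ω, ‖X ω 1‖ ^ 2 ∂P) * M ^ 2, fun g => ?_⟩
  rw [h.integral_norm_sq]
  exact mul_le_mul_of_nonneg_left (pow_le_pow_left₀ (norm_nonneg _) (hM g trivial) 2)
    (integral_nonneg fun _ => by positivity)

/-- Pythagoras: `hZY` says that each `Y n` is orthogonal to `Z - Y n`. -/
theorem integral_norm_sq_sum_sub {s : Finset ℕ} {Y : ℕ → Ω → ℂ} {Z : Ω → ℂ}
    (hY : ∀ n, MemLp (Y n) 2 P) (hZ : MemLp Z 2 P)
    (hYY : ∀ m n, m ≠ n → ∫ ω, Y m ω * conj (Y n ω) ∂P = 0)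
    (hZY : ∀ n, ∫ ω, Z ω * conj (Y n ω) ∂P = ∫ ω, Y n ω * conj (Y n ω) ∂P) :
    ∫ ω, ‖(∑ n ∈ s, Y n ω) - Z ω‖ ^ 2 ∂P =
      ∫ ω, ‖Z ω‖ ^ 2 ∂P - ∑ n ∈ s, ∫ ω, ‖Y n ω‖ ^ 2 ∂P := by
  have hi : ∀ {U V : Ω → ℂ}, MemLp U 2 P → MemLp V 2 P →
      Integrable (fun ω => U ω * conj (V ω)) P := fun hU hV => hU.integrable_mul hV.star
  have hS : MemLp (fun ω => ∑ n ∈ s, Y n ω) 2 P := memLp_finsetSum _ fun n _ => hY n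
  have h1 : ∀ m ∈ s, ∫ ω, (∑ n ∈ s, Y n ω) * conj (Y m ω) ∂P =
      ∫ ω, Y m ω * conj (Y m ω) ∂P := by
    intro m hm
    simp_rw [Finset.sum_mul]
    rw [integral_finsetSum _ fun n _ => hi (hY n) (hY m), Finset.sum_eq_single m]
    · intro n _ hn
      exact hYY n m hn
    · exact fun h => absurd hm h
  have h2 : ∫ ω, (∑ n ∈ s, Y n ω) * conj (∑ n ∈ s, Y n ω) ∂P =
      ∑ n ∈ s, ∫ ω, Y n ω * conj (Y n ω) ∂P := by
    simp_rw [map_sum, Finset.mul_sum]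
    rw [integral_finsetSum _ fun n _ => hi hS (hY n)]
    exact Finset.sum_congr rfl h1
  have h3 : ∫ ω, Z ω * conj (∑ n ∈ s, Y n ω) ∂P =
      ∑ n ∈ s, ∫ ω, Y n ω * conj (Y n ω) ∂P := by
    simp_rw [map_sum, Finset.mul_sum]
    rw [integral_finsetSum _ fun n _ => hi hZ (hY n)]
    exact Finset.sum_congr rfl fun n _ => hZY n
  have h4 : ∫ ω, (∑ n ∈ s, Y n ω) * conj (Z ω) ∂P =
      ∑ n ∈ s, ∫ ω, Y n ω * conj (Y n ω) ∂P := by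
    rw [integral_mul_conj_swap, h3, map_sum]
    exact Finset.sum_congr rfl fun n _ => (integral_mul_conj_swap _ _).symm
  apply Complex.ofReal_injective
  rw [Complex.ofReal_sub, Complex.ofReal_sum]
  simp_rw [ofReal_integral_norm_sq]
  have h5 : ∀ ω, ((∑ n ∈ s, Y n ω) - Z ω) * conj ((∑ n ∈ s, Y n ω) - Z ω) =
      ((∑ n ∈ s, Y n ω) * conj (∑ n ∈ s, Y n ω) - (∑ n ∈ s, Y n ω) * conj (Z ω)) -
        (Z ω * conj (∑ n ∈ s, Y n ω) - Z ω * conj (Z ω)) := by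
    intro ω
    rw [map_sub]
    ring
  simp_rw [h5]
  have i1 : Integrable (fun ω => (∑ n ∈ s, Y n ω) * conj (∑ n ∈ s, Y n ω) -
      (∑ n ∈ s, Y n ω) * conj (Z ω)) P := (hi hS hS).sub (hi hS hZ)
  have i2 : Integrable (fun ω => Z ω * conj (∑ n ∈ s, Y n ω) - Z ω * conj (Z ω)) P :=
    (hi hZ hS).sub (hi hZ hZ)
  rw [integral_sub i1 i2, integral_sub (hi hS hS) (hi hS hZ), integral_sub (hi hZ hS) (hi hZ hZ),
    h2, h3, h4]
  ring

variable [IsProbabilityMeasure P]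

theorem LeftInvariantCovariance.integrable_prod (h : LeftInvariantCovariance X P)
    (hX : Measurable (Function.uncurry X)) (hG : IsComplexGaussianField P X) :
    Integrable (fun p : Ω × SU2 => ‖X p.1 p.2‖ ^ 2) (P.prod volSU2) := by
  obtain ⟨C, hC⟩ := h.bounded (continuous_const (y := (1 : ℂ)))
  have := (memLp_two_prod_of_bounded hX hG measurable_const hC).integrable_norm_pow (by norm_num)
  simpa using this

theorem LeftInvariantCovariance.ae_memLp (h : LeftInvariantCovariance X P)
    (hX : Measurable (Function.uncurry X)) (hG : IsComplexGaussianField P X) :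
    ∀ᵐ ω ∂P, MemLp (X ω) 2 volSU2 := by
  filter_upwards [(h.integrable_prod hX hG).prod_right_ae] with ω hω
  rwa [memLp_two_iff_integrable_sq_norm]
  exact (hX.comp measurable_prodMk_left).aestronglyMeasurable

theorem LeftInvariantCovariance.integrable_covariance_mul (h : LeftInvariantCovariance X P)
    (hX : Measurable (Function.uncurry X)) (hG : IsComplexGaussianField P X) (n : ℕ)
    (k j : Fin (n + 1)) :
    Integrable (fun u => (∫ ω, X ω 1 * conj (X ω u) ∂P) * wignerD n k j u) volSU2 := by
  obtain ⟨M, hM⟩ := isCompact_univ.exists_bound_of_continuousOn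
    (continuous_wignerD n k j).continuousOn
  have hm : Measurable fun u => ∫ ω, X ω 1 * conj (X ω u) ∂P := by
    have hs : StronglyMeasurable (Function.uncurry fun (u : SU2) (ω : Ω) =>
        X ω 1 * conj (X ω u)) :=
      (((measurable_field hX 1).comp measurable_snd).mul
        (Complex.continuous_conj.measurable.comp (hX.comp measurable_swap))).stronglyMeasurable
    exact hs.integral_prod_right.measurable
  refine Integrable.of_bound (C := (∫ ω, ‖X ω 1‖ ^ 2 ∂P) * M)
    (hm.mul (continuous_wignerD n k j).measurable).aestronglyMeasurable (.of_forall fun u => ?_)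
  rw [norm_mul]
  refine mul_le_mul ?_ (hM u trivial) (norm_nonneg _) (integral_nonneg fun _ => by positivity)
  have hi : ∀ g, Integrable (fun ω => ‖X ω g‖ ^ 2) P := fun g =>
    (isComplexGaussianField_memLp hG g).integrable_norm_pow (by norm_num)
  calc ‖∫ ω, X ω 1 * conj (X ω u) ∂P‖
      ≤ ∫ ω, (‖X ω 1‖ ^ 2 + ‖X ω u‖ ^ 2) / 2 ∂P := by
        refine norm_integral_le_of_norm_le (((hi 1).add (hi u)).div_const 2)
          (.of_forall fun ω => ?_)
        rw [norm_mul, RCLike.norm_conj]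
        nlinarith [sq_nonneg (‖X ω 1‖ - ‖X ω u‖)]
    _ = ∫ ω, ‖X ω 1‖ ^ 2 ∂P := by
        rw [integral_div, integral_add (hi 1) (hi u), h.integral_norm_sq u]
        ring

theorem harmonic_mul {n : ℕ} (i j : Fin (n + 1)) (g h : SU2) :
    hypersphericalHarmonic n i j (g * h) =
      ∑ k, hypersphericalHarmonic n i k g * wignerD n k j h := by
  simp_rw [hypersphericalHarmonic, wignerD_mul, Finset.mul_sum, mul_assoc]

theorem continuous_conj_harmonic (n : ℕ) (i j : Fin (n + 1)) :
    Continuous fun g => conj (hypersphericalHarmonic n i j g) :=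
  Complex.continuous_conj.comp (continuous_hypersphericalHarmonic n i j)

/-- After the substitution `g ↦ w g` the covariance no longer involves `w`, and the representation
property splits `φ_{ij}(w g)`. -/
theorem LeftInvariantCovariance.integral_field_mul_conj_coeff (h : LeftInvariantCovariance X P)
    (hX : Measurable (Function.uncurry X)) (hG : IsComplexGaussianField P X) (n : ℕ)
    (i j : Fin (n + 1)) (w : SU2) :
    ∫ ω, X ω w * conj (fourierCoeffSU2 X n i j ω) ∂P =
      ∑ k, hypersphericalHarmonic n i k w * covarianceCoeff X P n k j := by
  obtain ⟨C, hC⟩ := h.bounded (continuous_conj_harmonic n i j)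
  rw [integral_mul_conj_swap]
  have h1 : ∫ ω, fourierCoeffSU2 X n i j ω * conj (X ω w) ∂P =
      ∫ g, (∫ ω, X ω g * conj (X ω w) ∂P) * conj (hypersphericalHarmonic n i j g) ∂volSU2 :=
    integral_integral_field_mul_conj hX hG (continuous_conj_harmonic n i j).measurable hC
      (isComplexGaussianField_memLp hG w)
  rw [h1, ← integral_conj]
  have h2 : ∀ g, conj ((∫ ω, X ω g * conj (X ω w) ∂P) * conj (hypersphericalHarmonic n i j g)) =
      (∫ ω, X ω w * conj (X ω g) ∂P) * hypersphericalHarmonic n i j g := by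
    intro g
    rw [map_mul, Complex.conj_conj, ← integral_mul_conj_swap]
  simp_rw [h2]
  rw [← integral_mul_left_eq_self
    (fun g => (∫ ω, X ω w * conj (X ω g) ∂P) * hypersphericalHarmonic n i j g) w]
  have h3 : ∀ g, (∫ ω, X ω w * conj (X ω (w * g)) ∂P) * hypersphericalHarmonic n i j (w * g) =
      ∑ k, hypersphericalHarmonic n i k w *
        ((∫ ω, X ω 1 * conj (X ω g) ∂P) * wignerD n k j g) := by
    intro g
    have := h w 1 g
    rw [mul_one] at this
    rw [this, harmonic_mul, Finset.mul_sum]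
    exact Finset.sum_congr rfl fun k _ => by ring
  simp_rw [h3]
  rw [integral_finsetSum _ fun k _ => (h.integrable_covariance_mul hX hG n k j).const_mul _]
  simp_rw [integral_const_mul]
  rfl

theorem LeftInvariantCovariance.integral_coeff_mul_conj_eq (h : LeftInvariantCovariance X P)
    (hX : Measurable (Function.uncurry X)) (hG : IsComplexGaussianField P X) (n n' : ℕ)
    (i j : Fin (n + 1)) (i' j' : Fin (n' + 1)) :
    ∫ ω, fourierCoeffSU2 X n i j ω * conj (fourierCoeffSU2 X n' i' j' ω) ∂P =
      ∑ k, (∫ g, hypersphericalHarmonic n' i' k g * conj (hypersphericalHarmonic n i j g)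
        ∂volSU2) * covarianceCoeff X P n' k j' := by
  obtain ⟨C, hC⟩ := h.bounded (continuous_conj_harmonic n i j)
  have hmem := (inGaussianSpace_fourierCoeffSU2 hX hG (h.ae_memLp hX hG) n' i' j').memLp
  have h1 : ∫ ω, fourierCoeffSU2 X n i j ω * conj (fourierCoeffSU2 X n' i' j' ω) ∂P =
      ∫ g, (∫ ω, X ω g * conj (fourierCoeffSU2 X n' i' j' ω) ∂P) *
        conj (hypersphericalHarmonic n i j g) ∂volSU2 :=
    integral_integral_field_mul_conj hX hG (continuous_conj_harmonic n i j).measurable hC hmem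
  rw [h1]
  simp_rw [h.integral_field_mul_conj_coeff hX hG, Finset.sum_mul]
  rw [integral_finsetSum]
  · refine Finset.sum_congr rfl fun k _ => ?_
    rw [← integral_mul_const]
    congr 1
    ext g
    ring
  · intro k _
    exact integrable_of_continuous
      (((continuous_hypersphericalHarmonic n' i' k).mul continuous_const).mul
        (continuous_conj_harmonic n i j))

theorem LeftInvariantCovariance.integral_coeff_mul_conj_of_ne (h : LeftInvariantCovariance X P)
    (hX : Measurable (Function.uncurry X)) (hG : IsComplexGaussianField P X) {n n' : ℕ}
    (hn : n ≠ n') (i j : Fin (n + 1)) (i' j' : Fin (n' + 1)) :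
    ∫ ω, fourierCoeffSU2 X n i j ω * conj (fourierCoeffSU2 X n' i' j' ω) ∂P = 0 := by
  rw [h.integral_coeff_mul_conj_eq hX hG]
  refine Finset.sum_eq_zero fun k _ => ?_
  rw [integral_harmonic_mul_conj_of_ne hn.symm, zero_mul]

theorem LeftInvariantCovariance.integral_coeff_mul_conj (h : LeftInvariantCovariance X P)
    (hX : Measurable (Function.uncurry X)) (hG : IsComplexGaussianField P X) {n : ℕ}
    (i j i' j' : Fin (n + 1)) :
    ∫ ω, fourierCoeffSU2 X n i j ω * conj (fourierCoeffSU2 X n i' j' ω) ∂P =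
      if i = i' then covarianceCoeff X P n j j' else 0 := by
  rw [h.integral_coeff_mul_conj_eq hX hG]
  simp_rw [integral_harmonic_mul_conj]
  rw [Finset.sum_eq_single j]
  · simp [eq_comm]
  · intro k _ hk
    simp [hk]
  · simp

theorem LeftInvariantCovariance.integral_component_mul_conj_of_ne
    (h : LeftInvariantCovariance X P)
    (hX : Measurable (Function.uncurry X)) (hG : IsComplexGaussianField P X) {n n' : ℕ}
    (hn : n ≠ n') (g g' : SU2) :
    ∫ ω, degreeComponent X n ω g * conj (degreeComponent X n' ω g') ∂P = 0 := by
  rw [integral_degreeComponent_mul_conj_eq_sum hX hG (h.ae_memLp hX hG)]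
  simp [h.integral_coeff_mul_conj_of_ne hX hG hn]

/-- The variance of the component of degree `n`. -/
theorem LeftInvariantCovariance.integral_component_mul_conj_self
    (h : LeftInvariantCovariance X P)
    (hX : Measurable (Function.uncurry X)) (hG : IsComplexGaussianField P X) (n : ℕ) (g : SU2) :
    ∫ ω, degreeComponent X n ω g * conj (degreeComponent X n ω g) ∂P =
      (((n + 1) / (16 * Real.pi ^ 2) : ℝ) : ℂ) * ∑ j, covarianceCoeff X P n j j := by
  rw [integral_degreeComponent_mul_conj_of_scalar hX hG (h.ae_memLp hX hG)
    (h.integral_coeff_mul_conj hX hG)]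
  simp [wignerD_one]

/-- The sum over `i` of `conj φ_{ij}(g) φ_{ik}(g)` is a constant times `δ_{jk}` at every point, so
the projection property holds for each `g` and not only almost everywhere. -/
theorem LeftInvariantCovariance.integral_field_mul_conj_component
    (h : LeftInvariantCovariance X P)
    (hX : Measurable (Function.uncurry X)) (hG : IsComplexGaussianField P X) (n : ℕ) (g : SU2) :
    ∫ ω, X ω g * conj (degreeComponent X n ω g) ∂P =
      ∫ ω, degreeComponent X n ω g * conj (degreeComponent X n ω g) ∂P := by
  rw [h.integral_component_mul_conj_self hX hG]
  have hi : ∀ i j, Integrable (fun ω => conj (hypersphericalHarmonic n i j g) *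
      (X ω g * conj (fourierCoeffSU2 X n i j ω))) P := fun i j =>
    ((inGaussianSpace_apply hG g).integrable_mul_conj
      (inGaussianSpace_fourierCoeffSU2 hX hG (h.ae_memLp hX hG) n i j)).const_mul _
  have he : ∀ ω, X ω g * conj (degreeComponent X n ω g) =
      ∑ i, ∑ j, conj (hypersphericalHarmonic n i j g) *
        (X ω g * conj (fourierCoeffSU2 X n i j ω)) := by
    intro ω
    simp only [degreeComponent, map_sum, map_mul, Finset.mul_sum]
    refine Finset.sum_congr rfl fun i _ => Finset.sum_congr rfl fun j _ => ?_
    ring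
  simp_rw [he]
  rw [integral_finsetSum _ fun i _ => integrable_finsetSum _ fun j _ => hi i j]
  simp_rw [integral_finsetSum _ fun j _ => hi _ j, integral_const_mul,
    h.integral_field_mul_conj_coeff hX hG, Finset.mul_sum]
  rw [Finset.sum_comm]
  refine Finset.sum_congr rfl fun j _ => ?_
  rw [Finset.sum_comm]
  have hk : ∀ k, ∑ i, conj (hypersphericalHarmonic n i j g) *
      (hypersphericalHarmonic n i k g * covarianceCoeff X P n k j) =
      (((n + 1) / (16 * Real.pi ^ 2) : ℝ) : ℂ) * (if j = k then 1 else 0) *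
        covarianceCoeff X P n k j := by
    intro k
    rw [← wignerD_one, ← inv_mul_cancel g, ← harmonic_mul_conj_sum, Finset.sum_mul]
    exact Finset.sum_congr rfl fun i _ => by ring
  simp_rw [hk]
  simp

/-- Parseval's identity holds only after integration over the group. Here the variances on both
sides are independent of `g`, so dividing by the volume gives the statement at each point. -/
theorem LeftInvariantCovariance.tendsto_sum_integral_norm_sq (h : LeftInvariantCovariance X P)
    (hX : Measurable (Function.uncurry X)) (hG : IsComplexGaussianField P X) (g : SU2) :
    Tendsto (fun N => ∑ n ∈ Finset.range N, ∫ ω, ‖degreeComponent X n ω g‖ ^ 2 ∂P) atTop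
      (𝓝 (∫ ω, ‖X ω g‖ ^ 2 ∂P)) := by
  have hL := h.ae_memLp hX hG
  have hprod := h.integrable_prod hX hG
  have hVpos : (0 : ℝ) < 16 * Real.pi ^ 2 := by have := Real.pi_pos; positivity
  have hia : ∀ n i j, Integrable (fun ω => ‖fourierCoeffSU2 X n i j ω‖ ^ 2) P := fun n i j =>
    (inGaussianSpace_fourierCoeffSU2 hX hG hL n i j).memLp.integrable_norm_pow (by norm_num)
  have hterm : ∀ n, ∫ ω, ‖degreeComponent X n ω g‖ ^ 2 ∂P =
      (16 * Real.pi ^ 2)⁻¹ * ∫ ω, ∑ i, ∑ j, ‖fourierCoeffSU2 X n i j ω‖ ^ 2 ∂P := by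
    intro n
    apply Complex.ofReal_injective
    rw [ofReal_integral_norm_sq, h.integral_component_mul_conj_self hX hG,
      integral_finsetSum _ fun i _ => integrable_finsetSum _ fun j _ => hia n i j]
    simp_rw [integral_finsetSum _ fun j _ => hia n _ j]
    rw [Complex.ofReal_mul, Complex.ofReal_sum]
    simp_rw [Complex.ofReal_sum, ofReal_integral_norm_sq, h.integral_coeff_mul_conj hX hG]
    simp only [if_true, Finset.sum_const, Finset.card_univ, Fintype.card_fin, nsmul_eq_mul]
    push_cast
    ring
  have hdom : Tendsto (fun N => ∫ ω, ∑ n ∈ Finset.range N,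
      ∑ i, ∑ j, ‖fourierCoeffSU2 X n i j ω‖ ^ 2 ∂P) atTop
      (𝓝 (∫ ω, ∫ g, ‖X ω g‖ ^ 2 ∂volSU2 ∂P)) := by
    have hsum : ∀ ω, MemLp (X ω) 2 volSU2 →
        HasSum (fun n => ∑ i, ∑ j, ‖fourierCoeffSU2 X n i j ω‖ ^ 2)
          (∫ g, ‖X ω g‖ ^ 2 ∂volSU2) := by
      intro ω hω
      have hs := (hasSum_norm_sq_fourierCoeff hω).sigma fun n => hasSum_fintype _
      simp only [Fintype.sum_prod_type] at hs
      exact hs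
    -- The partial sums in Parseval's identity are dominated by the full sum `∫ ‖X ω g‖²`, which is
    -- integrable in `ω`.
    refine tendsto_integral_of_dominated_convergence (fun ω => ∫ g, ‖X ω g‖ ^ 2 ∂volSU2)
      (fun N => ?_) hprod.integral_prod_left (fun N => ?_) ?_
    · exact (integrable_finsetSum _ fun n _ => integrable_finsetSum _ fun i _ =>
        integrable_finsetSum _ fun j _ => hia n i j).aestronglyMeasurable
    · filter_upwards [hL] with ω hω
      rw [Real.norm_of_nonneg (by positivity)]
      exact sum_le_hasSum _ (fun n _ => by positivity) (hsum ω hω)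
    · filter_upwards [hL] with ω hω
      exact (hsum ω hω).tendsto_sum_nat
  have hlim : ∫ ω, ∫ g, ‖X ω g‖ ^ 2 ∂volSU2 ∂P =
      16 * Real.pi ^ 2 * ∫ ω, ‖X ω g‖ ^ 2 ∂P := by
    rw [integral_integral_swap hprod]
    simp_rw [h.integral_norm_sq]
    rw [integral_const, volSU2_real_univ, smul_eq_mul]
  have hfin := hdom.const_mul (16 * Real.pi ^ 2)⁻¹
  rw [hlim, inv_mul_cancel_left₀ hVpos.ne'] at hfin
  refine hfin.congr fun N => ?_
  rw [integral_finsetSum _ fun n _ => integrable_finsetSum _ fun i _ =>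
    integrable_finsetSum _ fun j _ => hia n i j, Finset.mul_sum]
  exact Finset.sum_congr rfl fun n _ => (hterm n).symm

theorem LeftInvariantCovariance.hasHarmonicExpansion (h : LeftInvariantCovariance X P)
    (hX : Measurable (Function.uncurry X)) (hG : IsComplexGaussianField P X) :
    HasHarmonicExpansion X P := by
  have hL := h.ae_memLp hX hG
  refine ⟨hL, fun g => ?_⟩
  have hY := fun n => inGaussianSpace_degreeComponent hX hG hL n g
  have hYY : ∀ m n, m ≠ n →
      ∫ ω, degreeComponent X m ω g * conj (degreeComponent X n ω g) ∂P = 0 :=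
    fun m n hmn => h.integral_component_mul_conj_of_ne hX hG hmn g g
  have hZY := fun n => h.integral_field_mul_conj_component hX hG n g
  refine ae_tendsto_sum_of_orthogonal hG hY (fun n => measurable_degreeComponent hX n g)
    (inGaussianSpace_apply hG g) (measurable_field hX g) hYY hZY ?_
  simp_rw [fun N => integral_norm_sq_sum_sub (s := Finset.range N) (fun n => (hY n).memLp)
    (isComplexGaussianField_memLp hG g) hYY hZY]
  rw [← sub_self (∫ ω, ‖X ω g‖ ^ 2 ∂P)]
  exact (h.tendsto_sum_integral_norm_sq hX hG g).const_sub _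

theorem LeftInvariantCovariance.iIndepFun_degreeComponent (h : LeftInvariantCovariance X P)
    (hX : Measurable (Function.uncurry X)) (hG : IsComplexGaussianField P X) :
    iIndepFun (fun n ω => degreeComponent X n ω) P := by
  have hL := h.ae_memLp hX hG
  have h1 := iIndepFun_of_orthogonal hG (κ := fun n : ℕ => Fin (n + 1) × Fin (n + 1))
    (V := fun n p => fourierCoeffSU2 X n p.1 p.2)
    (fun n p => inGaussianSpace_fourierCoeffSU2 hX hG hL n p.1 p.2)
    (fun n n' hn p q => h.integral_coeff_mul_conj_of_ne hX hG hn p.1 p.2 q.1 q.2)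
  exact h1.comp (fun n (x : Fin (n + 1) × Fin (n + 1) → ℂ) (g : SU2) =>
    ∑ i, ∑ j, x (i, j) * hypersphericalHarmonic n i j g) fun n => by fun_prop

theorem LeftInvariantCovariance.crossCovariance_eq (h : LeftInvariantCovariance X P)
    (hX : Measurable (Function.uncurry X)) (hG : IsComplexGaussianField P X) (n : ℕ)
    (s s' : Fin (n + 1)) :
    crossCovariance P (fun m => fourierCoeffSU2 X n m s) (fun m => fourierCoeffSU2 X n m s') =
      covarianceCoeff X P n s s' • (1 : Matrix (Fin (n + 1)) (Fin (n + 1)) ℂ) := by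
  ext i i'
  simp [crossCovariance, h.integral_coeff_mul_conj hX hG, Matrix.one_apply]

theorem LeftInvariantCovariance.hasComplexNormalLaw (h : LeftInvariantCovariance X P)
    (hX : Measurable (Function.uncurry X)) (hG : IsComplexGaussianField P X) (n : ℕ)
    (s : Fin (n + 1)) :
    HasComplexNormalLaw P (fun m => fourierCoeffSU2 X n m s)
      (((√(covarianceCoeff X P n s s).re : ℝ) : ℂ) ^ 2 •
        (1 : Matrix (Fin (n + 1)) (Fin (n + 1)) ℂ)) := by
  have hL := h.ae_memLp hX hG
  refine ⟨isComplexGaussianVector_of_inGaussianSpace hG fun m =>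
    inGaussianSpace_fourierCoeffSU2 hX hG hL n m s, ?_⟩
  rw [h.crossCovariance_eq hX hG]
  -- The diagonal coefficient is the variance of `a_{ss}`, hence real and nonnegative.
  have h1 := h.integral_coeff_mul_conj hX hG s s s s
  rw [if_pos rfl, ← ofReal_integral_norm_sq] at h1
  rw [← h1, Complex.ofReal_re, ← Complex.ofReal_pow,
    Real.sq_sqrt (integral_nonneg fun _ => by positivity)]

end LeftInvariant

/-! ### Characterization of invariant fields -/

section Invariance

variable {Ω : Type*} [MeasurableSpace Ω] {X : Ω → SU2 → ℂ} {P : Measure Ω}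

theorem StronglyInvariant.leftInvariantCovariance
    (h : StronglyInvariant X P leftTranslations) : LeftInvariantCovariance X P := by
  intro k g₁ g₂
  have := h.integral_comp₂ (φ := fun z => k⁻¹⁻¹ * z) ⟨k⁻¹, rfl⟩
    (f := fun p => p.1 * conj p.2)
    (measurable_fst.mul (Complex.continuous_conj.measurable.comp measurable_snd)) g₁ g₂
  simpa only [inv_inv] using this

theorem StronglyInvariant.left_of_bi (h : StronglyInvariant X P biTranslations) :
    StronglyInvariant X P leftTranslations := by
  rintro _ ⟨g, rfl⟩
  simpa only [mul_one] using h _ ⟨g, 1, rfl⟩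

theorem StronglyInvariant.right_of_bi (h : StronglyInvariant X P biTranslations) :
    StronglyInvariant X P rightTranslations := by
  rintro _ ⟨g, rfl⟩
  simpa only [inv_one, one_mul] using h _ ⟨1, g, rfl⟩

theorem StronglyInvariant.bi (hl : StronglyInvariant X P leftTranslations)
    (hr : StronglyInvariant X P rightTranslations) : StronglyInvariant X P biTranslations := by
  rintro _ ⟨g, g', rfl⟩
  have h1 := (hr _ ⟨g', rfl⟩).comp (u := fun (x : SU2 → ℂ) z => x (g⁻¹ * z)) (by fun_prop)
  exact h1.trans (hl _ ⟨g, rfl⟩)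

/-! #### Transposition -/

/-- The field `g ↦ X(gᵀ)`. -/
def transposeField (X : Ω → SU2 → ℂ) (ω : Ω) (g : SU2) : ℂ := X ω (SU2.transpose g)

theorem measurable_transposeField (hX : Measurable (Function.uncurry X)) :
    Measurable (Function.uncurry (transposeField X)) :=
  hX.comp (measurable_fst.prodMk (SU2.continuous_transpose.measurable.comp measurable_snd))

theorem isComplexGaussianField_transposeField (hG : IsComplexGaussianField P X) :
    IsComplexGaussianField P (transposeField X) := fun N g =>
  hG N fun k => SU2.transpose (g k)

theorem stronglyInvariant_transposeField_iff :
    StronglyInvariant (transposeField X) P leftTranslations ↔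
      StronglyInvariant X P rightTranslations := by
  have hm : Measurable fun (x : SU2 → ℂ) z => x (SU2.transpose z) := by fun_prop
  constructor
  · rintro h _ ⟨g, rfl⟩
    -- Left translations are written with `g⁻¹`, so the inverse of `gᵀ` produces the factor `gᵀ`;
    -- transposition turns it into `g` on the right.
    have h1 := (h _ ⟨(SU2.transpose g)⁻¹, rfl⟩).comp hm
    convert! h1 using 3 with ω z
    simp [transposeField, SU2.transpose_mul, SU2.transpose_transpose]
  · rintro h _ ⟨g, rfl⟩
    have h1 := (h _ ⟨SU2.transpose g⁻¹, rfl⟩).comp hm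
    convert! h1 using 3 with ω z
    simp [transposeField, SU2.transpose_mul]

theorem harmonic_transpose {n : ℕ} (i j : Fin (n + 1)) (g : SU2) :
    hypersphericalHarmonic n i j (SU2.transpose g) = hypersphericalHarmonic n j i g := by
  rw [hypersphericalHarmonic, hypersphericalHarmonic, wignerD_transpose]

theorem measurableEmbedding_transpose : MeasurableEmbedding SU2.transpose :=
  MeasurableEquiv.measurableEmbedding
    { toFun := SU2.transpose
      invFun := SU2.transpose
      left_inv := SU2.transpose_transpose
      right_inv := SU2.transpose_transpose
      measurable_toFun := SU2.continuous_transpose.measurable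
      measurable_invFun := SU2.continuous_transpose.measurable }

theorem fourierCoeffSU2_transposeField {Ω : Type*} {X : Ω → SU2 → ℂ} (n : ℕ) (i j : Fin (n + 1)) :
    fourierCoeffSU2 (transposeField X) n i j = fourierCoeffSU2 X n j i := by
  ext ω
  rw [fourierCoeffSU2, fourierCoeffSU2, ← measurePreserving_transpose.integral_comp
    measurableEmbedding_transpose]
  simp_rw [harmonic_transpose]
  rfl

theorem degreeComponent_transposeField {Ω : Type*} {X : Ω → SU2 → ℂ} (n : ℕ) (ω : Ω) (g : SU2) :
    degreeComponent (transposeField X) n ω g = degreeComponent X n ω (SU2.transpose g) := by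
  rw [degreeComponent, degreeComponent, Finset.sum_comm]
  simp_rw [fourierCoeffSU2_transposeField, harmonic_transpose]

theorem HasHarmonicExpansion.transposeField (h : HasHarmonicExpansion X P) :
    HasHarmonicExpansion (transposeField X) P := by
  refine ⟨?_, fun g => ?_⟩
  · filter_upwards [h.1] with ω hω
    exact hω.comp_measurePreserving measurePreserving_transpose
  · simp_rw [degreeComponent_transposeField]
    exact h.2 (SU2.transpose g)

theorem iIndepFun_degreeComponent_transposeField
    (h : iIndepFun (fun n ω => degreeComponent X n ω) P) :
    iIndepFun (fun n ω => degreeComponent (transposeField X) n ω) P := by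
  have h1 := h.comp (fun _ (x : SU2 → ℂ) z => x (SU2.transpose z)) fun _ => by fun_prop
  convert! h1 using 3 with n ω
  ext g
  exact degreeComponent_transposeField n ω g

/-! #### From the harmonic expansion to invariance -/

variable [IsProbabilityMeasure P]

theorem LeftInvariantCovariance.stronglyInvariant (h : LeftInvariantCovariance X P)
    (hX : Measurable (Function.uncurry X)) (hG : IsComplexGaussianField P X) :
    StronglyInvariant X P leftTranslations := by
  rintro _ ⟨g, rfl⟩
  exact identDistrib_of_covariance_eq hX hG fun g₁ g₂ => h g⁻¹ g₁ g₂

/-- Almost sure convergence in the Gaussian space carries covariances along. The covariance of `X`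
is thus the sum of those of its components, each a function of `h⁻¹ g` alone. -/
theorem HasHarmonicExpansion.leftInvariantCovariance (h : HasHarmonicExpansion X P)
    (hX : Measurable (Function.uncurry X)) (hG : IsComplexGaussianField P X)
    (ho : ∀ n n', n ≠ n' → ∀ g g',
      ∫ ω, degreeComponent X n ω g * conj (degreeComponent X n' ω g') ∂P = 0)
    {K : (n : ℕ) → Fin (n + 1) → Fin (n + 1) → ℂ}
    (hK : ∀ n i j i' j', ∫ ω, fourierCoeffSU2 X n i j ω * conj (fourierCoeffSU2 X n i' j' ω) ∂P =
      if i = i' then K n j j' else 0) : LeftInvariantCovariance X P := by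
  have hY := fun g n => inGaussianSpace_degreeComponent hX hG h.1 n g
  have hlim : ∀ g g', Tendsto (fun N => ∑ n ∈ Finset.range N,
      ∫ ω, degreeComponent X n ω g * conj (degreeComponent X n ω g') ∂P) atTop
      (𝓝 (∫ ω, X ω g * conj (X ω g') ∂P)) := by
    intro g g'
    refine (tendsto_integral_mul_conj_of_tendsto_ae hG
      (fun N => InGaussianSpace.sum (Finset.range N) fun n _ => hY g n)
      (fun N => InGaussianSpace.sum (Finset.range N) fun n _ => hY g' n)
      (h.2 g) (h.2 g')).congr fun N => ?_
    simp_rw [map_sum, Finset.sum_mul_sum]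
    rw [integral_finsetSum _ fun n _ => integrable_finsetSum _ fun n' _ =>
      (hY g n).integrable_mul_conj (hY g' n')]
    refine Finset.sum_congr rfl fun n hn => ?_
    rw [integral_finsetSum _ fun n' _ => (hY g n).integrable_mul_conj (hY g' n'),
      Finset.sum_eq_single n]
    · intro n' _ hn'
      exact ho n n' hn'.symm g g'
    · exact fun hn' => absurd hn hn'
  intro k g₁ g₂
  refine tendsto_nhds_unique (hlim (k * g₁) (k * g₂)) ((hlim g₁ g₂).congr fun N => ?_)
  refine Finset.sum_congr rfl fun n _ => ?_
  rw [integral_degreeComponent_mul_conj_of_scalar hX hG h.1 (hK n),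
    integral_degreeComponent_mul_conj_of_scalar hX hG h.1 (hK n), mul_inv_rev, mul_assoc,
    inv_mul_cancel_left]

/-! ### The three characterizations -/

theorem integral_mul_conj_eq_zero_of_indepFun (hG : IsComplexGaussianField P X) {Y Z : Ω → ℂ}
    (hY : InGaussianSpace X P Y) (hZ : InGaussianSpace X P Z) (h : IndepFun Y Z P) :
    ∫ ω, Y ω * conj (Z ω) ∂P = 0 := by
  have h1 : IndepFun Y (fun ω => conj (Z ω)) P :=
    h.comp measurable_id Complex.continuous_conj.measurable
  rw [h1.integral_fun_mul_eq_mul_integral hY.memLp.aestronglyMeasurable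
    hZ.memLp.star.aestronglyMeasurable, hY.integral_eq_zero hG, zero_mul]

theorem stronglyInvariant_leftTranslations_iff (hX : Measurable (Function.uncurry X))
    (hG : IsComplexGaussianField P X) :
    StronglyInvariant X P leftTranslations ↔
      HasHarmonicExpansion X P ∧
      iIndepFun (fun n ω => degreeComponent X n ω) P ∧
      (∃ σ : (n : ℕ) → Fin (n + 1) → ℝ, ∀ n s,
        HasComplexNormalLaw P (fun m => fourierCoeffSU2 X n m s)
          (((σ n s : ℂ) ^ 2) • (1 : Matrix (Fin (n + 1)) (Fin (n + 1)) ℂ))) ∧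
      (∃ K : (n : ℕ) → Fin (n + 1) → Fin (n + 1) → ℂ, ∀ n s s',
        crossCovariance P (fun m => fourierCoeffSU2 X n m s) (fun m => fourierCoeffSU2 X n m s')
          = K n s s' • (1 : Matrix (Fin (n + 1)) (Fin (n + 1)) ℂ)) := by
  constructor
  · intro h
    have hc := h.leftInvariantCovariance
    exact ⟨hc.hasHarmonicExpansion hX hG, hc.iIndepFun_degreeComponent hX hG,
      ⟨_, fun n s => hc.hasComplexNormalLaw hX hG n s⟩,
      ⟨_, fun n s s' => hc.crossCovariance_eq hX hG n s s'⟩⟩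
  · rintro ⟨hexp, hind, -, K, hK⟩
    refine (hexp.leftInvariantCovariance hX hG (K := K) (fun n n' hn g g' => ?_)
      fun n i j i' j' => ?_).stronglyInvariant hX hG
    · exact integral_mul_conj_eq_zero_of_indepFun hG
        (inGaussianSpace_degreeComponent hX hG hexp.1 n g)
        (inGaussianSpace_degreeComponent hX hG hexp.1 n' g')
        ((hind.indepFun hn).comp (measurable_pi_apply g) (measurable_pi_apply g'))
    · have := congrFun (congrFun (hK n j j') i) i'
      simpa [crossCovariance, Matrix.one_apply] using this

theorem stronglyInvariant_rightTranslations_iff (hX : Measurable (Function.uncurry X))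
    (hG : IsComplexGaussianField P X) :
    StronglyInvariant X P rightTranslations ↔
      HasHarmonicExpansion X P ∧
      iIndepFun (fun n ω => degreeComponent X n ω) P ∧
      (∃ σ : (n : ℕ) → Fin (n + 1) → ℝ, ∀ n m,
        HasComplexNormalLaw P (fun s => fourierCoeffSU2 X n m s)
          (((σ n m : ℂ) ^ 2) • (1 : Matrix (Fin (n + 1)) (Fin (n + 1)) ℂ))) ∧
      (∃ K : (n : ℕ) → Fin (n + 1) → Fin (n + 1) → ℂ, ∀ n m m',
        crossCovariance P (fun s => fourierCoeffSU2 X n m s) (fun s => fourierCoeffSU2 X n m' s)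
          = K n m m' • (1 : Matrix (Fin (n + 1)) (Fin (n + 1)) ℂ)) := by
  rw [← stronglyInvariant_transposeField_iff, stronglyInvariant_leftTranslations_iff
    (measurable_transposeField hX) (isComplexGaussianField_transposeField hG)]
  simp_rw [fourierCoeffSU2_transposeField]
  exact and_congr ⟨fun h => h.transposeField, fun h => h.transposeField⟩
    (and_congr_left' ⟨fun h => iIndepFun_degreeComponent_transposeField
      (X := transposeField X) h, fun h => iIndepFun_degreeComponent_transposeField h⟩)

/-- Left invariance gives the factor `δ_{ii'}` and right invariance the factor `δ_{jj'}`, so all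
coefficients are orthogonal, hence independent. Conversely, a variance depending on the degree only
fits the left criterion both for `X` and for its transpose. -/
theorem stronglyInvariant_biTranslations_iff (hX : Measurable (Function.uncurry X))
    (hG : IsComplexGaussianField P X) :
    StronglyInvariant X P biTranslations ↔
      HasHarmonicExpansion X P ∧
      iIndepFun (fun (p : Σ n : ℕ, Fin (n + 1) × Fin (n + 1)) ω =>
        fourierCoeffSU2 X p.1 p.2.1 p.2.2 ω) P ∧
      (∃ σ : ℕ → ℝ, ∀ n s,
        HasComplexNormalLaw P (fun m => fourierCoeffSU2 X n m s)
          (((σ n : ℂ) ^ 2) • (1 : Matrix (Fin (n + 1)) (Fin (n + 1)) ℂ))) := by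
  have hXt := measurable_transposeField hX
  have hGt := isComplexGaussianField_transposeField hG
  constructor
  · intro h
    have hl := h.left_of_bi.leftInvariantCovariance
    have hr := (stronglyInvariant_transposeField_iff.2 h.right_of_bi).leftInvariantCovariance
    have hL := hl.ae_memLp hX hG
    have hc : ∀ n (i j i' j' : Fin (n + 1)),
        ∫ ω, fourierCoeffSU2 X n i j ω * conj (fourierCoeffSU2 X n i' j' ω) ∂P =
          if j = j' then covarianceCoeff (transposeField X) P n i i' else 0 := by
      intro n i j i' j'
      have := hr.integral_coeff_mul_conj hXt hGt j i j' i'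
      simpa only [fourierCoeffSU2_transposeField] using this
    -- The diagonal coefficient is the variance of `a_{0s}`, which right invariance makes
    -- independent of `s`.
    have hconst : ∀ n (s : Fin (n + 1)), covarianceCoeff X P n s s = covarianceCoeff X P n 0 0 := by
      intro n s
      have h1 : ∀ s, covarianceCoeff X P n s s =
          covarianceCoeff (transposeField X) P n 0 0 := by
        intro s
        have h2 := hl.integral_coeff_mul_conj hX hG 0 s 0 s
        rw [if_pos rfl, hc, if_pos rfl] at h2
        exact h2.symm
      rw [h1, h1]
    refine ⟨hl.hasHarmonicExpansion hX hG, ?_,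
      fun n => √(covarianceCoeff X P n 0 0).re, fun n s => ?_⟩
    · have hind := iIndepFun_of_orthogonal hG
        (ι := Σ n : ℕ, Fin (n + 1) × Fin (n + 1)) (κ := fun _ => Unit)
        (V := fun p _ => fourierCoeffSU2 X p.1 p.2.1 p.2.2)
        (fun p _ => inGaussianSpace_fourierCoeffSU2 hX hG hL _ _ _) ?_
      · exact hind.comp (fun _ (x : Unit → ℂ) => x ()) fun _ => measurable_pi_apply _
      · rintro ⟨n, i, j⟩ ⟨n', i', j'⟩ hne - -
        by_cases hn : n = n'
        · subst hn
          by_cases hi : i = i'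
          · rw [hc, if_neg]
            rintro rfl
            exact hne (by rw [hi])
          · rw [hl.integral_coeff_mul_conj hX hG, if_neg hi]
        · exact hl.integral_coeff_mul_conj_of_ne hX hG hn i j i' j'
    · change HasComplexNormalLaw P _ (((√(covarianceCoeff X P n 0 0).re : ℝ) : ℂ) ^ 2 • 1)
      rw [← hconst n s]
      exact hl.hasComplexNormalLaw hX hG n s
  · rintro ⟨hexp, hind, σ, hσ⟩
    have hmem := inGaussianSpace_fourierCoeffSU2 hX hG hexp.1
    have hne : ∀ (p q : Σ n : ℕ, Fin (n + 1) × Fin (n + 1)), p ≠ q →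
        ∫ ω, fourierCoeffSU2 X p.1 p.2.1 p.2.2 ω *
          conj (fourierCoeffSU2 X q.1 q.2.1 q.2.2 ω) ∂P = 0 := fun p q hpq =>
      integral_mul_conj_eq_zero_of_indepFun hG (hmem _ _ _) (hmem _ _ _) (hind.indepFun hpq)
    have heq : ∀ n (i j : Fin (n + 1)),
        ∫ ω, fourierCoeffSU2 X n i j ω * conj (fourierCoeffSU2 X n i j ω) ∂P =
          (σ n : ℂ) ^ 2 := by
      intro n i j
      have := congrFun (congrFun (hσ n j).2 i) i
      simpa [crossCovariance] using this
    have hK : ∀ n (i j i' j' : Fin (n + 1)),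
        ∫ ω, fourierCoeffSU2 X n i j ω * conj (fourierCoeffSU2 X n i' j' ω) ∂P =
          if i = i' then if j = j' then (σ n : ℂ) ^ 2 else 0 else 0 := by
      intro n i j i' j'
      split_ifs with h1 h2
      · rw [h1, h2, heq]
      · exact hne ⟨n, i, j⟩ ⟨n, i', j'⟩ (by simp [h2])
      · exact hne ⟨n, i, j⟩ ⟨n, i', j'⟩ (by simp [h1])
    have ho : ∀ n n', n ≠ n' → ∀ g g',
        ∫ ω, degreeComponent X n ω g * conj (degreeComponent X n' ω g') ∂P = 0 := by
      intro n n' hn g g'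
      rw [integral_degreeComponent_mul_conj_eq_sum hX hG hexp.1]
      have h0 : ∀ i j i' j',
          ∫ ω, fourierCoeffSU2 X n i j ω * conj (fourierCoeffSU2 X n' i' j' ω) ∂P = 0 :=
        fun i j i' j' => hne ⟨n, i, j⟩ ⟨n', i', j'⟩ fun h => hn (congrArg Sigma.fst h)
      simp [h0]
    refine StronglyInvariant.bi
      ((hexp.leftInvariantCovariance hX hG ho hK).stronglyInvariant hX hG)
      (stronglyInvariant_transposeField_iff.1
        ((hexp.transposeField.leftInvariantCovariance hXt hGt (fun n n' hn g g' => ?_)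
          (K := fun n j j' => if j = j' then (σ n : ℂ) ^ 2 else 0)
          fun n i j i' j' => ?_).stronglyInvariant hXt hGt))
    · simp_rw [degreeComponent_transposeField]
      exact ho n n' hn _ _
    · simp_rw [fourierCoeffSU2_transposeField]
      rw [hK]
      split_ifs <;> rfl

end Invariance

theorem mainTheorem12 {Ω : Type*} [MeasurableSpace Ω] (P : Measure Ω) [IsProbabilityMeasure P]
    (X : Ω → SU2 → ℂ) (hX : Measurable (Function.uncurry X))
    (hG : IsComplexGaussianField P X) :
    -- 2-weak and strong invariance are equivalent
    (TwoWeaklyInvariant X P leftTranslations ↔ StronglyInvariant X P leftTranslations) ∧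
    (TwoWeaklyInvariant X P rightTranslations ↔ StronglyInvariant X P rightTranslations) ∧
    (TwoWeaklyInvariant X P biTranslations ↔ StronglyInvariant X P biTranslations) ∧
    -- left-invariance: conditions on the columns of the matrices of coefficients
    (StronglyInvariant X P leftTranslations ↔
      HasHarmonicExpansion X P ∧
      iIndepFun (fun n ω => degreeComponent X n ω) P ∧
      (∃ σ : (n : ℕ) → Fin (n + 1) → ℝ, ∀ n s,
        HasComplexNormalLaw P (fun m => fourierCoeffSU2 X n m s)
          (((σ n s : ℂ) ^ 2) • (1 : Matrix (Fin (n + 1)) (Fin (n + 1)) ℂ))) ∧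
      (∃ K : (n : ℕ) → Fin (n + 1) → Fin (n + 1) → ℂ, ∀ n s s',
        crossCovariance P (fun m => fourierCoeffSU2 X n m s) (fun m => fourierCoeffSU2 X n m s')
          = K n s s' • (1 : Matrix (Fin (n + 1)) (Fin (n + 1)) ℂ))) ∧
    -- right-invariance: the same conditions on the rows
    (StronglyInvariant X P rightTranslations ↔
      HasHarmonicExpansion X P ∧
      iIndepFun (fun n ω => degreeComponent X n ω) P ∧
      (∃ σ : (n : ℕ) → Fin (n + 1) → ℝ, ∀ n m,
        HasComplexNormalLaw P (fun s => fourierCoeffSU2 X n m s)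
          (((σ n m : ℂ) ^ 2) • (1 : Matrix (Fin (n + 1)) (Fin (n + 1)) ℂ))) ∧
      (∃ K : (n : ℕ) → Fin (n + 1) → Fin (n + 1) → ℂ, ∀ n m m',
        crossCovariance P (fun s => fourierCoeffSU2 X n m s) (fun s => fourierCoeffSU2 X n m' s)
          = K n m m' • (1 : Matrix (Fin (n + 1)) (Fin (n + 1)) ℂ))) ∧
    -- bi-invariance
    (StronglyInvariant X P biTranslations ↔
      HasHarmonicExpansion X P ∧
      iIndepFun (fun (p : Σ n : ℕ, Fin (n + 1) × Fin (n + 1)) ω =>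
        fourierCoeffSU2 X p.1 p.2.1 p.2.2 ω) P ∧
      (∃ σ : ℕ → ℝ, ∀ n s,
        HasComplexNormalLaw P (fun m => fourierCoeffSU2 X n m s)
          (((σ n : ℂ) ^ 2) • (1 : Matrix (Fin (n + 1)) (Fin (n + 1)) ℂ)))) := by
  exact ⟨twoWeaklyInvariant_iff_stronglyInvariant hX hG _,
    twoWeaklyInvariant_iff_stronglyInvariant hX hG _,
    twoWeaklyInvariant_iff_stronglyInvariant hX hG _,
    stronglyInvariant_leftTranslations_iff hX hG, stronglyInvariant_rightTranslations_iff hX hG,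
    stronglyInvariant_biTranslations_iff hX hG⟩
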